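/- Let $n \ge 2$, let $T^{2n} = \mathbb{R}^{2n}/\mathbb{Z}^{2n}$, and let $\omega$ be a translation-invariant symplectic form on $T^{2n}$. Let $I \subseteq \mathbb{R}$ be an open interval containing $0$, and let $\nabla^t$ ($t \in I$) be an analytic curve of analytic symplectic connections on $(T^{2n},\omega)$: each $\nabla^t$ is a torsion-free linear connection on the tangent bundle with $\nabla^t\omega = 0$, and for all analytic vector fields $X, Y$ the field $\nabla^t_X Y$ is real analytic jointly in $t \in I$ and in the point of $T^{2n}$. Assume that $\nabla^0$ is the standard flat connection on $T^{2n}$ (the one for which translation-invariant vector fields are parallel). Let $R^t(X,Y)Z = \nabla^t_X\nabla^t_Y Z - \nabla^t_Y\nabla^t_X Z - \nabla^t_{[X,Y]}Z$ be the curvature, $R^t(X,Y;Z,T) = \omega(R^t(X,Y)Z,T)$, let $r^t(X,Y) = \operatorname{Trace}[Z \mapsto R^t(X,Z)Y]$ be the Ricci tensor, and put $$E^t(X,Y;Z,T) = \frac{-1}{2(n+1)}\bigl[2\omega(X,Y)r^t(Z,T) + \omega(X,Z)r^t(Y,T) + \omega(X,T)r^t(Y,Z) - \omega(Y,Z)r^t(X,T)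 - \omega(Y,T)r^t(X,Z)\bigr],$$ $W^t = R^t - E^t$. If $\nabla^t$ is of Ricci type, i.e. $W^t = 0$, for all $t \in I$, then the curvature $R^t$ vanishes for all $t \in I$. -/

import Mathlib

open scoped ContDiff

noncomputable section

namespace TorusConnection

/-- Tangent vectors of the torus `(ℝ/ℤ)^m`, in the frame of translation-invariant fields. -/
abbrev Vec (m : ℕ) : Type := Fin m → ℝ

/-- The torus `(ℝ/ℤ)^m`. -/
abbrev Torus (m : ℕ) : Type := UnitAddTorus (Fin m)

/-- The covering projection `ℝ^m → (ℝ/ℤ)^m`. -/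
def proj {m : ℕ} (x : Vec m) : Torus m := fun i => (x i : UnitAddCircle)

/-- `f` is smooth on the torus: its (periodic) lift to `ℝ^m` is smooth. -/
def IsSmooth {m : ℕ} {F : Type*} [NormedAddCommGroup F] [NormedSpace ℝ F]
    (f : Torus m → F) : Prop :=
  ContDiff ℝ ∞ (fun x : Vec m => f (proj x))

/-- `f` is real analytic on the torus: its (periodic) lift to `ℝ^m` is real analytic. -/
def IsAnalytic {m : ℕ} {F : Type*} [NormedAddCommGroup F] [NormedSpace ℝ F]
    (f : Torus m → F) : Prop :=
  AnalyticOnNhd ℝ (fun x : Vec m => f (proj x)) Set.univ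

/-- A vector field on the torus, written in the frame of translation-invariant fields. -/
abbrev Field (m : ℕ) : Type := Torus m → Vec m

/-- The translation-invariant vector field with value `v`. -/
def invField {m : ℕ} (v : Vec m) : Field m := fun _ => v

/-- The derivative `X · f` of a function `f` along the vector field `X`: at `p` it is the
derivative of `f` at `s = 0` along the curve `s ↦ p + s X(p)`. -/
def along {m : ℕ} {F : Type*} [NormedAddCommGroup F] [NormedSpace ℝ F]
    (X : Field m) (f : Torus m → F) : Torus m → F :=
  fun p => deriv (fun s : ℝ => f (p + proj (s • X p))) 0

/-- The Lie bracket `[X, Y]`. As the invariant frame consists of commuting fields, its components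
are `X · Y^a - Y · X^a`. -/
def bracket {m : ℕ} (X Y : Field m) : Field m := along X Y - along Y X

/-- A linear connection (Koszul covariant derivative) on the tangent bundle of the torus. Only its
values on smooth vector fields are meaningful. -/
structure Connection (m : ℕ) where
  /-- `cov X Y` is `∇_X Y`. -/
  cov : Field m → Field m → Field m
  smooth : ∀ X Y, IsSmooth X → IsSmooth Y → IsSmooth (cov X Y)
  add_left : ∀ X X' Y, IsSmooth X → IsSmooth X' → IsSmooth Y →
    cov (X + X') Y = cov X Y + cov X' Y
  smul_left : ∀ (f : Torus m → ℝ) X Y, IsSmooth f → IsSmooth X → IsSmooth Y →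
    cov (f • X) Y = f • cov X Y
  add_right : ∀ X Y Y', IsSmooth X → IsSmooth Y → IsSmooth Y' →
    cov X (Y + Y') = cov X Y + cov X Y'
  leibniz : ∀ (f : Torus m → ℝ) X Y, IsSmooth f → IsSmooth X → IsSmooth Y →
    cov X (f • Y) = along X f • Y + f • cov X Y

namespace Connection

variable {m : ℕ}

/-- `D` is the standard flat connection of the torus: the translation-invariant fields are
parallel. -/
def IsStandard (D : Connection m) : Prop :=
  ∀ u v : Vec m, D.cov (invField u) (invField v) = 0

/-- `D` has no torsion: `∇_X Y - ∇_Y X = [X, Y]`. -/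
def TorsionFree (D : Connection m) : Prop :=
  ∀ X Y, IsSmooth X → IsSmooth Y → D.cov X Y - D.cov Y X = bracket X Y

/-- The translation-invariant 2-form `Ω` is parallel for `D`:
`X · Ω(Y, Z) = Ω(∇_X Y, Z) + Ω(Y, ∇_X Z)`. -/
def Preserves (D : Connection m) (Ω : LinearMap.BilinForm ℝ (Vec m)) : Prop :=
  ∀ X Y Z, IsSmooth X → IsSmooth Y → IsSmooth Z → ∀ p,
    along X (fun q => Ω (Y q) (Z q)) p = Ω (D.cov X Y p) (Z p) + Ω (Y p) (D.cov X Z p)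

/-- `D` is a symplectic connection for `Ω`. -/
def IsSymplectic (D : Connection m) (Ω : LinearMap.BilinForm ℝ (Vec m)) : Prop :=
  D.TorsionFree ∧ D.Preserves Ω

/-- The curvature `R(X, Y)Z = ∇_X ∇_Y Z - ∇_Y ∇_X Z - ∇_{[X,Y]} Z`. -/
def curv (D : Connection m) (X Y Z : Field m) : Field m :=
  D.cov X (D.cov Y Z) - D.cov Y (D.cov X Z) - D.cov (bracket X Y) Z

/-- The Ricci tensor `r(X, Y) = Trace [Z ↦ R(X, Z) Y]`, the trace being taken in the invariant
frame. -/
def ricci (D : Connection m) (X Y : Field m) (p : Torus m) : ℝ :=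
  ∑ i, D.curv X (invField (Pi.single i 1)) Y p i

/-- The Ricci part `E(X, Y; Z, T)` of the symplectic curvature tensor of a connection on the
`2n`-dimensional torus with symplectic form `Ω`. -/
def ricciPart {n : ℕ} (D : Connection (2 * n)) (Ω : LinearMap.BilinForm ℝ (Vec (2 * n)))
    (X Y Z T : Field (2 * n)) (p : Torus (2 * n)) : ℝ :=
  -1 / (2 * ((n : ℝ) + 1)) *
    (2 * Ω (X p) (Y p) * D.ricci Z T p
      + Ω (X p) (Z p) * D.ricci Y T p + Ω (X p) (T p) * D.ricci Y Z p
      - Ω (Y p) (Z p) * D.ricci X T p - Ω (Y p) (T p) * D.ricci X Z p)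

/-- The component `W = R - E` of the symplectic curvature tensor
`R(X, Y; Z, T) = Ω(R(X, Y)Z, T)`. -/
def weylPart {n : ℕ} (D : Connection (2 * n)) (Ω : LinearMap.BilinForm ℝ (Vec (2 * n)))
    (X Y Z T : Field (2 * n)) (p : Torus (2 * n)) : ℝ :=
  Ω (D.curv X Y Z p) (T p) - D.ricciPart Ω X Y Z T p

/-- The curvature is of Ricci type: `W = 0`. -/
def IsRicciType {n : ℕ} (D : Connection (2 * n)) (Ω : LinearMap.BilinForm ℝ (Vec (2 * n))) :
    Prop :=
  ∀ X Y Z T, IsSmooth X → IsSmooth Y → IsSmooth Z → IsSmooth T →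
    ∀ p, D.weylPart Ω X Y Z T p = 0

/-- The curvature vanishes. -/
def IsFlat (D : Connection m) : Prop :=
  ∀ X Y Z, IsSmooth X → IsSmooth Y → IsSmooth Z → D.curv X Y Z = 0

end Connection

/-- `t ↦ D t`, `t ∈ I`, is an analytic curve of analytic connections: for analytic vector fields
`X, Y`, the field `∇^t_X Y` is (jointly) real analytic in the parameter `t ∈ I` and the point of
the torus. In particular each `∇^t` maps analytic fields to analytic fields. -/
def IsAnalyticCurve {m : ℕ} (I : Set ℝ) (D : ℝ → Connection m) : Prop :=
  ∀ X Y, IsAnalytic X → IsAnalytic Y →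
    AnalyticOnNhd ℝ (fun q : ℝ × Vec m => (D q.1).cov X Y (proj q.2)) (I ×ˢ Set.univ)

end TorusConnection

end

/-! ### Translation-invariant connections of Ricci type. -/

section

open Matrix

/-! For a connection of Ricci type the curvature is encoded in one endomorphism P, the Ricci tensor
with an index raised and rescaled. Write W for the matrix of ω. The second Bianchi identity forces
∇P to be given by a covector u (`RicciTypeData.exists_covP_eq`), and the commutator of covariant
derivatives on P forces ∇u to be given by P² and a function f (`RicciTypeData.exists_cov_u`). Hence
there is a linear connection B on a trivial bundle of rank 2n + 2, preserving a symplectic form,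
whose curvature is W ⊗ a for an endomorphism a assembled from P, u and f
(`RicciTypeData.tractor_curvature`). The Bianchi identity of B makes a parallel
(`parallel_of_curvature`).

At time 0 the matrices of B are constant and nilpotent. Since every function on a torus is a
derivative up to a function constant in the direction concerned, B and a can be made constant by a
periodic gauge transformation that is a formal power series in t starting at the identity
(`IsTorusLike.exists_constant_gauge`). For constant matrices b_i and a' the curvature equation and
parallelism become [b_i, b_j] = W_ij a' and [a', b_i] = 0: a representation of the Heisenberg
algebra by symplectic matrices. In a suitable basis it has the shape of the bundle data of a
translation-invariant connection of Ricci type. For n ≥ 2 such a connection has P = 0 by pure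
algebra (`eq_zero_of_constant_ricciType`), so all 2 × 2 minors of a' vanish
(`heisenberg_center_rank_one`). This property survives conjugation, so it holds for a, and the shape
of a then forces P = 0 (`RicciTypeData.formal_eq_zero`).

The power series are Taylor expansions in t at 0. As P is analytic in time, it vanishes once its
Taylor series does, and P = 0 means zero curvature. A reparametrisation gives a curve defined for
all times, and the identity theorem extends flatness from a neighbourhood of 0 to I. -/

/-- The defining identity of a curvature of Ricci type in a frame, for curvature endomorphisms
`R i j`, symplectic matrix `W` and Ricci endomorphism `P`. -/
def RicciTypeIdentity {ι K : Type*} [Fintype ι] [DecidableEq ι] [CommRing K]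
    (W P : Matrix ι ι K) (R : ι → ι → Matrix ι ι K) : Prop :=
  ∀ i j a k, 2 * R i j a k = 2 * W i j * P a k - (1 : Matrix ι ι K) a i * (W * P) j k
    + (1 : Matrix ι ι K) a j * (W * P) i k - P a i * W j k + P a j * W i k

section ConstantRicci

set_option linter.unusedSectionVars false

variable {ι K : Type*} [Fintype ι] [DecidableEq ι] [CommRing K]

theorem Matrix.IsSymm.swap {M : Matrix ι ι K} (h : M.IsSymm) (i j : ι) : M i j = M j i :=
  (congrFun (congrFun h i) j).symm

theorem Matrix.skew_swap {M : Matrix ι ι K} (h : Mᵀ = -M) (i j : ι) : M i j = -M j i := by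
  have := congrFun (congrFun h j) i
  simpa using this

/-- P is the product of the skew matrix V and the symmetric matrix W P, so transposition changes the
sign of its trace. -/
theorem Matrix.trace_eq_zero_of_symm_lower [IsDomain K] [CharZero K] {W V P : Matrix ι ι K}
    (hW : Wᵀ = -W) (hV : W * V = 1) (hP : (W * P).IsSymm) : P.trace = 0 := by
  have hV' : V * W = 1 := mul_eq_one_comm.mp hV
  have hVt : Vᵀ = -V := by
    have h1 : Vᵀ * W = -1 := by
      have := congrArg transpose hV
      rw [transpose_mul, hW, transpose_one] at this
      rw [← this]; simp
    calc Vᵀ = Vᵀ * W * V := by rw [Matrix.mul_assoc, hV, Matrix.mul_one]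
      _ = -V := by rw [h1]; simp
  have hPe : P = V * (W * P) := by rw [← Matrix.mul_assoc, hV', Matrix.one_mul]
  have h2 : P.trace = -P.trace := by
    conv_lhs => rw [hPe, ← trace_transpose, transpose_mul, hP.eq, hVt, trace_mul_comm]
    rw [Matrix.neg_mul, trace_neg, ← hPe]
  exact self_eq_neg.mp h2

variable [IsDomain K] [CharZero K]

/-- The entry (W A_k A_i)_{lj} is the W-pairing of the vectors A_i e_j and A_k e_l. It is therefore
symmetric in (i, j), symmetric in (k, l), and skew under exchange of the two pairs. The six products
in three curvature identities thus reduce, up to sign, to the three splittings of {i, j, k, l} into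
pairs, and the three equations can be solved for each. So the commutators determine the products
themselves. -/
theorem product_of_ricciType {W V P : Matrix ι ι K} {A : ι → Matrix ι ι K}
    (hW : Wᵀ = -W) (hV : W * V = 1) (hA : ∀ i a j, A i a j = A j a i)
    (hAW : ∀ i, (W * A i).IsSymm) (hP : (W * P).IsSymm)
    (hR : RicciTypeIdentity W P fun i j => A i * A j - A j * A i) (k i a j : ι) :
    2 * (A k * A i) a j = -W i k * P a j + (W * P) j k * (1 : Matrix ι ι K) a i
      - W j k * P a i + (W * P) i k * (1 : Matrix ι ι K) a j := by
  have hV' : V * W = 1 := mul_eq_one_comm.mp hV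
  have hlow : ∀ k i l j, (W * (A k * A i)) l j = -(W * (A i * A k)) j l := by
    intro k i l j
    have h1 : (W * (A k * A i))ᵀ = -(W * (A i * A k)) := by
      rw [← Matrix.mul_assoc, transpose_mul, (hAW k).eq, ← Matrix.mul_assoc, ← Matrix.mul_assoc]
      have := (hAW i).eq
      rw [transpose_mul, hW] at this
      rw [← this]; simp
    have := congrFun (congrFun h1 j) l
    simpa using this
  have hsym : ∀ k i l j, (W * (A k * A i)) l j = (W * (A k * A j)) l i := by
    intro k i l j
    simp only [← Matrix.mul_assoc]
    rw [mul_apply, mul_apply]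
    exact Finset.sum_congr rfl fun b _ => by rw [hA i b j]
  have hRl : ∀ i j l k, 2 * ((W * (A i * A j)) l k - (W * (A j * A i)) l k) =
      2 * W i j * (W * P) l k - W l i * (W * P) j k + W l j * (W * P) i k - (W * P) l i * W j k
        + (W * P) l j * W i k := by
    intro i j l k
    have h1 : (W * (A i * A j)) l k - (W * (A j * A i)) l k
        = ∑ a, W l a * ((fun i j => A i * A j - A j * A i) i j a k) := by
      simp [mul_apply, Matrix.sub_apply, mul_sub, Finset.sum_sub_distrib]
    rw [h1, Finset.mul_sum]
    have h2 : ∀ a, 2 * (W l a * ((fun i j => A i * A j - A j * A i) i j a k))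
        = W l a * (2 * W i j * P a k - (1 : Matrix ι ι K) a i * (W * P) j k
    + (1 : Matrix ι ι K) a j * (W * P) i k - P a i * W j k + P a j * W i k) := by
      intro a
      rw [← hR i j a k]; ring
    simp only [h2, mul_sub, mul_add, Finset.sum_sub_distrib, Finset.sum_add_distrib, one_apply]
    simp only [mul_ite, ite_mul, one_mul, zero_mul, mul_zero,
      Finset.sum_ite_eq', Finset.mem_univ, if_true]
    congr 1
    · congr 1
      · congr 1
        · congr 1
          rw [mul_apply, Finset.mul_sum]
          exact Finset.sum_congr rfl fun b _ => by ring
      · rw [mul_apply, Finset.sum_mul]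
        exact Finset.sum_congr rfl fun b _ => by ring
    · rw [mul_apply, Finset.sum_mul]
      exact Finset.sum_congr rfl fun b _ => by ring
  have hres : ∀ l, 2 * (W * (A k * A i)) l j = -W i k * (W * P) l j + (W * P) j k * W l i
      - W j k * (W * P) l i + (W * P) i k * W l j := by
    intro l
    have key : (2 : K) * (2 * (W * (A k * A i)) l j - (-W i k * (W * P) l j + (W * P) j k * W l i
      - W j k * (W * P) l i + (W * P) i k * W l j)) = 0 := by
      have B1 : ∀ x y z u, (W * (A z * A x)) u y = (W * (A z * A y)) u x :=
        fun x y z u => hsym z x u y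
      have B2 : ∀ x y z u, (W * (A z * A x)) u y = -(W * (A x * A z)) y u :=
        fun x y z u => hlow z x u y
      have B3 : ∀ x y z u, (W * (A z * A x)) u y = (W * (A u * A x)) z y := by
        intro x y z u
        rw [B2 x y z u, B1 z u x y, ← B2 x y u z]
      have f1 : (W * (A i * A k)) l j = -(W * (A j * A i)) k l := by
        rw [B2 k j i l, B3 i l k j]
      have f2 : (W * (A i * A l)) k j = -(W * (A j * A i)) l k := by
        rw [B2 l j i k, B3 i k l j]
      have f3 : (W * (A l * A i)) k j = (W * (A k * A i)) l j := B3 i j l k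
      have f4 : (W * (A i * A j)) l k = -(W * (A j * A i)) k l := B2 j k i l
      have e1 := hRl i k l j
      have e2 := hRl i l k j
      have e3 := hRl i j l k
      rw [f1] at e1
      rw [f2, f3] at e2
      rw [f4] at e3
      simp only [hP.swap l j, hP.swap l k, hP.swap l i, hP.swap k i, hP.swap k j,
        Matrix.skew_swap hW l j, Matrix.skew_swap hW l k, Matrix.skew_swap hW l i,
        Matrix.skew_swap hW k i, Matrix.skew_swap hW k j] at e1 e2 e3 ⊢
      linear_combination -e1 - e2 + e3
    have := (mul_eq_zero.mp key).resolve_left two_ne_zero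
    exact sub_eq_zero.mp this
  have h1 : ∀ M : Matrix ι ι K, M a j = ∑ l, V a l * (W * M) l j := by
    intro M
    rw [← mul_apply, ← Matrix.mul_assoc, hV', Matrix.one_mul]
  have h2 : ∀ x, (1 : Matrix ι ι K) a x = ∑ l, V a l * W l x := by
    intro x
    rw [← mul_apply, hV']
  have h3 : ∀ x, P a x = ∑ l, V a l * (W * P) l x := by
    intro x
    rw [← mul_apply, ← Matrix.mul_assoc, hV', Matrix.one_mul]
  rw [h1 (A k * A i), h2, h2, h3 j, h3 i]
  simp only [Finset.mul_sum, ← Finset.sum_add_distrib, ← Finset.sum_sub_distrib]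
  refine Finset.sum_congr rfl fun l _ => ?_
  linear_combination V a l * hres l

/-- The product formula evaluates a partial trace of A_k A_i A_s for both bracketings. Comparing
them gives a linear relation on the tensor W P A, which forces P A_k = 0 and then A_k P = 0 when n ≥
2. Multiplying the product formula by P on the right kills its left side and leaves an identity in W
and P alone. Its trace gives P² = 0, and what remains makes the square of every entry of W P vanish.
-/
theorem eq_zero_of_constant_ricciType {n : ℕ} (hn : 2 ≤ n) (hcard : Fintype.card ι = 2 * n)
    {W V P : Matrix ι ι K} {A : ι → Matrix ι ι K}
    (hW : Wᵀ = -W) (hV : W * V = 1) (hA : ∀ i a j, A i a j = A j a i)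
    (hAW : ∀ i, (W * A i).IsSymm) (hP : (W * P).IsSymm)
    (hR : RicciTypeIdentity W P fun i j => A i * A j - A j * A i) : P = 0 := by
  have hV' : V * W = 1 := mul_eq_one_comm.mp hV
  have htr : ∑ i, P i i = 0 := Matrix.trace_eq_zero_of_symm_lower hW hV hP
  have hprod := product_of_ricciType hW hV hA hAW hP hR
  have hWP : ∀ k b, ∑ i, W i k * P i b = -(W * P) k b := by
    intro k b
    rw [mul_apply, ← Finset.sum_neg_distrib]
    exact Finset.sum_congr rfl fun i _ => by rw [Matrix.skew_swap hW i k]; ring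
  have hdiag : ∀ k b, 2 * ∑ i, (A k * A i) i b = (2 * (n : K) + 2) * (W * P) k b := by
    intro k b
    rw [Finset.mul_sum]
    simp only [hprod k _ _ b]
    simp only [Finset.sum_sub_distrib, Finset.sum_add_distrib, ← Finset.mul_sum, htr, neg_mul,
      Finset.sum_neg_distrib, hWP, one_apply_eq, Finset.sum_const, Finset.card_univ, hcard]
    simp only [one_apply, mul_ite, mul_one, mul_zero, Finset.sum_ite_eq',
      Finset.mem_univ, if_true, nsmul_eq_mul]
    rw [hP.swap b k]
    push_cast
    ring
  have hAP : ∀ k s j, (W * (A k * P)) s j = -(W * P * A k) j s := by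
    intro k s j
    have h1 : (W * (A k * P))ᵀ = -(W * P * A k) := by
      have h2 := hP.eq
      rw [transpose_mul, hW, Matrix.mul_neg] at h2
      rw [← Matrix.mul_assoc, transpose_mul, (hAW k).eq, ← Matrix.mul_assoc, ← h2]
      simp
    have := congrFun (congrFun h1 j) s
    simpa using this
  have ht : ∀ k s j, (2 * (n : K) + 2) * (W * P * A s) k j
      = 2 * (W * P * A k) j s + 2 * (W * P * A k) s j := by
    intro k s j
    -- Bracketing as (A_k A_i) A_s uses only the traced formula `hdiag`; bracketing as A_k (A_i A_s)
    -- in `h2` needs the full product formula.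
    have h1 : 2 * ∑ i, (A k * A i * A s) i j = (2 * (n : K) + 2) * (W * P * A s) k j := by
      simp only [mul_apply (M := A k * A _) (N := A s)]
      rw [Finset.sum_comm, Finset.mul_sum, mul_apply (M := W * P), Finset.mul_sum]
      refine Finset.sum_congr rfl fun b _ => ?_
      rw [← Finset.sum_mul, ← mul_assoc, hdiag, mul_assoc]
    have h2 : 2 * ∑ i, (A k * (A i * A s)) i j
        = 2 * (W * P * A k) j s + 2 * (W * P * A k) s j := by
      have h3 : ∀ i, 2 * (A k * (A i * A s)) i j = ∑ b, A k i b * (-W s i * P b j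
          + (W * P) j i * (1 : Matrix ι ι K) b s - W j i * P b s
          + (W * P) s i * (1 : Matrix ι ι K) b j) := by
        intro i
        rw [mul_apply (M := A k), Finset.mul_sum]
        refine Finset.sum_congr rfl fun b _ => ?_
        rw [← hprod i s b j]; ring
      rw [Finset.mul_sum]
      simp only [h3, mul_add, mul_sub, Finset.sum_add_distrib, Finset.sum_sub_distrib, one_apply,
        mul_ite, mul_one, mul_zero, Finset.sum_ite_eq', Finset.mem_univ, if_true]
      have a1 : ∀ s j, ∑ i, ∑ b, A k i b * (W s i * P b j) = -(W * P * A k) j s := by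
        intro s j
        rw [← hAP, mul_apply]
        refine Finset.sum_congr rfl fun i _ => ?_
        rw [mul_apply, Finset.mul_sum]
        exact Finset.sum_congr rfl fun b _ => by ring
      have a2 : ∀ s j, ∑ i, A k i s * (W * P) j i = (W * P * A k) j s := by
        intro s j
        rw [mul_apply (M := W * P)]
        exact Finset.sum_congr rfl fun b _ => by ring
      simp only [neg_mul, mul_neg, Finset.sum_neg_distrib, a1, a2]
      ring
    rw [← h1, ← h2]
    simp only [Matrix.mul_assoc]
  have hsymA : ∀ k s j, (W * P * A k) j s = (W * P * A s) j k := by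
    intro k s j
    rw [mul_apply, mul_apply]
    exact Finset.sum_congr rfl fun b _ => by rw [hA k b s]
  -- The relation `ht`, taken for the three cyclic permutations of its indices, is a linear system
  -- with determinant proportional to (n - 1)(n + 2)². Dimension two is excluded here.
  have hn0 : ((n : K) - 1) * ((n : K) + 2) ≠ 0 := by
    refine mul_ne_zero (sub_ne_zero.mpr ?_) ?_
    · exact_mod_cast (by omega : n ≠ 1)
    · exact_mod_cast (by omega : n + 2 ≠ 0)
  have hQA : ∀ k, W * P * A k = 0 := by
    intro k
    ext j s
    have e1 := ht k s j
    have e2 := ht j s k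
    have e3 := ht s j k
    rw [hsymA s k j] at e2
    rw [hsymA j k s, hsymA j s k] at *
    rw [hsymA s k j] at e3
    have : 2 * (((n : K) - 1) * ((n : K) + 2)) * (W * P * A k) j s = 0 := by
      linear_combination (n : K) * e2 + e1 + e3
    exact (mul_eq_zero.mp this).resolve_left (mul_ne_zero two_ne_zero hn0)
  have hPA : ∀ k, P * A k = 0 := by
    intro k
    have := congrArg (V * ·) (hQA k)
    simpa [← Matrix.mul_assoc, hV'] using this
  have hAP' : ∀ k, A k * P = 0 := by
    intro k
    have h1 : W * (A k * P) = 0 := by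
      ext s j
      rw [hAP, hQA]; simp
    have := congrArg (V * ·) h1
    simpa [← Matrix.mul_assoc, hV'] using this
  have h0 : ∀ k i a j, -W i k * (P * P) a j + (W * P * P) k j * (1 : Matrix ι ι K) a i
      + (W * P) k j * P a i + (W * P) i k * P a j = 0 := by
    intro k i a j
    have h1 : ∑ b, 2 * (A k * A i) a b * P b j = 0 := by
      simp only [mul_assoc]
      rw [← Finset.mul_sum, ← mul_apply, Matrix.mul_assoc, hAP']
      simp
    simp only [hprod] at h1
    simp only [add_mul, sub_mul, Finset.sum_add_distrib, Finset.sum_sub_distrib, one_apply, mul_ite,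
      ite_mul, mul_one, mul_zero, zero_mul, Finset.sum_ite_eq, Finset.sum_ite_irrel,
      Finset.sum_const_zero, Finset.mem_univ, if_true] at h1
    have b1 : ∑ b, -W i k * P a b * P b j = -W i k * (P * P) a j := by
      rw [mul_apply, Finset.mul_sum]
      exact Finset.sum_congr rfl fun b _ => by ring
    have b2 : ∑ b, (W * P) b k * P b j = (W * P * P) k j := by
      rw [mul_apply (M := W * P)]
      exact Finset.sum_congr rfl fun b _ => by rw [hP.swap b k]
    have b3 : ∑ b, W b k * P a i * P b j = -((W * P) k j * P a i) := by
      rw [← neg_mul, ← hWP, Finset.sum_mul]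
      exact Finset.sum_congr rfl fun b _ => by ring
    rw [b1, b2, b3] at h1
    rw [one_apply]
    simp only [mul_ite, mul_one, mul_zero]
    linear_combination h1
  have hQP : ∀ k j, (W * P * P) k j = 0 := by
    intro k j
    have h1 : ∑ i, (-W i k * (P * P) i j + (W * P * P) k j * (1 : Matrix ι ι K) i i
      + (W * P) k j * P i i + (W * P) i k * P i j) = 0 :=
      Finset.sum_eq_zero fun i _ => h0 k i i j
    simp only [Finset.sum_add_distrib, ← Finset.mul_sum, htr, neg_mul, Finset.sum_neg_distrib,
      one_apply_eq, Finset.sum_const, Finset.card_univ, hcard, nsmul_eq_mul] at h1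
    have c1 : ∑ i, W i k * (P * P) i j = -(W * P * P) k j := by
      rw [Matrix.mul_assoc, mul_apply, ← Finset.sum_neg_distrib]
      exact Finset.sum_congr rfl fun i _ => by rw [Matrix.skew_swap hW i k]; ring
    have c2 : ∑ i, (W * P) i k * P i j = (W * P * P) k j := by
      rw [mul_apply (M := W * P)]
      exact Finset.sum_congr rfl fun b _ => by rw [hP.swap b k]
    rw [c1, c2] at h1
    push_cast at h1
    have h2 : (2 * ((n : K) + 1)) * (W * P * P) k j = 0 := by linear_combination h1
    refine (mul_eq_zero.mp h2).resolve_left (mul_ne_zero two_ne_zero ?_)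
    exact_mod_cast Nat.succ_ne_zero n
  have hPP : P * P = 0 := by
    have h1 : W * P * P = 0 := by
      ext k j
      exact hQP k j
    have := congrArg (V * ·) h1
    simpa [← Matrix.mul_assoc, hV'] using this
  have hQ : W * P = 0 := by
    ext k i
    -- Taking j = i makes the two surviving terms of `h0` equal by symmetry of W P. Lowering a with
    -- W then turns them into a square.
    have h1 : ∀ a, (W * P) k i * P a i + (W * P) i k * P a i = 0 := by
      intro a
      have := h0 k i a i
      rw [hPP, hQP] at this
      simpa using this
    have h2 : ∑ a, W k a * ((W * P) k i * P a i + (W * P) i k * P a i) = 0 :=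
      Finset.sum_eq_zero fun a _ => by rw [h1, mul_zero]
    have h3 : 2 * ((W * P) k i * (W * P) k i) = 0 := by
      rw [← h2]
      conv_lhs => rw [mul_apply (M := W), Finset.mul_sum, Finset.mul_sum]
      refine Finset.sum_congr rfl fun a _ => ?_
      rw [hP.swap i k, mul_apply]
      ring
    have h4 := (mul_eq_zero.mp h3).resolve_left two_ne_zero
    exact mul_self_eq_zero.mp h4
  have := congrArg (V * ·) hQ
  simpa [← Matrix.mul_assoc, hV'] using this

end ConstantRicci

end

/-! ### Representations of the Heisenberg algebra by symplectic matrices. -/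

section

open Matrix

section HeisenbergRepresentation

variable {ι K : Type*} [Fintype ι] [DecidableEq ι] [CommRing K]

/-- The symplectic form of the tractor space `K^ι ⊕ K^2` (up to the factor `2`). -/
def tractorForm (W : Matrix ι ι K) : Matrix (ι ⊕ Fin 2) (ι ⊕ Fin 2) K :=
  fromBlocks (-W) 0 0 !![0, 2; -2, 0]

variable [IsDomain K] [CharZero K]

/-- The inner blocks of b_i and a play the roles of A_i and P for a translation-invariant connection
of Ricci type. The column `Sum.inr 0` of `hbb` gives absence of torsion, skewness gives the symmetry
of W A_i and W P, and the inner block of `hbb` is the Ricci type identity. Hence the inner block of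
a vanishes by `eq_zero_of_constant_ricciType`, and skewness and the commutation relations remove
every other entry except the one prescribed by `ha0`. -/
theorem heisenberg_normalForm {n : ℕ} (hn : 2 ≤ n) (hcard : Fintype.card ι = 2 * n)
    {W V : Matrix ι ι K} (hW : Wᵀ = -W) (hV : W * V = 1)
    {b : ι → Matrix (ι ⊕ Fin 2) (ι ⊕ Fin 2) K} {a : Matrix (ι ⊕ Fin 2) (ι ⊕ Fin 2) K}
    (hb0 : ∀ i x, b i x (Sum.inr 0) = (1 : Matrix (ι ⊕ Fin 2) (ι ⊕ Fin 2) K) x (Sum.inl i))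
    (ha0 : ∀ x, a x (Sum.inr 0) = (1 : Matrix (ι ⊕ Fin 2) (ι ⊕ Fin 2) K) x (Sum.inr 1))
    (hbs : ∀ i, (b i)ᵀ * tractorForm W + tractorForm W * b i = 0)
    (has : aᵀ * tractorForm W + tractorForm W * a = 0)
    (hbb : ∀ i j, b i * b j - b j * b i = W i j • a)
    (hab : ∀ i, a * b i = b i * a) (x y : ι ⊕ Fin 2) :
    a x y = (1 : Matrix (ι ⊕ Fin 2) (ι ⊕ Fin 2) K) x (Sum.inr 1)
      * (1 : Matrix (ι ⊕ Fin 2) (ι ⊕ Fin 2) K) (Sum.inr 0) y := by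
  have hV' : V * W = 1 := mul_eq_one_comm.mp hV
  have hskew : ∀ m : Matrix (ι ⊕ Fin 2) (ι ⊕ Fin 2) K,
      mᵀ * tractorForm W + tractorForm W * m = 0 →
      (∀ j, -(m (Sum.inr 1) (Sum.inl j) * 2) - ∑ x, W j x * m (Sum.inl x) (Sum.inr 0) = 0) ∧
      (∀ j, m (Sum.inr 0) (Sum.inl j) * 2 - ∑ x, W j x * m (Sum.inl x) (Sum.inr 1) = 0) ∧
      (W * m.toBlocks₁₁).IsSymm ∧
      (m (Sum.inr 1) (Sum.inr 1) + m (Sum.inr 0) (Sum.inr 0) = 0) := by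
    intro m hm
    have he : ∀ p q, (mᵀ * tractorForm W + tractorForm W * m) p q = 0 := fun p q => by
      rw [hm]; rfl
    refine ⟨fun j => ?_, fun j => ?_, ?_, ?_⟩
    · have := he (Sum.inl j) (Sum.inr 0)
      simpa [tractorForm, mul_apply, Fintype.sum_sum_type, Fin.sum_univ_two, sub_eq_add_neg] using this
    · have := he (Sum.inl j) (Sum.inr 1)
      simpa [tractorForm, mul_apply, Fintype.sum_sum_type, Fin.sum_univ_two, sub_eq_add_neg] using this
    · ext i j
      have := he (Sum.inl j) (Sum.inl i)
      simp only [tractorForm, Matrix.add_apply, mul_apply, Fintype.sum_sum_type, Fin.sum_univ_two,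
        fromBlocks_apply₁₁, fromBlocks_apply₁₂, fromBlocks_apply₂₁, transpose_apply,
        Matrix.neg_apply, Matrix.zero_apply, mul_zero, zero_mul, add_zero] at this
      simp only [transpose_apply, mul_apply, toBlocks₁₁, of_apply]
      have h2 : ∑ x, m (Sum.inl x) (Sum.inl j) * -W x i
          = ∑ x, W i x * m (Sum.inl x) (Sum.inl j) :=
        Finset.sum_congr rfl fun x _ => by rw [Matrix.skew_swap hW x i]; ring
      rw [h2] at this
      simp only [neg_mul, Finset.sum_neg_distrib] at this
      linear_combination -this
    · have := he (Sum.inr 1) (Sum.inr 0)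
      simp only [tractorForm, Matrix.add_apply, mul_apply, Fintype.sum_sum_type, Fin.sum_univ_two,
        fromBlocks_apply₂₂, fromBlocks_apply₁₂, fromBlocks_apply₂₁, transpose_apply,
        Matrix.zero_apply, mul_zero, zero_mul] at this
      simp at this
      have h2 : (2 : K) * (m (Sum.inr 1) (Sum.inr 1) + m (Sum.inr 0) (Sum.inr 0)) = 0 := by
        linear_combination -this
      exact (mul_eq_zero.mp h2).resolve_left two_ne_zero
  have ha0' : ∀ j, a (Sum.inl j) (Sum.inr 0) = 0 := fun j => by simp [ha0]
  have ha00 : a (Sum.inr 0) (Sum.inr 0) = 0 := by simp [ha0]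
  have ha10 : a (Sum.inr 1) (Sum.inr 0) = 1 := by simp [ha0]
  have f1 : ∀ i j, 2 * b i (Sum.inr 1) (Sum.inl j) = W i j := by
    intro i j
    have h := (hskew _ (hbs i)).1 j
    simp only [hb0, one_apply, Sum.inl.injEq, mul_ite, mul_one, mul_zero, Finset.sum_ite_eq',
      Finset.mem_univ, if_true] at h
    rw [Matrix.skew_swap hW i j]
    linear_combination -h
  have f2 : ∀ j, a (Sum.inr 1) (Sum.inl j) = 0 := by
    intro j
    have h := (hskew _ has).1 j
    simp only [ha0', mul_zero, Finset.sum_const_zero, sub_zero] at h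
    simpa using h
  -- Apply a b_i = b_i a to the basis vector `Sum.inr 0`, which b_i sends to `Sum.inl i` and a sends
  -- to `Sum.inr 1`.
  have f3 : ∀ i x, b i x (Sum.inr 1) = a x (Sum.inl i) := by
    intro i x
    have h := congrFun (congrFun (hab i) x) (Sum.inr 0)
    simp only [mul_apply, hb0, ha0, one_apply, mul_ite, mul_one, mul_zero, Finset.sum_ite_eq',
      Finset.mem_univ, if_true] at h
    exact h.symm
  have f4 : ∀ i j, 2 * b i (Sum.inr 0) (Sum.inl j) = (W * a.toBlocks₁₁) j i := by
    intro i j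
    have h := (hskew _ (hbs i)).2.1 j
    simp only [f3] at h
    simp only [mul_apply, toBlocks₁₁, of_apply]
    linear_combination h
  have f7 : ∀ i x j, (b i).toBlocks₁₁ x j = (b j).toBlocks₁₁ x i := by
    intro i x j
    have h := congrFun (congrFun (hbb i j) (Sum.inl x)) (Sum.inr 0)
    simp only [mul_apply, hb0, one_apply, mul_ite, mul_one, mul_zero, Finset.sum_ite_eq',
      Finset.mem_univ, if_true, Matrix.sub_apply, Matrix.smul_apply, ha0', smul_zero] at h
    exact sub_eq_zero.mp h
  have hcomm : ∀ i j x k, ∑ c, b i x (Sum.inl c) * b j (Sum.inl c) (Sum.inl k)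
      + b i x (Sum.inr 0) * b j (Sum.inr 0) (Sum.inl k)
      + b i x (Sum.inr 1) * b j (Sum.inr 1) (Sum.inl k)
      - (∑ c, b j x (Sum.inl c) * b i (Sum.inl c) (Sum.inl k)
      + b j x (Sum.inr 0) * b i (Sum.inr 0) (Sum.inl k)
      + b j x (Sum.inr 1) * b i (Sum.inr 1) (Sum.inl k)) = W i j * a x (Sum.inl k) := by
    intro i j x k
    have h := congrFun (congrFun (hbb i j) x) (Sum.inl k)
    simp only [mul_apply, Matrix.sub_apply, Fintype.sum_sum_type, Fin.sum_univ_two,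
      Matrix.smul_apply, smul_eq_mul] at h
    rw [← h]; ring
  have hP : a.toBlocks₁₁ = 0 := by
    refine eq_zero_of_constant_ricciType hn hcard (A := fun i => (b i).toBlocks₁₁) hW hV f7
      (fun i => (hskew _ (hbs i)).2.2.1) (hskew _ has).2.2.1 ?_
    intro i j x k
    have h := hcomm i j (Sum.inl x) k
    simp only [hb0, f3] at h
    have g1 := f4 j k
    have g2 := f4 i k
    have g3 := f1 j k
    have g4 := f1 i k
    have q := (hskew _ has).2.2.1
    rw [q.swap k j] at g1
    rw [q.swap k i] at g2
    simp only [one_apply, Sum.inl.injEq] at h ⊢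
    simp only [Matrix.sub_apply, mul_apply (M := (b _).toBlocks₁₁)]
    simp only [← g1, ← g2, ← g3, ← g4]
    simp only [toBlocks₁₁, of_apply]
    linear_combination 2 * h
  have hP' : ∀ i j, a (Sum.inl i) (Sum.inl j) = 0 := fun i j => congrFun (congrFun hP i) j
  have f9 : ∀ i j, b i (Sum.inr 0) (Sum.inl j) = 0 := by
    intro i j
    have := f4 i j
    rw [hP] at this
    simpa using this
  have hlam : ∀ i, a (Sum.inr 0) (Sum.inl i) = 0 := by
    intro i
    have h1 : ∀ j, W i j * a (Sum.inr 0) (Sum.inl i) = 0 := by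
      intro j
      -- Repeating the index i removes the term with W_ii = 0; the other two reinforce each other,
      -- which is the source of the factor 3.
      have h := hcomm i j (Sum.inr 0) i
      simp only [f9, zero_mul, mul_zero, Finset.sum_const_zero, zero_add, f3] at h
      have g1 := f1 j i
      have g2 := f1 i i
      have g3 := Matrix.skew_swap hW i i
      have g4 := Matrix.skew_swap hW j i
      have : (3 : K) * (W i j * a (Sum.inr 0) (Sum.inl i)) = 0 := by
        have g5 : W i i = 0 := self_eq_neg.mp g3
        rw [g5] at g2
        linear_combination -2 * h + a (Sum.inr 0) (Sum.inl i) * (g1 + g4)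
          - a (Sum.inr 0) (Sum.inl j) * g2
      exact (mul_eq_zero.mp this).resolve_left (by exact_mod_cast (by norm_num : (3 : ℕ) ≠ 0))
    have h2 := congrFun (congrFun hV i) i
    rw [mul_apply, one_apply_eq] at h2
    rw [← one_mul (a _ _), ← h2, Finset.sum_mul]
    exact Finset.sum_eq_zero fun j _ => by rw [mul_right_comm, h1, zero_mul]
  have ha11 : a (Sum.inr 1) (Sum.inr 1) = 0 := by
    have := (hskew _ has).2.2.2
    rw [ha00] at this
    simpa using this
  have hai1 : ∀ i, a (Sum.inl i) (Sum.inr 1) = 0 := by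
    have h1 : ∀ j, ∑ x, W j x * a (Sum.inl x) (Sum.inr 1) = 0 := by
      intro j
      have := (hskew _ has).2.1 j
      rw [hlam] at this
      simpa using this
    intro i
    have h2 : ∑ j, V i j * ∑ x, W j x * a (Sum.inl x) (Sum.inr 1) = 0 := by simp [h1]
    have h3 : (V *ᵥ (W *ᵥ fun x => a (Sum.inl x) (Sum.inr 1))) i = 0 := h2
    rw [mulVec_mulVec, hV', one_mulVec] at h3
    exact h3
  have ha01 : a (Sum.inr 0) (Sum.inr 1) = 0 := by
    have : Nonempty ι := Fintype.card_pos_iff.mp (by omega)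
    obtain ⟨i⟩ := this
    have h := congrFun (congrFun (hab i) (Sum.inl i)) (Sum.inr 1)
    simp only [mul_apply, Fintype.sum_sum_type, Fin.sum_univ_two, hP', ha0', hai1, hb0, ha11] at h
    simpa using h.symm
  match x, y with
  | Sum.inl i, Sum.inl j => simp [hP']
  | Sum.inl i, Sum.inr 0 => simp [ha0']
  | Sum.inl i, Sum.inr 1 => simp [hai1]
  | Sum.inr 0, Sum.inl j => simp [hlam]
  | Sum.inr 1, Sum.inl j => simp [f2]
  | Sum.inr 0, Sum.inr 0 => simp [ha00]
  | Sum.inr 0, Sum.inr 1 => simp [ha01]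
  | Sum.inr 1, Sum.inr 0 => simp [ha10]
  | Sum.inr 1, Sum.inr 1 => simp [ha11]

/-- Adding multiples of the central element a to the b_i preserves all relations and can be used to
make every b'_i v orthogonal to v, where v is the basis vector `Sum.inr 0`. Twice the Gram matrix of
the vectors b'_i v, v, a v is then κ times `tractorForm W`, so these vectors form a basis, in which
`heisenberg_normalForm` applies. Vanishing of 2 × 2 minors does not depend on the basis. -/
theorem heisenberg_center_rank_one {n : ℕ} (hn : 2 ≤ n) (hcard : Fintype.card ι = 2 * n)
    {W V : Matrix ι ι K} (hW : Wᵀ = -W) (hV : W * V = 1) {c : K} (hc : 2 * c = 1)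
    {b : ι → Matrix (ι ⊕ Fin 2) (ι ⊕ Fin 2) K} {a H : Matrix (ι ⊕ Fin 2) (ι ⊕ Fin 2) K}
    (hH : Hᵀ = -H) (hbs : ∀ i, (b i)ᵀ * H + H * b i = 0) (has : aᵀ * H + H * a = 0)
    (hbb : ∀ i j, b i * b j - b j * b i = W i j • a) (hab : ∀ i, a * b i = b i * a)
    (hκ : IsUnit ((H * a) (Sum.inr 0) (Sum.inr 0))) (p q r s : ι ⊕ Fin 2) :
    a p q * a r s = a p s * a r q := by
  obtain ⟨κ, hκ⟩ := hκ
  let β : (ι ⊕ Fin 2 → K) → (ι ⊕ Fin 2 → K) → K := fun u w => u ⬝ᵥ (H *ᵥ w)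
  let v : ι ⊕ Fin 2 → K := Pi.single (Sum.inr 0) 1
  have hβs : ∀ u w, β u w = -β w u := by
    intro u w
    change u ⬝ᵥ (H *ᵥ w) = -(w ⬝ᵥ (H *ᵥ u))
    rw [dotProduct_comm, dotProduct_mulVec, ← mulVec_transpose, hH, neg_mulVec, neg_dotProduct]
    rw [dotProduct_comm, neg_neg]
  have hβ0 : ∀ u, β u u = 0 := fun u => self_eq_neg.mp (hβs u u)
  have hβm : ∀ m : Matrix (ι ⊕ Fin 2) (ι ⊕ Fin 2) K, mᵀ * H + H * m = 0 →
      ∀ u w, β (m *ᵥ u) w = -β u (m *ᵥ w) := by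
    intro m hm u w
    change (m *ᵥ u) ⬝ᵥ (H *ᵥ w) = -(u ⬝ᵥ (H *ᵥ (m *ᵥ w)))
    rw [← vecMul_transpose, ← dotProduct_mulVec, mulVec_mulVec, mulVec_mulVec,
      eq_neg_of_add_eq_zero_left hm, neg_mulVec, dotProduct_neg]
  have hvav : β v (a *ᵥ v) = κ := by
    change v ⬝ᵥ (H *ᵥ (a *ᵥ v)) = κ
    rw [mulVec_mulVec, hκ]
    simp [v]
  -- Solves β(v, b_i v) + χ_i β(v, a v) = 0, where β(v, a v) = κ.
  let χ : ι → K := fun i => -(β v (b i *ᵥ v) * (κ⁻¹ : Kˣ))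
  let b' : ι → Matrix (ι ⊕ Fin 2) (ι ⊕ Fin 2) K := fun i => b i + χ i • a
  have hbs' : ∀ i, (b' i)ᵀ * H + H * b' i = 0 := by
    intro i
    have : (b' i)ᵀ * H + H * b' i = ((b i)ᵀ * H + H * b i) + χ i • (aᵀ * H + H * a) := by
      simp only [b', transpose_add, transpose_smul, add_mul, mul_add, smul_mul_assoc,
        mul_smul_comm, smul_add]
      abel
    rw [this, hbs, has, smul_zero, add_zero]
  have hbb' : ∀ i j, b' i * b' j - b' j * b' i = W i j • a := by
    intro i j
    rw [← hbb i j]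
    simp only [b', add_mul, mul_add, smul_mul_assoc, mul_smul_comm, hab, smul_add]
    rw [smul_comm (χ j) (χ i)]
    abel
  have hab' : ∀ i, a * b' i = b' i * a := by
    intro i
    simp only [b', add_mul, mul_add, smul_mul_assoc, mul_smul_comm, hab]
  have hv0 : ∀ i, β v (b' i *ᵥ v) = 0 := by
    intro i
    have : β v (b' i *ᵥ v) = β v (b i *ᵥ v) + χ i * β v (a *ᵥ v) := by
      simp only [b', β, add_mulVec, smul_mulVec, mulVec_add, dotProduct_add, mulVec_smul,
        dotProduct_smul, smul_eq_mul]
    rw [this, hvav]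
    simp only [χ, neg_mul, mul_assoc, Units.inv_mul, mul_one, add_neg_cancel]
  have hb0a : ∀ i, β (b' i *ᵥ v) (a *ᵥ v) = 0 := by
    intro i
    have h1 := hβm _ (hbs' i) v (a *ᵥ v)
    have h2 := hβm _ has v (b' i *ᵥ v)
    rw [mulVec_mulVec] at h1 h2
    rw [hab', ← h1, hβs] at h2
    exact self_eq_neg.mp h2.symm
  have hbij : ∀ i j, 2 * β (b' i *ᵥ v) (b' j *ᵥ v) = -W i j * κ := by
    intro i j
    have h1 := hβm _ (hbs' i) v (b' j *ᵥ v)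
    have h2 := hβm _ (hbs' j) v (b' i *ᵥ v)
    have h3 := hβs (b' i *ᵥ v) (b' j *ᵥ v)
    have h4 : β v (b' i *ᵥ b' j *ᵥ v) - β v (b' j *ᵥ b' i *ᵥ v) = W i j * β v (a *ᵥ v) := by
      simp only [β, ← dotProduct_sub, mulVec_mulVec]
      rw [← sub_mulVec, ← mul_sub, hbb']
      simp only [mul_smul_comm, smul_mulVec, dotProduct_smul, smul_eq_mul]
    rw [hvav] at h4
    linear_combination h1 - h2 + h3 - h4
  let u : ι ⊕ Fin 2 → ι ⊕ Fin 2 → K := Sum.elim (fun i => b' i *ᵥ v) ![v, a *ᵥ v]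
  let M : Matrix (ι ⊕ Fin 2) (ι ⊕ Fin 2) K := of fun x p => u p x
  have hMu : ∀ p q, (Mᵀ * H * M) p q = β (u p) (u q) := by
    intro p q
    rw [Matrix.mul_assoc, mul_apply]
    rfl
  have hgram : (2 : K) • (Mᵀ * H * M) = (κ : K) • tractorForm W := by
    ext p q
    rw [Matrix.smul_apply, Matrix.smul_apply, hMu, smul_eq_mul, smul_eq_mul]
    match p, q with
    | Sum.inl i, Sum.inl j =>
      simp only [u, Sum.elim_inl, hbij, tractorForm, fromBlocks_apply₁₁, Matrix.neg_apply]
      ring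
    | Sum.inl i, Sum.inr 0 => simp [u, tractorForm, hβs (b' i *ᵥ v) v, hv0]
    | Sum.inl i, Sum.inr 1 => simp [u, tractorForm, hb0a]
    | Sum.inr 0, Sum.inl j => simp [u, tractorForm, hv0]
    | Sum.inr 1, Sum.inl j => simp [u, tractorForm, hβs (a *ᵥ v) _, hb0a]
    | Sum.inr 0, Sum.inr 0 => simp [u, tractorForm, hβ0]
    | Sum.inr 0, Sum.inr 1 => simp [u, tractorForm, hvav, mul_comm]
    | Sum.inr 1, Sum.inr 0 => simp [u, tractorForm, hβs (a *ᵥ v) v, hvav, mul_comm]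
    | Sum.inr 1, Sum.inr 1 => simp [u, tractorForm, hβ0]
  have hform : tractorForm W * fromBlocks (-V) 0 0 !![0, -c; c, 0] = 1 := by
    rw [tractorForm, fromBlocks_multiply, ← fromBlocks_one]
    congr 1
    · simp [hV]
    · simp
    · simp
    · ext i j
      fin_cases i <;> fin_cases j <;> simp [hc]
  have hdet : IsUnit M.det := by
    have h1 : Mᵀ * ((2 : K) • (H * M) * ((κ⁻¹ : Kˣ) : K) •
        fromBlocks (-V) 0 0 !![0, -c; c, 0]) = 1 := by
      calc Mᵀ * ((2 : K) • (H * M) * ((κ⁻¹ : Kˣ) : K) • fromBlocks (-V) 0 0 !![0, -c; c, 0])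
          = ((2 : K) • (Mᵀ * H * M)) * ((κ⁻¹ : Kˣ) : K) •
            fromBlocks (-V) 0 0 !![0, -c; c, 0] := by
            simp only [Matrix.mul_assoc, mul_smul_comm, smul_mul_assoc]
        _ = 1 := by
            rw [hgram, smul_mul_assoc, mul_smul_comm, hform, smul_smul, Units.mul_inv, one_smul]
    have := isUnit_det_of_right_inverse h1
    rwa [det_transpose] at this
  have hMM : M * M⁻¹ = 1 := mul_nonsing_inv _ hdet
  have hMM' : M⁻¹ * M = 1 := nonsing_inv_mul _ hdet
  have hconj : ∀ m : Matrix (ι ⊕ Fin 2) (ι ⊕ Fin 2) K, mᵀ * H + H * m = 0 →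
      (M⁻¹ * m * M)ᵀ * tractorForm W + tractorForm W * (M⁻¹ * m * M) = 0 := by
    intro m hm
    have h1 : (κ : K) • ((M⁻¹ * m * M)ᵀ * tractorForm W + tractorForm W * (M⁻¹ * m * M))
        = (2 : K) • (Mᵀ * (mᵀ * H + H * m) * M) := by
      rw [smul_add, ← mul_smul_comm, ← smul_mul_assoc, ← hgram]
      have e1 : (M⁻¹ * m * M)ᵀ * (Mᵀ * H * M) = Mᵀ * mᵀ * H * M := by
        have : (M⁻¹ * m * M)ᵀ * Mᵀ = Mᵀ * mᵀ := by
          rw [← transpose_mul, ← transpose_mul, Matrix.mul_assoc M⁻¹, ← Matrix.mul_assoc M, hMM,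
            Matrix.one_mul]
        rw [← Matrix.mul_assoc, ← Matrix.mul_assoc, this]
      have e2 : (Mᵀ * H * M) * (M⁻¹ * m * M) = Mᵀ * H * m * M := by
        rw [Matrix.mul_assoc M⁻¹, ← Matrix.mul_assoc, Matrix.mul_assoc _ M, hMM, Matrix.mul_one,
          ← Matrix.mul_assoc]
      rw [mul_smul_comm, smul_mul_assoc, e1, e2, ← smul_add]
      simp only [mul_add, add_mul, Matrix.mul_assoc]
    rw [hm] at h1
    have h2 := congrArg (((κ⁻¹ : Kˣ) : K) • ·) h1
    simpa [smul_smul] using h2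
  have hmulc : ∀ m m' : Matrix (ι ⊕ Fin 2) (ι ⊕ Fin 2) K,
      (M⁻¹ * m * M) * (M⁻¹ * m' * M) = M⁻¹ * (m * m') * M := by
    intro m m'
    calc (M⁻¹ * m * M) * (M⁻¹ * m' * M) = M⁻¹ * m * (M * M⁻¹) * m' * M := by
          simp only [Matrix.mul_assoc]
      _ = _ := by rw [hMM]; simp only [Matrix.mul_assoc, Matrix.one_mul]
  have hcol : ∀ (m : Matrix (ι ⊕ Fin 2) (ι ⊕ Fin 2) K) (y : ι ⊕ Fin 2), m *ᵥ v = u y →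
      ∀ x, (M⁻¹ * m * M) x (Sum.inr 0) = (1 : Matrix (ι ⊕ Fin 2) (ι ⊕ Fin 2) K) x y := by
    intro m y hy x
    have h1 : (m * M).col (Sum.inr 0) = M.col y := by
      ext z
      have : (m * M) z (Sum.inr 0) = (m *ᵥ u (Sum.inr 0)) z := rfl
      change (m * M) z (Sum.inr 0) = u y z
      rw [this, ← hy]
      rfl
    rw [Matrix.mul_assoc, mul_apply, ← hMM', mul_apply]
    exact Finset.sum_congr rfl fun z _ => by
      have := congrFun h1 z
      simp only [col_apply] at this
      rw [this]
  have hfin := heisenberg_normalForm hn hcard hW hV (b := fun i => M⁻¹ * b' i * M)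
    (a := M⁻¹ * a * M) (fun i => hcol _ _ rfl) (hcol _ _ rfl) (fun i => hconj _ (hbs' i))
    (hconj _ has)
    (fun i j => by
      rw [hmulc, hmulc, ← sub_mul, ← mul_sub, hbb', mul_smul_comm, smul_mul_assoc])
    (fun i => by rw [hmulc, hmulc, hab'])
  have hfact : ∀ p q, a p q = M p (Sum.inr 1) * M⁻¹ (Sum.inr 0) q := by
    intro p q
    have h1 : a = M * (M⁻¹ * a * M) * M⁻¹ := by
      simp only [← Matrix.mul_assoc, hMM, Matrix.one_mul]
      rw [Matrix.mul_assoc, hMM, Matrix.mul_one]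
    conv_lhs => rw [h1]
    rw [mul_apply]
    simp only [mul_apply (M := M), hfin, one_apply]
    simp
  simp only [hfact]
  ring

end HeisenbergRepresentation

end

/-! ### Connections of Ricci type over a differential ring, and the second Bianchi identity. -/

section

open Matrix

section MatrixDerivation

variable {S : Type*} [CommRing S] [Algebra ℝ S]

/-- Entrywise application of a derivation to a matrix. -/
def Matrix.der {l m : Type*} (δ : Derivation ℝ S S) (M : Matrix l m S) : Matrix l m S := M.map δ

variable {l m n : Type*} (δ : Derivation ℝ S S)

@[simp] theorem Matrix.der_apply (M : Matrix l m S) (i : l) (j : m) : M.der δ i j = δ (M i j) := rfl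

theorem Matrix.der_mul [Fintype m] (M : Matrix l m S) (N : Matrix m n S) :
    (M * N).der δ = M.der δ * N + M * N.der δ := by
  ext i j
  simp only [der_apply, mul_apply, Matrix.add_apply, map_sum, Derivation.leibniz, smul_eq_mul,
    ← Finset.sum_add_distrib]
  exact Finset.sum_congr rfl fun x _ => by ring

theorem Matrix.der_add (M N : Matrix l m S) : (M + N).der δ = M.der δ + N.der δ := by
  ext; simp

theorem Matrix.der_sub (M N : Matrix l m S) : (M - N).der δ = M.der δ - N.der δ := by
  ext; simp

theorem Matrix.der_zero : (0 : Matrix l m S).der δ = 0 := by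
  ext; simp

theorem Matrix.der_transpose (M : Matrix l m S) : Mᵀ.der δ = (M.der δ)ᵀ := rfl

theorem Matrix.der_one [DecidableEq m] : (1 : Matrix m m S).der δ = 0 := by
  ext i j
  by_cases h : i = j <;> simp [h]

theorem Matrix.der_comm {δ δ' : Derivation ℝ S S} (h : ∀ x, δ (δ' x) = δ' (δ x))
    (M : Matrix l m S) : (M.der δ').der δ = (M.der δ).der δ' := by
  ext; simp [h]

/-- The ring S may have zero divisors, as rings of smooth functions do; positive integers are
nevertheless invertible because S is an ℝ-algebra. -/
theorem natCast_mul_cancel {k : ℕ} (hk : k ≠ 0) {x : S} (h : (k : S) * x = 0) : x = 0 := by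
  have h1 : algebraMap ℝ S (k : ℝ)⁻¹ * (k : S) = 1 := by
    rw [← map_natCast (algebraMap ℝ S) k, ← map_mul, inv_mul_cancel₀ (by exact_mod_cast hk), map_one]
  rw [← one_mul x, ← h1, mul_assoc, h, mul_zero]

end MatrixDerivation

/-- The components of a symplectic connection of Ricci type in a frame of commuting derivations
over a differential ring. -/
structure RicciTypeData (ι S : Type*) [Fintype ι] [DecidableEq ι] [CommRing S] [Algebra ℝ S] where
  d : ι → Derivation ℝ S S
  d_comm : ∀ i j x, d i (d j x) = d j (d i x)
  W : Matrix ι ι S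
  V : Matrix ι ι S
  W_skew : Wᵀ = -W
  W_mul_V : W * V = 1
  dW : ∀ k, W.der (d k) = 0
  dV : ∀ k, V.der (d k) = 0
  A : ι → Matrix ι ι S
  A_symm : ∀ i a j, A i a j = A j a i
  WA_symm : ∀ i, (W * A i).IsSymm
  P : Matrix ι ι S
  WP_symm : (W * P).IsSymm
  ricci : RicciTypeIdentity W P
    fun i j => (A j).der (d i) - (A i).der (d j) + A i * A j - A j * A i

namespace RicciTypeData

variable {ι S : Type*} [Fintype ι] [DecidableEq ι] [CommRing S] [Algebra ℝ S]
  (C : RicciTypeData ι S)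

theorem V_mul_W : C.V * C.W = 1 := mul_eq_one_comm.mp C.W_mul_V

theorem sum_V_W (i j : ι) : ∑ k, C.V i k * C.W k j = (1 : Matrix ι ι S) i j := by
  rw [← mul_apply, C.V_mul_W]

theorem sum_W_V (i j : ι) : ∑ k, C.W i k * C.V k j = (1 : Matrix ι ι S) i j := by
  rw [← mul_apply, C.W_mul_V]

/-- Curvature endomorphisms. -/
def R (i j : ι) : Matrix ι ι S :=
  (C.A j).der (C.d i) - (C.A i).der (C.d j) + C.A i * C.A j - C.A j * C.A i

/-- The covariant derivative of `P`. -/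
def covP (k : ι) : Matrix ι ι S := C.P.der (C.d k) + C.A k * C.P - C.P * C.A k

theorem transpose_A_mul_W (k : ι) : (C.A k)ᵀ * C.W = -(C.W * C.A k) := by
  have h := (C.WA_symm k).eq
  rw [transpose_mul, C.W_skew, Matrix.mul_neg] at h
  rw [← h, neg_neg]

theorem transpose_P_mul_W : C.Pᵀ * C.W = -(C.W * C.P) := by
  have h := C.WP_symm.eq
  rw [transpose_mul, C.W_skew, Matrix.mul_neg] at h
  rw [← h, neg_neg]

theorem W_mul_der (k : ι) (M : Matrix ι ι S) : C.W * M.der (C.d k) = (C.W * M).der (C.d k) := by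
  rw [der_mul, C.dW, Matrix.zero_mul, zero_add]

/-- P takes values in the symplectic Lie algebra, and a symplectic connection preserves this
property. -/
theorem W_covP_symm (k : ι) : (C.W * C.covP k).IsSymm := by
  have h1 : C.W * C.covP k = (C.W * C.P).der (C.d k) - (C.A k)ᵀ * (C.W * C.P)
      - C.W * C.P * C.A k := by
    rw [covP, mul_sub, mul_add, C.W_mul_der, ← Matrix.mul_assoc, ← Matrix.mul_assoc,
      ← Matrix.mul_assoc, C.transpose_A_mul_W]
    simp only [neg_mul, sub_neg_eq_add]
  rw [h1, Matrix.IsSymm, transpose_sub, transpose_sub, ← der_transpose, transpose_mul _ (C.A k),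
    transpose_mul _ (C.W * C.P), transpose_transpose, C.WP_symm.eq]
  abel

theorem R_apply (i j a k : ι) : 2 * C.R i j a k = 2 * C.W i j * C.P a k
    - (1 : Matrix ι ι S) a i * (C.W * C.P) j k
    + (1 : Matrix ι ι S) a j * (C.W * C.P) i k - C.P a i * C.W j k + C.P a j * C.W i k :=
  C.ricci i j a k

theorem R_skew (i j : ι) : C.R i j = -C.R j i := by
  simp only [R]
  abel

/-- Second derivatives cancel because the frame derivations commute, and the remaining terms cancel
formally. The connection acts here only on the endomorphism indices; the corrections in the form
indices are treated in `covP_cyclic`. -/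
theorem R_bianchi (k i j : ι) :
    ((C.R i j).der (C.d k) + C.A k * C.R i j - C.R i j * C.A k)
    + ((C.R j k).der (C.d i) + C.A i * C.R j k - C.R j k * C.A i)
    + ((C.R k i).der (C.d j) + C.A j * C.R k i - C.R k i * C.A j) = 0 := by
  have h : ∀ x y (M : Matrix ι ι S), (M.der (C.d x)).der (C.d y) = (M.der (C.d y)).der (C.d x) :=
    fun x y M => der_comm (C.d_comm y x) M
  simp only [R, der_add, der_sub, der_mul]
  rw [h i k, h j k, h i j]
  noncomm_ring

/-- The left side is the full covariant derivative of 2R, form indices included. Since W and the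
identity are parallel, differentiating the Ricci type identity amounts to replacing P by ∇P. -/
theorem covR_apply (k i j x m : ι) :
    2 * ((C.R i j).der (C.d k) + C.A k * C.R i j - C.R i j * C.A k) x m
      - ∑ b, C.A k b i * (2 * C.R b j x m) - ∑ b, C.A k b j * (2 * C.R i b x m)
    = 2 * C.W i j * C.covP k x m - (1 : Matrix ι ι S) x i * (C.W * C.covP k) j m
      + (1 : Matrix ι ι S) x j * (C.W * C.covP k) i m - C.covP k x i * C.W j m
      + C.covP k x j * C.W i m := by
  have hdW : ∀ i j, C.d k (C.W i j) = 0 := fun i j => congrFun (congrFun (C.dW k) i) j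
  have hd1 : ∀ i j, C.d k ((1 : Matrix ι ι S) i j) = 0 :=
    fun i j => congrFun (congrFun (der_one (C.d k)) i) j
  have hdQ : ∀ i j, C.d k ((C.W * C.P) i j) = (C.W * C.P.der (C.d k)) i j := fun i j => by
    rw [C.W_mul_der]; rfl
  have h1 : 2 * C.d k (C.R i j x m) = 2 * C.W i j * (C.P.der (C.d k)) x m
      - (1 : Matrix ι ι S) x i * (C.W * C.P.der (C.d k)) j m
      + (1 : Matrix ι ι S) x j * (C.W * C.P.der (C.d k)) i m - (C.P.der (C.d k)) x i * C.W j m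
      + (C.P.der (C.d k)) x j * C.W i m := by
    have h := congrArg (C.d k) (C.R_apply i j x m)
    have h2 : C.d k 2 = 0 := by
      have := (C.d k).map_natCast 2
      simpa using this
    simp only [Derivation.leibniz, map_add, map_sub, hdW, hd1, hdQ, h2, smul_eq_mul, mul_zero] at h
    simp only [der_apply]
    linear_combination h
  have h2 : 2 * (C.A k * C.R i j) x m = 2 * C.W i j * (C.A k * C.P) x m
      - C.A k x i * (C.W * C.P) j m + C.A k x j * (C.W * C.P) i m
      - (C.A k * C.P) x i * C.W j m + (C.A k * C.P) x j * C.W i m := by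
    rw [mul_apply, Finset.mul_sum]
    have : ∀ b, 2 * (C.A k x b * C.R i j b m) = C.A k x b * (2 * C.R i j b m) := fun b => by ring
    simp only [this, R_apply, mul_add, mul_sub, Finset.sum_add_distrib, Finset.sum_sub_distrib,
      one_apply, mul_ite, ite_mul, mul_zero, zero_mul, one_mul, Finset.sum_ite_eq',
      Finset.mem_univ, if_true]
    simp only [← mul_assoc, ← Finset.sum_mul, ← mul_apply]
    rw [mul_apply (M := C.A k) (k := m), Finset.mul_sum]
    congr 4
    exact Finset.sum_congr rfl fun b _ => by ring
  have h3 : 2 * (C.R i j * C.A k) x m = 2 * C.W i j * (C.P * C.A k) x m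
      - (1 : Matrix ι ι S) x i * (C.W * C.P * C.A k) j m
      + (1 : Matrix ι ι S) x j * (C.W * C.P * C.A k) i m
      - C.P x i * (C.W * C.A k) j m + C.P x j * (C.W * C.A k) i m := by
    rw [mul_apply, Finset.mul_sum]
    simp only [← mul_assoc (2 : S), R_apply, add_mul, sub_mul, Finset.sum_add_distrib,
      Finset.sum_sub_distrib]
    simp only [mul_assoc, ← Finset.mul_sum]
    simp only [← mul_assoc, ← mul_apply]
  have hTW : ∀ i j, ∑ b, C.A k b i * C.W b j = -(C.W * C.A k) i j := fun i j => by
    rw [← Matrix.neg_apply, ← C.transpose_A_mul_W]; rfl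
  have hTQ : ∀ i j, ∑ b, C.A k b i * (C.W * C.P) b j = -(C.W * C.A k * C.P) i j := fun i j => by
    rw [← Matrix.neg_apply, ← Matrix.neg_mul, ← C.transpose_A_mul_W, Matrix.mul_assoc]; rfl
  have h4 : ∀ i j, ∑ b, C.A k b i * (2 * C.R b j x m) = -2 * (C.W * C.A k) i j * C.P x m
      - C.A k x i * (C.W * C.P) j m - (1 : Matrix ι ι S) x j * (C.W * C.A k * C.P) i m
      - (C.P * C.A k) x i * C.W j m - C.P x j * (C.W * C.A k) i m := by
    intro i j
    have e : ∀ b, C.A k b i * (2 * C.R b j x m) = 2 * C.P x m * (C.A k b i * C.W b j)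
        - (1 : Matrix ι ι S) x b * (C.A k b i * (C.W * C.P) j m)
        + (1 : Matrix ι ι S) x j * (C.A k b i * (C.W * C.P) b m)
        - C.P x b * C.A k b i * C.W j m + C.P x j * (C.A k b i * C.W b m) := by
      intro b
      rw [R_apply]; ring
    simp only [e, Finset.sum_add_distrib, Finset.sum_sub_distrib, ← Finset.mul_sum, hTW, hTQ,
      ← Finset.sum_mul]
    simp only [← mul_apply, one_apply, ite_mul, one_mul, zero_mul, Finset.sum_ite_eq,
      Finset.mem_univ, if_true]
    split_ifs <;> ring
  have h5 : ∑ b, C.A k b j * (2 * C.R i b x m) = 2 * (C.W * C.A k) i j * C.P x m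
      + (1 : Matrix ι ι S) x i * (C.W * C.A k * C.P) j m + C.A k x j * (C.W * C.P) i m
      + C.P x i * (C.W * C.A k) j m + (C.P * C.A k) x j * C.W i m := by
    have e : ∑ b, C.A k b j * (2 * C.R i b x m) = -∑ b, C.A k b j * (2 * C.R b i x m) := by
      rw [← Finset.sum_neg_distrib]
      exact Finset.sum_congr rfl fun b _ => by rw [C.R_skew i b, Matrix.neg_apply]; ring
    rw [e, h4, (C.WA_symm k).swap j i]
    ring
  rw [h4 i j, h5]
  simp only [covP, Matrix.add_apply, Matrix.sub_apply, mul_add, mul_sub, der_apply]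
  simp only [← Matrix.mul_assoc]
  simp only [der_apply] at h1
  linear_combination h1 + h2 - h3

theorem covP_cyclic (k i j x m : ι) :
    (2 * C.W i j * C.covP k x m - (1 : Matrix ι ι S) x i * (C.W * C.covP k) j m
      + (1 : Matrix ι ι S) x j * (C.W * C.covP k) i m - C.covP k x i * C.W j m
      + C.covP k x j * C.W i m)
    + (2 * C.W j k * C.covP i x m - (1 : Matrix ι ι S) x j * (C.W * C.covP i) k m
      + (1 : Matrix ι ι S) x k * (C.W * C.covP i) j m - C.covP i x j * C.W k m
      + C.covP i x k * C.W j m)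
    + (2 * C.W k i * C.covP j x m - (1 : Matrix ι ι S) x k * (C.W * C.covP j) i m
      + (1 : Matrix ι ι S) x i * (C.W * C.covP j) k m - C.covP j x k * C.W i m
      + C.covP j x i * C.W k m) = 0 := by
  rw [← covR_apply, ← covR_apply, ← covR_apply]
  have h := congrFun (congrFun (C.R_bianchi k i j) x) m
  simp only [Matrix.add_apply, Matrix.zero_apply] at h
  -- By absence of torsion and skewness of R, the form-index corrections cancel in pairs in the
  -- cyclic sum.
  have e : ∀ p q r, ∑ b, C.A p b q * (2 * C.R r b x m) = -∑ b, C.A q b p * (2 * C.R b r x m) := by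
    intro p q r
    rw [← Finset.sum_neg_distrib]
    exact Finset.sum_congr rfl fun b _ => by rw [C.R_skew r b, Matrix.neg_apply, C.A_symm p b q]; ring
  rw [e k j i, e i k j, e j i k]
  linear_combination 2 * h

theorem covP_cyclic_lower (k i j l m : ι) :
    (2 * C.W i j * (C.W * C.covP k) l m - C.W l i * (C.W * C.covP k) j m
      + C.W l j * (C.W * C.covP k) i m - (C.W * C.covP k) l i * C.W j m
      + (C.W * C.covP k) l j * C.W i m)
    + (2 * C.W j k * (C.W * C.covP i) l m - C.W l j * (C.W * C.covP i) k m
      + C.W l k * (C.W * C.covP i) j m - (C.W * C.covP i) l j * C.W k m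
      + (C.W * C.covP i) l k * C.W j m)
    + (2 * C.W k i * (C.W * C.covP j) l m - C.W l k * (C.W * C.covP j) i m
      + C.W l i * (C.W * C.covP j) k m - (C.W * C.covP j) l k * C.W i m
      + (C.W * C.covP j) l i * C.W k m) = 0 := by
  have hl : ∀ p q, (C.W * C.covP p) l q = ∑ x, C.W l x * C.covP p x q := fun p q => mul_apply
  have h1 : ∀ q, C.W l q = ∑ x, C.W l x * (1 : Matrix ι ι S) x q := fun q => by
    rw [← mul_apply, Matrix.mul_one]
  have h := Finset.sum_congr (rfl : (Finset.univ : Finset ι) = Finset.univ)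
    fun x _ => congrArg (C.W l x * ·) (C.covP_cyclic k i j x m)
  simp only [mul_zero, Finset.sum_const_zero] at h
  rw [← h]
  rw [h1 i, h1 j, h1 k]
  simp only [hl _ m, hl _ i, hl _ j, hl _ k, Finset.mul_sum, Finset.sum_mul,
    ← Finset.sum_add_distrib, ← Finset.sum_sub_distrib]
  refine Finset.sum_congr rfl fun x _ => ?_
  ring

end RicciTypeData

section Contraction

variable {ι S : Type*} [Fintype ι] [DecidableEq ι] [CommRing S] [Algebra ℝ S]

/-- The dual basis contraction kills a symplectic trace of a tensor satisfying the Bianchi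
identity of the derivative of a curvature of Ricci type. -/
theorem ricci_bianchi_contraction {n : ℕ} (hn : 2 ≤ n) (hcard : Fintype.card ι = 2 * n)
    {W V : Matrix ι ι S} (hW : Wᵀ = -W) (hV : W * V = 1) {s : ι → ι → ι → S}
    (hs : ∀ k l m, s k l m = s k m l)
    (h : ∀ k i j l m, (2 * W i j * s k l m - W l i * s k j m + W l j * s k i m - s k l i * W j m
      + s k l j * W i m)
    + (2 * W j k * s i l m - W l j * s i k m + W l k * s i j m - s i l j * W k m + s i l k * W j m)
    + (2 * W k i * s j l m - W l k * s j i m + W l i * s j k m - s j l k * W i m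
      + s j l i * W k m) = 0) :
    ∃ u : ι → S, ∀ k l m, s k l m = W k l * u m + W k m * u l := by
  have hV' : V * W = 1 := mul_eq_one_comm.mp hV
  have hVt : ∀ i j, V i j = -V j i := by
    have h1 : Vᵀ * W = -1 := by
      have := congrArg transpose hV
      rw [transpose_mul, hW, transpose_one] at this
      rw [← this]; simp
    have h2 : Vᵀ = -V := by
      calc Vᵀ = Vᵀ * W * V := by rw [Matrix.mul_assoc, hV, Matrix.mul_one]
        _ = -V := by rw [h1]; simp
    exact skew_swap h2
  have c1 : ∀ (l : ι) (f : ι → S), ∑ i, ∑ j, V i j * (W l i * f j) = f l := by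
    intro l f
    rw [Finset.sum_comm]
    have : ∀ j, ∑ i, V i j * (W l i * f j) = (1 : Matrix ι ι S) l j * f j := fun j => by
      rw [← hV, mul_apply, Finset.sum_mul]
      exact Finset.sum_congr rfl fun i _ => by ring
    simp only [this, one_apply, ite_mul, one_mul, zero_mul, Finset.sum_ite_eq, Finset.mem_univ,
      if_true]
  have c2 : ∀ (l : ι) (f : ι → S), ∑ i, ∑ j, V i j * (W l j * f i) = -f l := by
    intro l f
    rw [← c1 l f, Finset.sum_comm, ← Finset.sum_neg_distrib]
    refine Finset.sum_congr rfl fun i _ => ?_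
    rw [← Finset.sum_neg_distrib]
    exact Finset.sum_congr rfl fun j _ => by rw [hVt]; ring
  have c3 : ∑ i, ∑ j, V i j * W i j = -(2 * (n : S)) := by
    have : ∀ i, ∑ j, V i j * W i j = -1 := by
      intro i
      rw [← one_apply_eq (n := ι) (α := S) i, ← hV', mul_apply, ← Finset.sum_neg_distrib]
      exact Finset.sum_congr rfl fun j _ => by rw [skew_swap hW]; ring
    simp only [this, Finset.sum_const, Finset.card_univ, hcard, nsmul_eq_mul]
    push_cast
    ring
  -- The symplectic trace of s; the covector u will be -v / (2n + 1).
  let v : ι → S := fun m => ∑ i, ∑ j, V i j * s i j m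
  have c4 : ∀ m, ∑ i, ∑ j, V i j * s j i m = -v m := by
    intro m
    simp only [v]
    rw [Finset.sum_comm, ← Finset.sum_neg_distrib]
    refine Finset.sum_congr rfl fun i _ => ?_
    rw [← Finset.sum_neg_distrib]
    exact Finset.sum_congr rfl fun j _ => by rw [hVt]; ring
  have hv : ∀ m, ∑ i, ∑ j, V i j * s i j m = v m := fun m => rfl
  -- Contraction of the cyclic identity with V in the indices i, j. The coefficient 2n comes from
  -- the trace of W against V.
  have key : ∀ k l m, 2 * (n : S) * s k l m = s l k m + s m k l - W k l * v m - W k m * v l := by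
    intro k l m
    have e : ∀ i j, V i j * (2 * W i j * s k l m - W l i * s k j m + W l j * s k i m
        - s k l i * W j m + s k l j * W i m
        + (2 * W j k * s i l m - W l j * s i k m + W l k * s i j m - s i l j * W k m
          + s i l k * W j m)
        + (2 * W k i * s j l m - W l k * s j i m + W l i * s j k m - s j l k * W i m
          + s j l i * W k m))
        = 2 * s k l m * (V i j * W i j) + V i j * (W l i * (-s k j m + s j k m))
        + V i j * (W l j * (s k i m - s i k m)) + V i j * (W m j * (s k l i - s i l k))
        + V i j * (W m i * (-s k l j + s j l k)) + V i j * (W k j * (-2 * s i l m))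
        + V i j * (W k i * (2 * s j l m)) + W l k * (V i j * s i j m) - W l k * (V i j * s j i m)
        - W k m * (V i j * s i j l) + W k m * (V i j * s j i l) := by
      intro i j
      rw [skew_swap hW j m, skew_swap hW i m, skew_swap hW j k, hs i l j, hs j l i]
      ring
    have h0 : ∑ i, ∑ j, V i j * (2 * W i j * s k l m - W l i * s k j m + W l j * s k i m
        - s k l i * W j m + s k l j * W i m
        + (2 * W j k * s i l m - W l j * s i k m + W l k * s i j m - s i l j * W k m
          + s i l k * W j m)
        + (2 * W k i * s j l m - W l k * s j i m + W l i * s j k m - s j l k * W i m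
          + s j l i * W k m)) = 0 :=
      Finset.sum_eq_zero fun i _ => Finset.sum_eq_zero fun j _ => by rw [h, mul_zero]
    simp only [e] at h0
    simp only [Finset.sum_add_distrib, Finset.sum_sub_distrib, ← Finset.mul_sum] at h0
    rw [c3, c1 l (fun j => -s k j m + s j k m), c2 l (fun i => s k i m - s i k m),
      c2 m (fun i => s k l i - s i l k), c1 m (fun j => -s k l j + s j l k),
      c2 k (fun i => -2 * s i l m), c1 k (fun j => 2 * s j l m)] at h0
    simp only [c4, hv] at h0
    have h1 : ((2 : ℕ) : S) * (2 * (n : S) * s k l m - (s l k m + s m k l - W k l * v m - W k m * v l))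
        = 0 := by
      rw [skew_swap hW l k, hs m l k] at h0
      push_cast
      linear_combination -h0
    exact sub_eq_zero.mp (natCast_mul_cancel two_ne_zero h1)
  -- The W-terms cancel in the sum of the three versions of `key`, so 2n - 2 annihilates the cyclic
  -- sum. After that, `key` reads (2n + 1) s_klm = -(W_kl v_m + W_km v_l).
  have hsum : ∀ k l m, s k l m + s l k m + s m k l = 0 := by
    intro k l m
    have e1 := key k l m
    have e2 := key l k m
    have e3 := key m k l
    rw [hs m l k] at e2
    rw [hs k m l, hs l m k] at e3
    rw [skew_swap hW l k] at e2
    rw [skew_swap hW m k, skew_swap hW m l] at e3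
    have h1 : ((2 * (n - 1) : ℕ) : S) * (s k l m + s l k m + s m k l) = 0 := by
      push_cast [Nat.cast_sub (by omega : 1 ≤ n)]
      linear_combination e1 + e2 + e3
    exact natCast_mul_cancel (by omega) h1
  have hinv : algebraMap ℝ S (2 * n + 1)⁻¹ * (2 * (n : S) + 1) = 1 := by
    have : (2 * (n : S) + 1) = algebraMap ℝ S (2 * n + 1) := by
      simp [map_ofNat]
    rw [this, ← map_mul, inv_mul_cancel₀ (by positivity), map_one]
  refine ⟨fun m => -(algebraMap ℝ S (2 * n + 1)⁻¹ * v m), fun k l m => ?_⟩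
  have e1 := key k l m
  have e2 := hsum k l m
  linear_combination (algebraMap ℝ S (2 * n + 1)⁻¹) * (e1 + e2) - s k l m * hinv

end Contraction

end

/-! ### The tractor connection and its parallel endomorphism. -/

section

open Matrix

namespace RicciTypeData

variable {ι S : Type*} [Fintype ι] [DecidableEq ι] [CommRing S] [Algebra ℝ S]
  (C : RicciTypeData ι S)

theorem exists_covP_eq {n : ℕ} (hn : 2 ≤ n) (hcard : Fintype.card ι = 2 * n) :
    ∃ u : ι → S, ∀ k l m, (C.W * C.covP k) l m = C.W k l * u m + C.W k m * u l :=
  ricci_bianchi_contraction hn hcard C.W_skew C.W_mul_V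
    (s := fun k l m => (C.W * C.covP k) l m) (fun k l m => (C.W_covP_symm k).swap l m)
    C.covP_cyclic_lower

variable {u : ι → S} (hu : ∀ k l m, (C.W * C.covP k) l m = C.W k l * u m + C.W k m * u l)

include hu in
theorem covP_apply (k x m : ι) :
    C.covP k x m = C.W k m * (C.V *ᵥ u) x - u m * (1 : Matrix ι ι S) x k := by
  have h1 : C.covP k x m = ∑ l, C.V x l * (C.W * C.covP k) l m := by
    rw [← mul_apply, ← Matrix.mul_assoc, C.V_mul_W, Matrix.one_mul]
  rw [h1, ← C.V_mul_W, mul_apply, mulVec, dotProduct, Finset.mul_sum, Finset.mul_sum,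
    ← Finset.sum_sub_distrib]
  refine Finset.sum_congr rfl fun l _ => ?_
  rw [hu, skew_swap C.W_skew k l]
  ring

theorem transpose_QP (i j : ι) : (C.W * C.P * C.P) i j = -(C.W * C.P * C.P) j i := by
  refine skew_swap ?_ i j
  rw [transpose_mul, C.WP_symm.eq, ← Matrix.mul_assoc, C.transpose_P_mul_W, Matrix.neg_mul]

theorem ricci_commutator (i j x m : ι) :
    2 * (C.R i j * C.P - C.P * C.R i j) x m
      = -((1 : Matrix ι ι S) x i * (C.W * C.P * C.P) j m)
        + (1 : Matrix ι ι S) x j * (C.W * C.P * C.P) i m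
        + (C.P * C.P) x i * C.W j m - (C.P * C.P) x j * C.W i m := by
  have h1 : 2 * (C.R i j * C.P) x m = 2 * C.W i j * (C.P * C.P) x m
      - (1 : Matrix ι ι S) x i * (C.W * C.P * C.P) j m
      + (1 : Matrix ι ι S) x j * (C.W * C.P * C.P) i m
      - C.P x i * (C.W * C.P) j m + C.P x j * (C.W * C.P) i m := by
    rw [mul_apply, Finset.mul_sum]
    simp only [← mul_assoc (2 : S), R_apply, add_mul, sub_mul, Finset.sum_add_distrib,
      Finset.sum_sub_distrib]
    simp only [mul_assoc, ← Finset.mul_sum]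
    simp only [← mul_assoc, ← mul_apply]
  have h2 : 2 * (C.P * C.R i j) x m = 2 * C.W i j * (C.P * C.P) x m
      - C.P x i * (C.W * C.P) j m + C.P x j * (C.W * C.P) i m
      - (C.P * C.P) x i * C.W j m + (C.P * C.P) x j * C.W i m := by
    rw [mul_apply, Finset.mul_sum]
    have : ∀ b, 2 * (C.P x b * C.R i j b m) = C.P x b * (2 * C.R i j b m) := fun b => by ring
    simp only [this, R_apply, mul_add, mul_sub, Finset.sum_add_distrib, Finset.sum_sub_distrib,
      one_apply, ite_mul, mul_ite, mul_zero, zero_mul, one_mul, Finset.sum_ite_eq',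
      Finset.mem_univ, if_true]
    simp only [← mul_assoc, ← Finset.sum_mul, ← mul_apply]
    rw [mul_apply (M := C.P) (k := m), Finset.mul_sum]
    congr 4
    exact Finset.sum_congr rfl fun b _ => by ring
  rw [Matrix.sub_apply]
  linear_combination h1 - h2

/-- The Ricci identity [∇_i, ∇_j] P = [R_ij, P]. The corrections in the form index are omitted: they
are symmetric in i, j when there is no torsion. -/
theorem covP_commutator (i j : ι) :
    ((C.covP j).der (C.d i) + C.A i * C.covP j - C.covP j * C.A i)
      - ((C.covP i).der (C.d j) + C.A j * C.covP i - C.covP i * C.A j)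
      = C.R i j * C.P - C.P * C.R i j := by
  have h : ∀ x y (M : Matrix ι ι S), (M.der (C.d x)).der (C.d y) = (M.der (C.d y)).der (C.d x) :=
    fun x y M => der_comm (C.d_comm y x) M
  simp only [covP, R, der_add, der_sub, der_mul]
  rw [h i j]
  noncomm_ring

theorem sum_WA_swap (i j m : ι) : (C.W * C.A i) j m = (C.W * C.A j) i m := by
  rw [(C.WA_symm i).swap j m, (C.WA_symm j).swap i m, mul_apply, mul_apply]
  exact Finset.sum_congr rfl fun b _ => by rw [C.A_symm]

-- Expressing ∇P through u in the Ricci identity for P gives a linear equation for ∇u. One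
-- contraction solves it up to a multiple of W; the multiplier f collects the traces of P² and of
-- the covariant derivative of the vector V u.
include hu in
theorem exists_cov_u {n : ℕ} (hn : 2 ≤ n) (hcard : Fintype.card ι = 2 * n) :
    ∃ f : S, ∀ i m, 2 * (C.d i (u m) - ∑ b, u b * C.A i b m)
      = -(C.W * C.P * C.P) i m + f * C.W i m := by
  set U := C.V *ᵥ u with hU
  -- The covariant derivative of the vector U; by `hT`, lowering its index with W gives that of u,
  -- called `y` below.
  let T : ι → ι → S := fun i x => C.d i (U x) + ∑ b, C.A i x b * U b
  have hWU : C.W *ᵥ U = u := by rw [hU, mulVec_mulVec, C.W_mul_V, one_mulVec]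
  have hcov : ∀ k x m, C.covP k x m = C.W k m * U x - u m * (1 : Matrix ι ι S) x k :=
    C.covP_apply hu
  have hdW : ∀ k i j, C.d k (C.W i j) = 0 := fun k i j => congrFun (congrFun (C.dW k) i) j
  have hd1 : ∀ k i j, C.d k ((1 : Matrix ι ι S) i j) = 0 :=
    fun k i j => congrFun (congrFun (der_one (C.d k)) i) j
  have hT : ∀ i m, ∑ x, C.W m x * T i x = C.d i (u m) - ∑ b, u b * C.A i b m := by
    intro i m
    have e1 : C.d i (u m) = ∑ x, C.W m x * C.d i (U x) := by
      conv_lhs => rw [← hWU]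
      simp only [mulVec, dotProduct, map_sum, Derivation.leibniz, hdW, smul_eq_mul, mul_zero,
        add_zero]
    have e2 : ∑ x, C.W m x * ∑ b, C.A i x b * U b = -∑ b, u b * C.A i b m := by
      have e3 : ∑ x, C.W m x * ∑ b, C.A i x b * U b = (C.W *ᵥ (C.A i *ᵥ U)) m := rfl
      have e4 : C.W * C.A i = -((C.A i)ᵀ * C.W) := by rw [C.transpose_A_mul_W, neg_neg]
      rw [e3, mulVec_mulVec, e4, neg_mulVec, ← mulVec_mulVec, hWU, Pi.neg_apply]
      congr 1
      exact Finset.sum_congr rfl fun b _ => mul_comm _ _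
    simp only [T, mul_add, Finset.sum_add_distrib]
    rw [e1, e2, sub_eq_add_neg]
  have hD : ∀ i j x m, ((C.covP j).der (C.d i) + C.A i * C.covP j - C.covP j * C.A i) x m
      = C.W j m * T i x - (1 : Matrix ι ι S) x j * (C.d i (u m) - ∑ b, u b * C.A i b m)
        - u m * C.A i x j - U x * (C.W * C.A i) j m := by
    intro i j x m
    have e1 : C.d i (C.covP j x m)
        = C.W j m * C.d i (U x) - (1 : Matrix ι ι S) x j * C.d i (u m) := by
      rw [hcov]
      simp only [map_sub, Derivation.leibniz, hdW, hd1, smul_eq_mul, mul_zero, add_zero, zero_add]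
    have e2 : (C.A i * C.covP j) x m = C.W j m * ∑ b, C.A i x b * U b - u m * C.A i x j := by
      simp only [mul_apply, hcov, mul_sub, Finset.sum_sub_distrib, one_apply, mul_ite, mul_one,
        mul_zero, Finset.sum_ite_eq', Finset.mem_univ, if_true]
      rw [Finset.mul_sum, mul_comm (u m)]
      congr 1
      exact Finset.sum_congr rfl fun b _ => by ring
    have e3 : (C.covP j * C.A i) x m
        = U x * (C.W * C.A i) j m - (1 : Matrix ι ι S) x j * ∑ b, u b * C.A i b m := by
      simp only [mul_apply, hcov, sub_mul, Finset.sum_sub_distrib]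
      rw [Finset.mul_sum, Finset.mul_sum]
      congr 1
      · exact Finset.sum_congr rfl fun b _ => by ring
      · exact Finset.sum_congr rfl fun b _ => by ring
    rw [Matrix.sub_apply, Matrix.add_apply, der_apply, e1, e2, e3]
    simp only [T]
    ring
  let y : ι → ι → S := fun i m => C.d i (u m) - ∑ b, u b * C.A i b m
  have hy : ∀ i m, C.d i (u m) - ∑ b, u b * C.A i b m = y i m := fun i m => rfl
  simp only [hy] at hT hD ⊢
  have hid : ∀ i j x m, 2 * (C.W j m * T i x - (1 : Matrix ι ι S) x j * y i m
      - C.W i m * T j x + (1 : Matrix ι ι S) x i * y j m)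
      = -((1 : Matrix ι ι S) x i * (C.W * C.P * C.P) j m)
        + (1 : Matrix ι ι S) x j * (C.W * C.P * C.P) i m
        + (C.P * C.P) x i * C.W j m - (C.P * C.P) x j * C.W i m := by
    intro i j x m
    rw [← C.ricci_commutator, ← C.covP_commutator, Matrix.sub_apply, hD, hD, C.A_symm i x j,
      C.sum_WA_swap i j m]
    ring
  -- The contraction x = j of `hid`, summed over j.
  have htr : ∀ i m, 4 * (n : S) * y i m = -(2 * (n : S) * (C.W * C.P * C.P) i m)
      + (∑ j, (C.P * C.P) j j - 2 * ∑ j, T j j) * C.W i m := by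
    intro i m
    have h := Finset.sum_congr (rfl : (Finset.univ : Finset ι) = Finset.univ)
      fun j _ => hid i j j m
    simp only [← Finset.mul_sum, Finset.sum_add_distrib, Finset.sum_sub_distrib,
      Finset.sum_neg_distrib, one_apply_eq, one_mul, Finset.sum_const, Finset.card_univ, hcard,
      nsmul_eq_mul, ← Finset.sum_mul] at h
    simp only [one_apply, ite_mul, one_mul, zero_mul, Finset.sum_ite_eq', Finset.mem_univ,
      if_true] at h
    have e1 : ∑ j, C.W j m * T i j = -y i m := by
      rw [← hT, ← Finset.sum_neg_distrib]
      exact Finset.sum_congr rfl fun j _ => by rw [skew_swap C.W_skew j m]; ring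
    have e2 : ∑ j, (C.P * C.P) j i * C.W j m = (C.W * C.P * C.P) i m := by
      rw [C.transpose_QP, Matrix.mul_assoc, mul_apply, ← Finset.sum_neg_distrib]
      exact Finset.sum_congr rfl fun j _ => by rw [skew_swap C.W_skew j m]; ring
    rw [e1, e2] at h
    push_cast at h
    linear_combination -h
  have hinv : algebraMap ℝ S (2 * n)⁻¹ * (2 * (n : S)) = 1 := by
    have : (2 * (n : S)) = algebraMap ℝ S (2 * n) := by simp [map_ofNat]
    rw [this, ← map_mul, inv_mul_cancel₀ (by positivity), map_one]
  refine ⟨algebraMap ℝ S (2 * n)⁻¹ * (∑ j, (C.P * C.P) j j - 2 * ∑ j, T j j), fun i m => ?_⟩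
  linear_combination (algebraMap ℝ S (2 * n)⁻¹) * htr i m
    - (2 * y i m + (C.W * C.P * C.P) i m) * hinv

/-- One half. -/
noncomputable def half (S : Type*) [CommRing S] [Algebra ℝ S] : S := algebraMap ℝ S (1 / 2)

theorem two_mul_half : 2 * half S = 1 := by
  rw [half, ← map_ofNat (algebraMap ℝ S) 2, ← map_mul]
  norm_num

/-- The tractor connection. -/
noncomputable def tractorConn (u : ι → S) (i : ι) : Matrix (ι ⊕ Fin 2) (ι ⊕ Fin 2) S :=
  fromBlocks (C.A i) (of fun x => ![(1 : Matrix ι ι S) x i, C.P x i])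
    (of ![fun m => half S * (C.W * C.P) m i, fun m => half S * C.W i m]) !![0, u i; 0, 0]

/-- The parallel endomorphism of the tractor bundle. -/
noncomputable def tractorEnd (u : ι → S) (f : S) : Matrix (ι ⊕ Fin 2) (ι ⊕ Fin 2) S :=
  fromBlocks C.P (of fun x => ![0, 2 * (C.V *ᵥ u) x]) (of ![u, 0]) !![0, f; 1, 0]

/-- This is what later places the gauge-transformed matrices in a symplectic Lie algebra, as the
Heisenberg lemma requires. -/
theorem tractorConn_skew (i : ι) :
    (C.tractorConn u i)ᵀ * tractorForm C.W + tractorForm C.W * C.tractorConn u i = 0 := by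
  rw [tractorConn, tractorForm, fromBlocks_transpose, fromBlocks_multiply, fromBlocks_multiply,
    fromBlocks_add, ← fromBlocks_zero]
  have h2 := two_mul_half (S := S)
  congr 1
  · rw [Matrix.mul_neg, C.transpose_A_mul_W]
    simp
  · ext x y
    fin_cases y
    · simp [mul_apply, Fin.sum_univ_two, one_apply]
      rw [skew_swap C.W_skew i x]
      linear_combination (C.W x i) * h2
    · simp [mul_apply, Fin.sum_univ_two]
      rw [← mul_apply]
      linear_combination ((C.W * C.P) x i) * h2
  · ext y x
    fin_cases y
    · simp [mul_apply, one_apply]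
      linear_combination (C.W i x) * h2
    · simp [mul_apply]
      rw [← mul_apply]
      have : ∑ z, C.P z i * C.W z x = -(C.W * C.P) x i := by
        rw [mul_apply, ← Finset.sum_neg_distrib]
        exact Finset.sum_congr rfl fun z _ => by rw [skew_swap C.W_skew z x]; ring
      rw [this]
      linear_combination -((C.W * C.P) x i) * h2
  · ext x y
    fin_cases x <;> fin_cases y <;> simp [mul_apply, Fin.sum_univ_two, mul_comm]

section Entries

variable (i x m : ι) (f : S)

theorem tractorConn_ll : C.tractorConn u i (Sum.inl x) (Sum.inl m) = C.A i x m := rfl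
theorem tractorConn_l0 : C.tractorConn u i (Sum.inl x) (Sum.inr 0) = (1 : Matrix ι ι S) x i := rfl
theorem tractorConn_l1 : C.tractorConn u i (Sum.inl x) (Sum.inr 1) = C.P x i := rfl
theorem tractorConn_0l :
    C.tractorConn u i (Sum.inr 0) (Sum.inl m) = half S * (C.W * C.P) m i := rfl
theorem tractorConn_1l : C.tractorConn u i (Sum.inr 1) (Sum.inl m) = half S * C.W i m := rfl
theorem tractorConn_00 : C.tractorConn u i (Sum.inr 0) (Sum.inr 0) = 0 := rfl
theorem tractorConn_01 : C.tractorConn u i (Sum.inr 0) (Sum.inr 1) = u i := rfl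
theorem tractorConn_10 : C.tractorConn u i (Sum.inr 1) (Sum.inr 0) = 0 := rfl
theorem tractorConn_11 : C.tractorConn u i (Sum.inr 1) (Sum.inr 1) = 0 := rfl
theorem tractorEnd_ll : C.tractorEnd u f (Sum.inl x) (Sum.inl m) = C.P x m := rfl
theorem tractorEnd_l0 : C.tractorEnd u f (Sum.inl x) (Sum.inr 0) = 0 := rfl
theorem tractorEnd_l1 : C.tractorEnd u f (Sum.inl x) (Sum.inr 1) = 2 * (C.V *ᵥ u) x := rfl
theorem tractorEnd_0l : C.tractorEnd u f (Sum.inr 0) (Sum.inl m) = u m := rfl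
theorem tractorEnd_1l : C.tractorEnd u f (Sum.inr 1) (Sum.inl m) = 0 := rfl
theorem tractorEnd_00 : C.tractorEnd u f (Sum.inr 0) (Sum.inr 0) = 0 := rfl
theorem tractorEnd_01 : C.tractorEnd u f (Sum.inr 0) (Sum.inr 1) = f := rfl
theorem tractorEnd_10 : C.tractorEnd u f (Sum.inr 1) (Sum.inr 0) = 1 := rfl
theorem tractorEnd_11 : C.tractorEnd u f (Sum.inr 1) (Sum.inr 1) = 0 := rfl

end Entries

-- Each block is a structure equation already available. Block (inl, inl) is the Ricci type identity
-- and (inl, inr 0) is absence of torsion. Blocks (inl, inr 1) and (inr 0, inl) are the formula for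
-- ∇P, (inr 1, inl) follows from the symmetries of A and W A, and (inr 0, inr 1) is the formula for
-- ∇u. The other three use the symmetry of W P or the skewness of W.
include hu in
theorem tractor_curvature {f : S}
    (hf : ∀ i m, 2 * (C.d i (u m) - ∑ b, u b * C.A i b m)
      = -(C.W * C.P * C.P) i m + f * C.W i m) (i j : ι) :
    (C.tractorConn u j).der (C.d i) - (C.tractorConn u i).der (C.d j)
      + C.tractorConn u i * C.tractorConn u j - C.tractorConn u j * C.tractorConn u i
      = C.W i j • C.tractorEnd u f := by
  have h2 := two_mul_half (S := S)
  have hdh : ∀ k, C.d k (half S) = 0 := fun k => (C.d k).map_algebraMap _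
  have hdW : ∀ k i j, C.d k (C.W i j) = 0 := fun k i j => congrFun (congrFun (C.dW k) i) j
  have hd1 : ∀ k i j, C.d k ((1 : Matrix ι ι S) i j) = 0 :=
    fun k i j => congrFun (congrFun (der_one (C.d k)) i) j
  have hdQ : ∀ k i j, C.d k ((C.W * C.P) i j) = (C.W * C.P.der (C.d k)) i j := fun k i j => by
    rw [C.W_mul_der]; rfl
  have hone : ∀ (g : ι → S) k, ∑ x, g x * (1 : Matrix ι ι S) x k = g k := fun g k => by
    simp [one_apply]
  have hcov := C.covP_apply hu
  ext p q
  rw [Matrix.smul_apply, Matrix.sub_apply, Matrix.add_apply, Matrix.sub_apply, der_apply,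
    der_apply, mul_apply, mul_apply]
  simp only [Fintype.sum_sum_type, Fin.sum_univ_two, smul_eq_mul]
  match p, q with
  | Sum.inl x, Sum.inl m =>
    simp only [tractorConn_ll, tractorConn_l0, tractorConn_l1, tractorConn_0l, tractorConn_1l,
      tractorEnd_ll]
    have h := C.R_apply i j x m
    simp only [R, Matrix.sub_apply, Matrix.add_apply, der_apply, mul_apply (M := C.A _)] at h
    rw [C.WP_symm.swap m i, C.WP_symm.swap m j]
    linear_combination half S * h - (C.d i (C.A j x m) - C.d j (C.A i x m)
      + ∑ b, C.A i x b * C.A j b m - ∑ b, C.A j x b * C.A i b m - C.W i j * C.P x m) * h2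
  | Sum.inl x, Sum.inr 0 =>
    simp only [tractorConn_ll, tractorConn_l0, tractorConn_l1, tractorConn_00, tractorConn_10,
      tractorEnd_l0, hd1, hone]
    rw [C.A_symm i x j]
    ring
  | Sum.inl x, Sum.inr 1 =>
    simp only [tractorConn_ll, tractorConn_l0, tractorConn_l1, tractorConn_01, tractorConn_11,
      tractorEnd_l1]
    have e1 := hcov i x j
    have e2 := hcov j x i
    simp only [covP, Matrix.sub_apply, Matrix.add_apply, der_apply] at e1 e2
    have e3 : (C.P * C.A i) x j = (C.P * C.A j) x i := by
      rw [mul_apply, mul_apply]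
      exact Finset.sum_congr rfl fun b _ => by rw [C.A_symm]
    rw [← mul_apply, ← mul_apply]
    rw [skew_swap C.W_skew j i] at e2
    linear_combination e1 - e2 + e3
  | Sum.inr 0, Sum.inl m =>
    simp only [tractorConn_ll, tractorConn_00, tractorConn_01, tractorConn_0l, tractorConn_1l,
      tractorEnd_0l, Derivation.leibniz, hdh, hdQ, smul_eq_mul, mul_zero, add_zero]
    have e0 : ∀ i j, ∑ x, half S * (C.W * C.P) x i * C.A j x m
        = half S * (C.W * (C.P * C.A j)) i m := by
      intro i j
      rw [← Matrix.mul_assoc, mul_apply (M := C.W * C.P), Finset.mul_sum]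
      exact Finset.sum_congr rfl fun x _ => by rw [C.WP_symm.swap x i]; ring
    rw [e0, e0]
    have e1 := hu i m j
    have e2 := hu j m i
    simp only [covP, mul_sub, mul_add, Matrix.sub_apply, Matrix.add_apply] at e1 e2
    have e3 : ∀ i j, (C.W * (C.A i * C.P)) m j = -(C.W * (C.P * C.A i)) j m := by
      intro i j
      have h1 : (C.W * (C.A i * C.P))ᵀ = -(C.W * (C.P * C.A i)) := by
        rw [← Matrix.mul_assoc, transpose_mul, (C.WA_symm i).eq, ← Matrix.mul_assoc,
          C.transpose_P_mul_W, ← Matrix.mul_assoc, Matrix.neg_mul]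
      exact congrFun (congrFun h1 j) m
    have e4 : ∀ i j, (C.W * (C.P * C.A i)) m j = (C.W * (C.P * C.A j)) m i := by
      intro i j
      rw [← Matrix.mul_assoc, ← Matrix.mul_assoc, mul_apply, mul_apply]
      exact Finset.sum_congr rfl fun b _ => by rw [C.A_symm]
    rw [e3] at e1 e2
    rw [skew_swap C.W_skew j i] at e2
    linear_combination half S * (e1 - e2 + e4 i j) + C.W i j * u m * h2
  | Sum.inr 1, Sum.inl m =>
    simp only [tractorConn_ll, tractorConn_10, tractorConn_11, tractorConn_0l, tractorConn_1l,
      tractorEnd_1l, Derivation.leibniz, hdh, hdW, smul_eq_mul, mul_zero, add_zero]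
    have e0 : ∀ i j, ∑ x, half S * C.W i x * C.A j x m = half S * (C.W * C.A j) i m := by
      intro i j
      rw [mul_apply, Finset.mul_sum]
      exact Finset.sum_congr rfl fun x _ => by ring
    rw [e0, e0, C.sum_WA_swap j i m]
    ring
  | Sum.inr 0, Sum.inr 0 =>
    simp only [tractorConn_l0, tractorConn_00, tractorConn_01, tractorConn_0l, tractorConn_10,
      tractorEnd_00, hone, map_zero]
    rw [C.WP_symm.swap j i]
    ring
  | Sum.inr 0, Sum.inr 1 =>
    simp only [tractorConn_l1, tractorConn_00, tractorConn_01, tractorConn_0l, tractorConn_11,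
      tractorEnd_01]
    have e0 : ∀ i j, ∑ x, half S * (C.W * C.P) x i * C.P x j
        = half S * (C.W * C.P * C.P) i j := by
      intro i j
      rw [mul_apply (M := C.W * C.P), Finset.mul_sum]
      exact Finset.sum_congr rfl fun x _ => by rw [C.WP_symm.swap x i]; ring
    have e1 := hf i j
    have e2 := hf j i
    have e3 : ∑ b, u b * C.A i b j = ∑ b, u b * C.A j b i :=
      Finset.sum_congr rfl fun b _ => by rw [C.A_symm]
    rw [e3] at e1
    rw [C.transpose_QP j i, skew_swap C.W_skew j i] at e2
    rw [e0, e0, C.transpose_QP j i]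
    linear_combination half S * (e1 - e2) - (C.d i (u j) - C.d j (u i) - C.W i j * f) * h2
  | Sum.inr 1, Sum.inr 0 =>
    simp only [tractorConn_l0, tractorConn_00, tractorConn_11, tractorConn_1l, tractorConn_10,
      tractorEnd_10, hone, map_zero]
    rw [skew_swap C.W_skew j i]
    linear_combination C.W i j * h2
  | Sum.inr 1, Sum.inr 1 =>
    simp only [tractorConn_l1, tractorConn_11, tractorConn_01, tractorConn_1l, tractorConn_10,
      tractorEnd_11, map_zero]
    have e0 : ∀ i j, ∑ x, half S * C.W i x * C.P x j = half S * (C.W * C.P) i j := by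
      intro i j
      rw [mul_apply, Finset.mul_sum]
      exact Finset.sum_congr rfl fun x _ => by ring
    rw [e0, e0, C.WP_symm.swap j i]
    ring

end RicciTypeData

section Bianchi

variable {ι N S : Type*} [Fintype ι] [DecidableEq ι] [Fintype N] [DecidableEq N]
  [CommRing S] [Algebra ℝ S]

/-- If the curvature of a connection is `W ⊗ a` with `W` constant and nondegenerate, in dimension
at least four, then `a` is parallel. -/
theorem parallel_of_curvature {n : ℕ} (hn : 2 ≤ n) (hcard : Fintype.card ι = 2 * n)
    {d : ι → Derivation ℝ S S} (hd : ∀ i j x, d i (d j x) = d j (d i x))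
    {W V : Matrix ι ι S} (hW : Wᵀ = -W) (hV : W * V = 1) (hdW : ∀ k, W.der (d k) = 0)
    {B : ι → Matrix N N S} {a : Matrix N N S}
    (hF : ∀ i j, (B j).der (d i) - (B i).der (d j) + B i * B j - B j * B i = W i j • a) (k : ι) :
    a.der (d k) + B k * a - a * B k = 0 := by
  have hV' : V * W = 1 := mul_eq_one_comm.mp hV
  set Θ : ι → Matrix N N S := fun k => a.der (d k) + B k * a - a * B k with hΘ
  change Θ k = 0
  have hs : ∀ i j k, (W i j • a).der (d k) = W i j • a.der (d k) := by
    intro i j k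
    ext p q
    have : d k (W i j) = 0 := congrFun (congrFun (hdW k) i) j
    simp [Derivation.leibniz, this]
  have h1 : ∀ i j k, W i j • Θ k
      = (W i j • a).der (d k) + B k * (W i j • a) - (W i j • a) * B k := by
    intro i j k
    simp only [hΘ, hs, smul_sub, smul_add, mul_smul_comm, smul_mul_assoc]
  -- The Bianchi identity of B, in which the constant factor W comes out.
  have hcyc : ∀ i j k, W i j • Θ k + W j k • Θ i + W k i • Θ j = 0 := by
    intro i j k
    have h : ∀ x y (M : Matrix N N S), (M.der (d x)).der (d y) = (M.der (d y)).der (d x) :=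
      fun x y M => der_comm (hd y x) M
    rw [h1, h1, h1, ← hF, ← hF, ← hF]
    simp only [der_add, der_sub, der_mul]
    rw [h i k, h j k, h i j]
    noncomm_ring
  -- Contracted with V, the three terms give 2n, -1 and -1 times Θ_k, so 2n - 2 annihilates Θ_k.
  have h2 : ∑ i, ∑ j, V j i • (W i j • Θ k + W j k • Θ i + W k i • Θ j) = 0 :=
    Finset.sum_eq_zero fun i _ => Finset.sum_eq_zero fun j _ => by rw [hcyc, smul_zero]
  simp only [smul_add, smul_smul, Finset.sum_add_distrib] at h2
  have c1 : ∑ i, ∑ j, (V j i * W i j) • Θ k = ((2 * n : ℕ) : S) • Θ k := by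
    rw [Finset.sum_comm]
    have : ∀ j, ∑ i, (V j i * W i j) • Θ k = Θ k := fun j => by
      rw [← Finset.sum_smul, ← mul_apply, hV', one_apply_eq, one_smul]
    simp only [this, Finset.sum_const, Finset.card_univ, hcard]
    rw [Nat.cast_smul_eq_nsmul]
  have c2 : ∑ i, ∑ j, (V j i * W j k) • Θ i = -Θ k := by
    have : ∀ i, ∑ j, (V j i * W j k) • Θ i = -((1 : Matrix ι ι S) k i • Θ i) := fun i => by
      rw [← Finset.sum_smul, ← neg_smul, ← hV, mul_apply, ← Finset.sum_neg_distrib]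
      congr 1
      exact Finset.sum_congr rfl fun j _ => by rw [skew_swap hW j k]; ring
    simp only [this, Finset.sum_neg_distrib, one_apply, ite_smul, one_smul, zero_smul,
      Finset.sum_ite_eq, Finset.mem_univ, if_true]
  have c3 : ∑ i, ∑ j, (V j i * W k i) • Θ j = -Θ k := by
    rw [Finset.sum_comm]
    have : ∀ j, ∑ i, (V j i * W k i) • Θ j = -((1 : Matrix ι ι S) j k • Θ j) := fun i => by
      rw [← Finset.sum_smul, ← neg_smul, ← hV', mul_apply, ← Finset.sum_neg_distrib]
      congr 1
      exact Finset.sum_congr rfl fun j _ => by rw [skew_swap hW k j]; ring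
    simp only [this, Finset.sum_neg_distrib, one_apply, ite_smul, one_smul, zero_smul,
      Finset.sum_ite_eq', Finset.mem_univ, if_true]
  rw [c1, c2, c3] at h2
  ext p q
  have h3 := congrFun (congrFun h2 p) q
  simp only [Matrix.add_apply, Matrix.smul_apply, Matrix.neg_apply, smul_eq_mul,
    Matrix.zero_apply] at h3
  have h4 : ((2 * n - 2 : ℕ) : S) * Θ k p q = 0 := by
    rw [Nat.cast_sub (by omega)]
    push_cast at h3 ⊢
    linear_combination h3
  exact natCast_mul_cancel (by omega) h4

end Bianchi

end

/-! ### Formal gauge transformations to constant connections on a torus. -/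

section

open Matrix PowerSeries

/-- Builds the coefficients of a power series one order at a time: values of index at least k are
hidden from the k-th step by replacing them with 0. -/
theorem exists_strong_recursion {α : Type*} [Zero α] (F : ℕ → (ℕ → α) → α) :
    ∃ f : ℕ → α, ∀ k, f k = F k fun i => if i < k then f i else 0 := by
  let f : ℕ → α := fun k => WellFounded.fix (C := fun _ => α) (measure id).wf
    (fun k ih => F k fun i => if h : i < k then ih i h else 0) k
  refine ⟨f, fun k => ?_⟩
  have h := WellFounded.fix_eq (C := fun _ => α) (measure id).wf
    (fun k ih => F k fun i => if h : i < k then ih i h else 0) k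
  exact h

section PowerSeriesMatrix

set_option linter.unusedSectionVars false

variable {C : Type*} [CommRing C] [Algebra ℝ C]

/-- Coefficientwise extension of a derivation to power series. -/
noncomputable def psDer (δ : Derivation ℝ C C) : Derivation ℝ C⟦X⟧ C⟦X⟧ :=
  Derivation.mk'
    { toFun := fun f => PowerSeries.mk fun k => δ (coeff k f)
      map_add' := fun f g => by ext k; simp
      map_smul' := fun r f => by ext k; simp }
    (fun f g => by
      ext k
      simp only [LinearMap.coe_mk, AddHom.coe_mk, coeff_mk, coeff_mul, map_sum, smul_eq_mul,
        Derivation.leibniz, map_add, Finset.sum_add_distrib]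
      rw [add_right_inj]
      rw [← Finset.Nat.sum_antidiagonal_swap]
      rfl)

@[simp] theorem coeff_psDer (δ : Derivation ℝ C C) (f : C⟦X⟧) (k : ℕ) :
    coeff k (psDer δ f) = δ (coeff k f) := by
  change coeff k (PowerSeries.mk fun k => δ (coeff k f)) = _
  rw [coeff_mk]

theorem psDer_comm {δ δ' : Derivation ℝ C C} (h : ∀ x, δ (δ' x) = δ' (δ x)) (f : C⟦X⟧) :
    psDer δ (psDer δ' f) = psDer δ' (psDer δ f) := by
  ext k; simp [h]

variable {N : Type*}

/-- The `k`-th coefficient of a matrix of power series. -/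
noncomputable def Matrix.cf (k : ℕ) (M : Matrix N N C⟦X⟧) : Matrix N N C := M.map (coeff k)

theorem Matrix.cf_ext {M M' : Matrix N N C⟦X⟧} (h : ∀ k, M.cf k = M'.cf k) : M = M' := by
  ext i j k
  exact congrFun (congrFun (h k) i) j

theorem Matrix.cf_add (k : ℕ) (M M' : Matrix N N C⟦X⟧) : (M + M').cf k = M.cf k + M'.cf k := by
  ext; simp [cf]

theorem Matrix.cf_sub (k : ℕ) (M M' : Matrix N N C⟦X⟧) : (M - M').cf k = M.cf k - M'.cf k := by
  ext; simp [cf]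

theorem Matrix.cf_zero (k : ℕ) : (0 : Matrix N N C⟦X⟧).cf k = 0 := by
  ext; simp [cf]

theorem Matrix.cf_der (δ : Derivation ℝ C C) (k : ℕ) (M : Matrix N N C⟦X⟧) :
    (M.der (psDer δ)).cf k = (M.cf k).der δ := by
  ext; simp [cf]

theorem Matrix.cf_mul [Fintype N] (k : ℕ) (M M' : Matrix N N C⟦X⟧) :
    (M * M').cf k = ∑ p ∈ Finset.HasAntidiagonal.antidiagonal k, M.cf p.1 * M'.cf p.2 := by
  ext i j
  simp only [cf, map_apply, mul_apply, map_sum, coeff_mul, Matrix.sum_apply]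
  rw [Finset.sum_comm]

theorem Matrix.cf_zero_mul [Fintype N] (M M' : Matrix N N C⟦X⟧) :
    (M * M').cf 0 = M.cf 0 * M'.cf 0 := by
  simp [cf_mul]

theorem Matrix.cf_zero_apply (M : Matrix N N C⟦X⟧) (i j : N) :
    M.cf 0 i j = constantCoeff (M i j) := by
  simp [cf]

variable [Fintype N] [DecidableEq N]

theorem Matrix.cf_zero_one : (1 : Matrix N N C⟦X⟧).cf 0 = 1 := by
  ext i j
  by_cases h : i = j
  · subst h; simp [cf]
  · simp [cf, h]

theorem Matrix.isUnit_det_of_cf_zero {M : Matrix N N C⟦X⟧} (h : M.cf 0 = 1) : IsUnit M.det := by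
  rw [PowerSeries.isUnit_iff_constantCoeff, RingHom.map_det]
  have : (constantCoeff (R := C)).mapMatrix M = M.cf 0 := by
    ext i j; simp [cf]
  rw [this, h, det_one]
  exact isUnit_one

end PowerSeriesMatrix

section Sylvester

variable {C : Type*} [CommRing C] [Algebra ℝ C] {N : Type*} [Fintype N] [DecidableEq N]

/-- The operator `X ↦ bX - Xc` on matrices. -/
noncomputable def sylvester (b c : Matrix N N C) : Module.End ℝ (Matrix N N C) :=
  LinearMap.mulLeft ℝ b - LinearMap.mulRight ℝ c

theorem sylvester_apply (b c x : Matrix N N C) : sylvester b c x = b * x - x * c := rfl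

theorem sylvester_nilpotent {b c : Matrix N N C} (hb : IsNilpotent b) (hc : IsNilpotent c) :
    IsNilpotent (sylvester b c) := by
  refine Commute.isNilpotent_sub (LinearMap.commute_mulLeft_right _ _) ?_ ?_
  · exact (LinearMap.isNilpotent_mulLeft_iff ℝ b).mpr hb
  · exact (LinearMap.isNilpotent_mulRight_iff ℝ c).mpr hc

theorem der_sylvester_pow {δ : Derivation ℝ C C} {b c : Matrix N N C} (hb : b.der δ = 0)
    (hc : c.der δ = 0) (q : ℕ) (x : Matrix N N C) :
    ((sylvester b c ^ q) x).der δ = (sylvester b c ^ q) (x.der δ) := by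
  induction q generalizing x with
  | zero => rfl
  | succ q ih =>
    rw [pow_succ, Module.End.mul_apply, Module.End.mul_apply, ih]
    congr 1
    simp only [sylvester_apply, der_sub, der_mul, hb, hc, Matrix.zero_mul, Matrix.mul_zero,
      zero_add, add_zero]

end Sylvester

/-- `M` is constant in the first `p` directions. -/
def ConstUpTo {m : ℕ} {S N : Type*} [CommRing S] [Algebra ℝ S] (d : Fin m → Derivation ℝ S S)
    (p : ℕ) (M : Matrix N N S) : Prop :=
  ∀ j : Fin m, (j : ℕ) < p → M.der (d j) = 0

section ConstUpTo

set_option linter.unusedSectionVars false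

variable {m : ℕ} {S N : Type*} [CommRing S] [Algebra ℝ S] [Fintype N] [DecidableEq N]
  {d : Fin m → Derivation ℝ S S} {p : ℕ} {M M' : Matrix N N S}

theorem ConstUpTo.add (h : ConstUpTo d p M) (h' : ConstUpTo d p M') : ConstUpTo d p (M + M') :=
  fun j hj => by rw [der_add, h j hj, h' j hj, add_zero]

theorem ConstUpTo.sub (h : ConstUpTo d p M) (h' : ConstUpTo d p M') : ConstUpTo d p (M - M') :=
  fun j hj => by rw [der_sub, h j hj, h' j hj, sub_zero]

theorem ConstUpTo.mul (h : ConstUpTo d p M) (h' : ConstUpTo d p M') : ConstUpTo d p (M * M') :=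
  fun j hj => by rw [der_mul, h j hj, h' j hj, Matrix.zero_mul, Matrix.mul_zero, add_zero]

theorem ConstUpTo.zero : ConstUpTo d p (0 : Matrix N N S) := fun _ _ => der_zero _

theorem ConstUpTo.one : ConstUpTo d p (1 : Matrix N N S) := fun _ _ => der_one _

theorem ConstUpTo.sum {α : Type*} {s : Finset α} {f : α → Matrix N N S}
    (h : ∀ x ∈ s, ConstUpTo d p (f x)) : ConstUpTo d p (∑ x ∈ s, f x) :=
  Finset.sum_induction f (ConstUpTo d p) (fun _ _ => ConstUpTo.add) ConstUpTo.zero h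

theorem ConstUpTo.der (hd : ∀ i j x, d i (d j x) = d j (d i x)) (i : Fin m)
    (h : ConstUpTo d p M) : ConstUpTo d p (M.der (d i)) :=
  fun j hj => by rw [der_comm (hd j i), h j hj, der_zero]

theorem ConstUpTo.inv (hM : IsUnit M.det) (h : ConstUpTo d p M) : ConstUpTo d p M⁻¹ := by
  intro j hj
  have h1 := congrArg (Matrix.der (d j)) (mul_nonsing_inv M hM)
  rw [der_mul, h j hj, Matrix.zero_mul, zero_add, der_one] at h1
  rw [← Matrix.one_mul (M⁻¹.der (d j)), ← nonsing_inv_mul M hM, Matrix.mul_assoc, h1,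
    Matrix.mul_zero]

end ConstUpTo

/-- Functions that behave like smooth functions on a torus `T^m`: up to functions independent of
the `i`-th coordinate every function has a primitive in that direction, depending on no more
coordinates, and a function whose second derivative vanishes is constant. -/
structure IsTorusLike {m : ℕ} {C : Type*} [CommRing C] [Algebra ℝ C]
    (d : Fin m → Derivation ℝ C C) : Prop where
  comm : ∀ i j x, d i (d j x) = d j (d i x)
  exists_primitive : ∀ i c, (∀ j < i, d j c = 0) →
    ∃ e, (∀ j < i, d j e = 0) ∧ d i (d i e - c) = 0
  der_eq_zero : ∀ i x, d i (d i x) = 0 → d i x = 0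

section GaugeTransformation

variable {S N : Type*} [CommRing S] [Algebra ℝ S] [Fintype N] {δ δ' : Derivation ℝ S S}
  {Γ a a' b b' c c' : Matrix N N S}

/-- Gauge covariance of the covariant derivative, kept multiplied by Γ so that no inverse enters;
the same is done for the curvature next. -/
theorem gauge_parallel (hb : Γ.der δ + b * Γ = Γ * b') (ha : a * Γ = Γ * a') :
    Γ * (a'.der δ + b' * a' - a' * b') = (a.der δ + b * a - a * b) * Γ := by
  have h1 := congrArg (Matrix.der δ) ha
  rw [der_mul, der_mul] at h1
  have e1 : Γ * (b' * a') = (Γ.der δ + b * Γ) * a' := by rw [hb, Matrix.mul_assoc]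
  have e2 : Γ * (a' * b') = a * (Γ.der δ + b * Γ) := by
    rw [hb, ← Matrix.mul_assoc, ← ha, Matrix.mul_assoc]
  have e3 : Γ * a'.der δ = a.der δ * Γ + a * Γ.der δ - Γ.der δ * a' := by
    rw [h1]; noncomm_ring
  have e4 : b * Γ * a' = b * a * Γ := by rw [Matrix.mul_assoc, ← ha, Matrix.mul_assoc]
  rw [mul_sub, mul_add, e1, e2, e3, add_mul, e4]
  noncomm_ring

theorem gauge_curvature (hδ : ∀ x, δ (δ' x) = δ' (δ x)) (hb : Γ.der δ + b * Γ = Γ * b')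
    (hc : Γ.der δ' + c * Γ = Γ * c') :
    Γ * (c'.der δ - b'.der δ' + b' * c' - c' * b')
      = (c.der δ - b.der δ' + b * c - c * b) * Γ := by
  have h1 := congrArg (Matrix.der δ) hc
  have h2 := congrArg (Matrix.der δ') hb
  rw [der_mul, der_add, der_mul] at h1 h2
  rw [← der_comm hδ] at h2
  have e1 : Γ * c'.der δ = (Γ.der δ').der δ + (c.der δ * Γ + c * Γ.der δ) - Γ.der δ * c' := by
    rw [h1]; noncomm_ring
  have e2 : Γ * b'.der δ' = (Γ.der δ').der δ + (b.der δ' * Γ + b * Γ.der δ') - Γ.der δ' * b' := by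
    rw [h2]; noncomm_ring
  have e3 : Γ * (b' * c') = Γ.der δ * c' + b * (Γ.der δ' + c * Γ) := by
    rw [hc, ← Matrix.mul_assoc, ← hb, add_mul, Matrix.mul_assoc]
  have e4 : Γ * (c' * b') = Γ.der δ' * b' + c * (Γ.der δ + b * Γ) := by
    rw [hb, ← Matrix.mul_assoc, ← hc, add_mul, Matrix.mul_assoc]
  rw [mul_sub, mul_add, mul_sub, e1, e2, e3, e4]
  noncomm_ring

end GaugeTransformation

section Gauge

set_option linter.unusedSectionVars false

variable {m : ℕ} {C : Type*} [CommRing C] [Algebra ℝ C] {N : Type*} [Fintype N] [DecidableEq N]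
  {d : Fin m → Derivation ℝ C C} (hT : IsTorusLike d)

include hT

theorem IsTorusLike.exists_matrix_primitive (i : Fin m) {M : Matrix N N C}
    (h : ConstUpTo d i M) : ∃ E, ConstUpTo d i E ∧ (E.der (d i) - M).der (d i) = 0 := by
  have h1 : ∀ x y, ∃ e, (∀ j < i, d j e = 0) ∧ d i (d i e - M x y) = 0 := fun x y =>
    hT.exists_primitive i (M x y) fun j hj => congrFun (congrFun (h j hj) x) y
  choose E hE using h1
  refine ⟨of E, fun j hj => ?_, ?_⟩
  · ext x y
    exact (hE x y).1 j hj
  · ext x y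
    exact (hE x y).2

theorem IsTorusLike.matrix_der_eq_zero (i : Fin m) {M : Matrix N N C}
    (h : (M.der (d i)).der (d i) = 0) : M.der (d i) = 0 := by
  ext x y
  exact hT.der_eq_zero i _ (congrFun (congrFun h x) y)

/-- With N the Sylvester operator, a primitive e of M (modulo functions constant in direction i)
solves the equation up to the error N e. Correcting the error repeatedly produces an alternating
series in powers of N, which stops because N is nilpotent. -/
theorem IsTorusLike.exists_sylvester_primitive (i : Fin m) {b c : Matrix N N C}
    (hb : IsNilpotent b) (hc : IsNilpotent c) (hbd : ConstUpTo d (i + 1) b)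
    (hcd : ConstUpTo d (i + 1) c) {M : Matrix N N C} (hM : ConstUpTo d i M) :
    ∃ E, ConstUpTo d i E ∧ (E.der (d i) + sylvester b c E - M).der (d i) = 0 := by
  obtain ⟨K, hK⟩ := sylvester_nilpotent hb hc
  have hcomm : ∀ j : Fin m, (j : ℕ) < i + 1 → ∀ q x,
      ((sylvester b c ^ q) x).der (d j) = (sylvester b c ^ q) (x.der (d j)) :=
    fun j hj q x => der_sylvester_pow (hbd j hj) (hcd j hj) q x
  have hconst : ∀ q x, ConstUpTo d i x → ConstUpTo d i ((sylvester b c ^ q) x) := by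
    intro q x hx j hj
    rw [hcomm j (by omega), hx j hj, map_zero]
  -- Descending induction on the power q of the operator, starting from q = K where the right-hand
  -- side is zero.
  have claim : ∀ r q, q + r = K → ∀ s, ConstUpTo d i s →
      ∃ E, ConstUpTo d i E ∧
        (E.der (d i) + sylvester b c E - (sylvester b c ^ q) s).der (d i) = 0 := by
    intro r
    induction r with
    | zero =>
      intro q hq s _
      refine ⟨0, ConstUpTo.zero, ?_⟩
      rw [add_zero] at hq
      rw [hq, hK, der_zero, map_zero]
      simp [der_zero]
    | succ r ih =>
      intro q hq s hs
      obtain ⟨e, he, he'⟩ := hT.exists_matrix_primitive i hs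
      obtain ⟨g, hg, hg'⟩ := ih (q + 1) (by omega) e he
      refine ⟨(sylvester b c ^ q) e - g, (hconst q e he).sub hg, ?_⟩
      have h1 : ((sylvester b c ^ q) (e.der (d i) - s)).der (d i) = 0 := by
        rw [hcomm i (by omega), he', map_zero]
      have h2 : ((sylvester b c ^ q) e - g).der (d i) + sylvester b c ((sylvester b c ^ q) e - g)
          - (sylvester b c ^ q) s = (sylvester b c ^ q) (e.der (d i) - s)
          - (g.der (d i) + sylvester b c g - (sylvester b c ^ (q + 1)) e) := by
        rw [der_sub, hcomm i (by omega), map_sub, map_sub, pow_succ', Module.End.mul_apply]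
        abel
      rw [h2, der_sub, h1, hg', sub_zero]
  simpa using claim K 0 (zero_add K) M hM

/-- Write N for the Sylvester operator. If N^(q+1) ∂M = 0, then the second derivative of N^q M
vanishes, so on a torus N^q ∂M = 0. Nilpotency starts this descent, which ends at q = 0. -/
theorem IsTorusLike.der_eq_zero_of_sylvester (i : Fin m) {b c : Matrix N N C}
    (hb : IsNilpotent b) (hc : IsNilpotent c) (hbd : b.der (d i) = 0) (hcd : c.der (d i) = 0)
    {M : Matrix N N C} (hM : (M.der (d i)).der (d i) + sylvester b c (M.der (d i)) = 0) :
    M.der (d i) = 0 := by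
  obtain ⟨K, hK⟩ := sylvester_nilpotent hb hc
  have hcomm := der_sylvester_pow hbd hcd
  have claim : ∀ r q, q + r = K → (sylvester b c ^ q) (M.der (d i)) = 0 := by
    intro r
    induction r with
    | zero =>
      intro q hq
      rw [add_zero] at hq
      rw [hq, hK]; rfl
    | succ r ih =>
      intro q hq
      have h1 := ih (q + 1) (by omega)
      rw [← hcomm]
      apply hT.matrix_der_eq_zero
      rw [hcomm, hcomm, eq_neg_of_add_eq_zero_left hM, map_neg, ← Module.End.mul_apply,
        ← pow_succ, h1, neg_zero]
  simpa using claim K 0 (zero_add K)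

/-- At order k only the constant terms of b and c meet the k-th coefficient of ∂M, since the lower
coefficients of ∂M vanish by induction. What is left is the Sylvester equation with nilpotent
coefficients. -/
theorem IsTorusLike.der_series_eq_zero (i : Fin m) {b c M : Matrix N N C⟦X⟧}
    (hb : IsNilpotent (b.cf 0)) (hc : IsNilpotent (c.cf 0)) (hbd : b.der (psDer (d i)) = 0)
    (hcd : c.der (psDer (d i)) = 0)
    (hM : (M.der (psDer (d i)) + b * M - M * c).der (psDer (d i)) = 0) :
    M.der (psDer (d i)) = 0 := by
  apply cf_ext
  intro k
  rw [cf_zero]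
  induction k using Nat.strong_induction_on with
  | _ k ih =>
    rw [cf_der]
    refine hT.der_eq_zero_of_sylvester i hb hc ?_ ?_ ?_
    · rw [← cf_der, hbd, cf_zero]
    · rw [← cf_der, hcd, cf_zero]
    have h := congrArg (Matrix.cf k) hM
    rw [der_sub, der_add, der_mul, der_mul, hbd, hcd, Matrix.zero_mul, Matrix.mul_zero, zero_add,
      add_zero, cf_zero, cf_sub, cf_add, cf_mul, cf_mul, cf_der, cf_der] at h
    rw [Finset.sum_eq_single (0, k), Finset.sum_eq_single (k, 0)] at h
    · rw [cf_der] at h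
      rw [sylvester_apply, ← add_sub_assoc]
      exact h
    · rintro ⟨p, q⟩ hpq hne
      rw [Finset.HasAntidiagonal.mem_antidiagonal] at hpq
      have : p < k := by
        rcases Nat.lt_or_ge p k with h | h
        · exact h
        · exact absurd (Prod.ext (by simp only at hpq ⊢; omega) (by simp only at hpq ⊢; omega)) hne
      rw [ih p this, Matrix.zero_mul]
    · intro hn
      exact absurd (by simp) hn
    · rintro ⟨p, q⟩ hpq hne
      rw [Finset.HasAntidiagonal.mem_antidiagonal] at hpq
      have : q < k := by
        rcases Nat.lt_or_ge q k with h | h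
        · exact h
        · exact absurd (Prod.ext (by simp only at hpq ⊢; omega) (by simp only at hpq ⊢; omega)) hne
      rw [ih q this, Matrix.mul_zero]
    · intro hn
      exact absurd (by simp) hn

/-- At order k the unknowns must satisfy c_k = ∂g_k + [b_0, g_k] - (terms of lower order in g and
c). The Sylvester primitive lemma chooses g_k so that c_k is constant in direction i. -/
theorem IsTorusLike.exists_gauge_one (i : Fin m) {b : Matrix N N C⟦X⟧}
    (hb : IsNilpotent (b.cf 0)) (hb0 : (b.cf 0).der (d i) = 0)
    (hbd : ConstUpTo (fun j => psDer (d j)) i b) :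
    ∃ G c : Matrix N N C⟦X⟧, G.cf 0 = 1 ∧ ConstUpTo (fun j => psDer (d j)) i G ∧
      c.der (psDer (d i)) = 0 ∧ G.der (psDer (d i)) + b * G = G * c := by
  have hbk : ∀ k, ConstUpTo d i (b.cf k) := fun k j hj => by
    rw [← cf_der, hbd j hj, cf_zero]
  have hb0' : ConstUpTo d (i + 1) (b.cf 0) := by
    intro j hj
    rcases Nat.lt_succ_iff_lt_or_eq.mp hj with h | h
    · exact hbk 0 j h
    · rw [Fin.ext h, hb0]
  have hσ : ∀ S : Matrix N N C, ∃ g : Matrix N N C, ConstUpTo d i S → ConstUpTo d i g ∧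
      (g.der (d i) + sylvester (b.cf 0) (b.cf 0) g - S).der (d i) = 0 := by
    intro S
    by_cases hS : ConstUpTo d i S
    · obtain ⟨g, hg⟩ := hT.exists_sylvester_primitive i hb hb hb0' hb0' hS
      exact ⟨g, fun _ => hg⟩
    · exact ⟨0, fun h => absurd h hS⟩
  choose σ hσ using hσ
  -- It is evaluated only on sequences truncated below k, so g_k c_0, g_0 c_k and b_0 g_k contribute
  -- nothing to it.
  let rhs : ℕ → (ℕ → Matrix N N C × Matrix N N C) → Matrix N N C := fun k f =>
    ∑ p ∈ Finset.HasAntidiagonal.antidiagonal k, (f p.1).1 * (f p.2).2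
      - ∑ p ∈ Finset.HasAntidiagonal.antidiagonal k, b.cf p.1 * (f p.2).1
  obtain ⟨f, hf⟩ := exists_strong_recursion (α := Matrix N N C × Matrix N N C) fun k f =>
    if k = 0 then (1, b.cf 0) else
      (σ (rhs k f), (σ (rhs k f)).der (d i) + sylvester (b.cf 0) (b.cf 0) (σ (rhs k f)) - rhs k f)
  let tr : ℕ → ℕ → Matrix N N C × Matrix N N C := fun k j => if j < k then f j else 0
  have hf0 : f 0 = (1, b.cf 0) := by rw [hf]; rfl
  have hfk : ∀ k, k ≠ 0 → f k = (σ (rhs k (tr k)), (σ (rhs k (tr k))).der (d i)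
      + sylvester (b.cf 0) (b.cf 0) (σ (rhs k (tr k))) - rhs k (tr k)) := by
    intro k hk
    rw [hf, if_neg hk]
  have hconst : ∀ k, ConstUpTo d i (f k).1 ∧ ConstUpTo d i (f k).2 := by
    intro k
    induction k using Nat.strong_induction_on with
    | _ k ih =>
      by_cases hk : k = 0
      · rw [hk, hf0]
        exact ⟨ConstUpTo.one, hbk 0⟩
      · have htr : ∀ j, ConstUpTo d i (tr k j).1 ∧ ConstUpTo d i (tr k j).2 := by
          intro j
          simp only [tr]
          split_ifs with h
          · exact ih j h
          · exact ⟨ConstUpTo.zero, ConstUpTo.zero⟩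
        have hr : ConstUpTo d i (rhs k (tr k)) :=
          (ConstUpTo.sum fun p _ => (htr _).1.mul (htr _).2).sub
            (ConstUpTo.sum fun p _ => (hbk _).mul (htr _).1)
        have hg := (hσ _ hr).1
        rw [hfk k hk]
        exact ⟨hg, ((hg.der hT.comm i).add (((hbk 0).mul hg).sub (hg.mul (hbk 0)))).sub hr⟩
  have hfi : ∀ k, (f k).2.der (d i) = 0 := by
    intro k
    by_cases hk : k = 0
    · rw [hk, hf0]; exact hb0
    · have hr : ConstUpTo d i (rhs k (tr k)) := by
        have htr : ∀ j, ConstUpTo d i (tr k j).1 ∧ ConstUpTo d i (tr k j).2 := by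
          intro j
          simp only [tr]
          split_ifs with h
          · exact hconst j
          · exact ⟨ConstUpTo.zero, ConstUpTo.zero⟩
        exact (ConstUpTo.sum fun p _ => (htr _).1.mul (htr _).2).sub
            (ConstUpTo.sum fun p _ => (hbk _).mul (htr _).1)
      rw [hfk k hk]
      exact (hσ _ hr).2
  let G : Matrix N N C⟦X⟧ := of fun x y => PowerSeries.mk fun k => (f k).1 x y
  let c : Matrix N N C⟦X⟧ := of fun x y => PowerSeries.mk fun k => (f k).2 x y
  have hG : ∀ k, G.cf k = (f k).1 := fun k => by ext; simp [G, cf]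
  have hc : ∀ k, c.cf k = (f k).2 := fun k => by ext; simp [c, cf]
  refine ⟨G, c, by rw [hG, hf0], fun j hj => ?_, ?_, ?_⟩
  · apply cf_ext
    intro k
    rw [cf_der, hG, (hconst k).1 j hj, cf_zero]
  · apply cf_ext
    intro k
    rw [cf_der, hc, hfi, cf_zero]
  · apply cf_ext
    intro k
    rw [cf_add, cf_mul, cf_mul, cf_der]
    simp only [hG, hc]
    by_cases hk : k = 0
    · subst hk
      simp [hf0, der_one]
    · have hk0 : (k, 0) ∈ Finset.HasAntidiagonal.antidiagonal k := by simp
      have h0k : (0, k) ∈ Finset.HasAntidiagonal.antidiagonal k := by simp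
      have htrk : tr k k = 0 := if_neg (lt_irrefl k)
      have htrl : ∀ j < k, tr k j = f j := fun j hj => if_pos hj
      have e1 : ∑ p ∈ Finset.HasAntidiagonal.antidiagonal k, (f p.1).1 * (f p.2).2
          = ∑ p ∈ Finset.HasAntidiagonal.antidiagonal k, (tr k p.1).1 * (tr k p.2).2
            + (f k).1 * b.cf 0 + (f k).2 := by
        have h : ∀ p ∈ Finset.HasAntidiagonal.antidiagonal k, (f p.1).1 * (f p.2).2
            = (tr k p.1).1 * (tr k p.2).2 + (if p = (k, 0) then (f k).1 * b.cf 0 else 0)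
              + (if p = (0, k) then (f k).2 else 0) := by
          rintro ⟨p, q⟩ hpq
          rw [Finset.HasAntidiagonal.mem_antidiagonal] at hpq
          simp only at hpq
          by_cases hp : p = k
          · obtain rfl : q = 0 := by omega
            subst hp
            simp [htrk, hf0, hk]
          · by_cases hq : q = k
            · obtain rfl : p = 0 := by omega
              subst hq
              simp [htrk, hf0, hp]
            · rw [htrl p (by omega), htrl q (by omega)]
              simp [hp, hq]
        rw [Finset.sum_congr rfl h, Finset.sum_add_distrib, Finset.sum_add_distrib,
          Finset.sum_ite_eq', Finset.sum_ite_eq', if_pos hk0, if_pos h0k]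
      have e2 : ∑ p ∈ Finset.HasAntidiagonal.antidiagonal k, b.cf p.1 * (f p.2).1
          = ∑ p ∈ Finset.HasAntidiagonal.antidiagonal k, b.cf p.1 * (tr k p.2).1
            + b.cf 0 * (f k).1 := by
        have h : ∀ p ∈ Finset.HasAntidiagonal.antidiagonal k, b.cf p.1 * (f p.2).1
            = b.cf p.1 * (tr k p.2).1 + (if p = (0, k) then b.cf 0 * (f k).1 else 0) := by
          rintro ⟨p, q⟩ hpq
          rw [Finset.HasAntidiagonal.mem_antidiagonal] at hpq
          simp only at hpq
          by_cases hq : q = k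
          · obtain rfl : p = 0 := by omega
            subst hq
            simp [htrk]
          · rw [htrl q (by omega)]
            simp [hq]
        rw [Finset.sum_congr rfl h, Finset.sum_add_distrib, Finset.sum_ite_eq', if_pos h0k]
      have e3 : (f k).2 = (f k).1.der (d i) + (b.cf 0 * (f k).1 - (f k).1 * b.cf 0)
          - rhs k (tr k) := by
        rw [hfk k hk]; rfl
      rw [e1, e2, e3]
      simp only [rhs]
      abel

/-- Directions are straightened one at a time. Once the i-th connection matrix is constant in
direction i, parallelism of a and the curvature equation force a and all other connection matrices
to be constant in that direction as well. -/
theorem IsTorusLike.exists_constant_gauge {W : Matrix (Fin m) (Fin m) C⟦X⟧}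
    (hW : ∀ k, W.der (psDer (d k)) = 0) {B : Fin m → Matrix N N C⟦X⟧} {a : Matrix N N C⟦X⟧}
    (hF : ∀ i j, (B j).der (psDer (d i)) - (B i).der (psDer (d j)) + B i * B j - B j * B i
      = W i j • a)
    (ha : ∀ i, a.der (psDer (d i)) + B i * a - a * B i = 0)
    (hB : ∀ i, IsNilpotent ((B i).cf 0)) (hBd : ∀ i j, ((B i).cf 0).der (d j) = 0) :
    ∃ (G : Matrix N N C⟦X⟧) (B' : Fin m → Matrix N N C⟦X⟧) (a' : Matrix N N C⟦X⟧),
      G.cf 0 = 1 ∧ (∀ i, G.der (psDer (d i)) + B i * G = G * B' i) ∧ a * G = G * a' ∧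
      (∀ i j, (B' i).der (psDer (d j)) = 0) ∧ (∀ j, a'.der (psDer (d j)) = 0) := by
  have hcomm : ∀ i j x, psDer (d i) (psDer (d j) x) = psDer (d j) (psDer (d i) x) :=
    fun i j => psDer_comm (hT.comm i j)
  have claim : ∀ p ≤ m, ∃ (G : Matrix N N C⟦X⟧) (B' : Fin m → Matrix N N C⟦X⟧)
      (a' : Matrix N N C⟦X⟧), G.cf 0 = 1 ∧
      (∀ i, G.der (psDer (d i)) + B i * G = G * B' i) ∧ a * G = G * a' ∧
      (∀ i, ConstUpTo (fun j => psDer (d j)) p (B' i)) ∧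
      ConstUpTo (fun j => psDer (d j)) p a' := by
    intro p
    induction p with
    | zero =>
      exact fun _ => ⟨1, B, a, cf_zero_one, fun i => by simp [der_one], by simp,
        fun i j hj => absurd hj (Nat.not_lt_zero _), fun j hj => absurd hj (Nat.not_lt_zero _)⟩
    | succ p ih =>
      intro hp
      obtain ⟨G, B', a', hG0, hGB, hGa, hB', ha'⟩ := ih (by omega)
      let i : Fin m := ⟨p, by omega⟩
      have hB'0 : ∀ j, (B' j).cf 0 = (B j).cf 0 := by
        intro j
        have h := congrArg (Matrix.cf 0) (hGB j)
        rw [cf_add, cf_der, cf_zero_mul, cf_zero_mul, hG0, der_one] at h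
        simpa using h.symm
      obtain ⟨G₁, c, hG₁0, hG₁, hc, hG₁c⟩ := hT.exists_gauge_one i (b := B' i)
        (by rw [hB'0]; exact hB i) (by rw [hB'0]; exact hBd i i) (hB' i)
      have hdet := isUnit_det_of_cf_zero hG₁0
      have hdetG := isUnit_det_of_cf_zero hG0
      have hinv := mul_nonsing_inv _ hdet
      have hinv' := nonsing_inv_mul _ hdet
      let B'' : Fin m → Matrix N N C⟦X⟧ := fun j => G₁⁻¹ * (G₁.der (psDer (d j)) + B' j * G₁)
      let a'' : Matrix N N C⟦X⟧ := G₁⁻¹ * (a' * G₁)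
      have hG₁B : ∀ j, G₁.der (psDer (d j)) + B' j * G₁ = G₁ * B'' j := fun j => by
        simp only [B'', ← Matrix.mul_assoc, hinv, Matrix.one_mul]
      have hG₁a : a' * G₁ = G₁ * a'' := by
        simp only [a'', ← Matrix.mul_assoc, hinv, Matrix.one_mul]
      have hB''i : B'' i = c := by
        simp only [B'']
        rw [hG₁c, ← Matrix.mul_assoc, hinv', Matrix.one_mul]
      have hGG0 : (G * G₁).cf 0 = 1 := by rw [cf_zero_mul, hG0, hG₁0, Matrix.one_mul]
      have hGGB : ∀ j, (G * G₁).der (psDer (d j)) + B j * (G * G₁) = (G * G₁) * B'' j := by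
        intro j
        rw [Matrix.mul_assoc G G₁ (B'' j), ← hG₁B, der_mul, Matrix.mul_add, ← Matrix.mul_assoc G,
          ← hGB]
        noncomm_ring
      have hGGa : a * (G * G₁) = (G * G₁) * a'' := by
        rw [Matrix.mul_assoc G, ← hG₁a, ← Matrix.mul_assoc, hGa, Matrix.mul_assoc]
      have hdGG := isUnit_det_of_cf_zero hGG0
      have hcancel : ∀ M M' : Matrix N N C⟦X⟧, (G * G₁) * M = (G * G₁) * M' → M = M' := by
        intro M M' h
        have := congrArg ((G * G₁)⁻¹ * ·) h
        simpa only [← Matrix.mul_assoc, nonsing_inv_mul _ hdGG, Matrix.one_mul] using this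
      have hpar : ∀ j, a''.der (psDer (d j)) + B'' j * a'' - a'' * B'' j = 0 := fun j =>
        hcancel _ _ (by rw [gauge_parallel (hGGB j) hGGa, ha, Matrix.zero_mul, Matrix.mul_zero])
      have hcurv : ∀ j k, (B'' k).der (psDer (d j)) - (B'' j).der (psDer (d k))
          + B'' j * B'' k - B'' k * B'' j = W j k • a'' := fun j k =>
        hcancel _ _ (by
          rw [gauge_curvature (hcomm j k) (hGGB j) (hGGB k), hF, smul_mul_assoc, hGGa,
            mul_smul_comm])
      -- The new gauge is itself independent of the first p coordinates, so constancy in those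
      -- directions is not destroyed.
      have hB''c : ∀ j, ConstUpTo (fun j => psDer (d j)) p (B'' j) := fun j =>
        (ConstUpTo.inv hdet hG₁).mul ((hG₁.der hcomm j).add ((hB' j).mul hG₁))
      have ha''c : ConstUpTo (fun j => psDer (d j)) p a'' :=
        (ConstUpTo.inv hdet hG₁).mul (ha'.mul hG₁)
      have hc0 : IsNilpotent (c.cf 0) := by
        have h := congrArg (Matrix.cf 0) hG₁c
        rw [cf_add, cf_der, cf_zero_mul, cf_zero_mul, hG₁0, der_one, zero_add, Matrix.mul_one,
          Matrix.one_mul] at h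
        rw [← h, hB'0]
        exact hB i
      have ha''i : a''.der (psDer (d i)) = 0 := by
        refine hT.der_series_eq_zero i hc0 hc0 hc hc ?_
        rw [← hB''i, hpar, der_zero]
      have hB''j : ∀ j, (B'' j).der (psDer (d i)) = 0 := by
        intro j
        refine hT.der_series_eq_zero i hc0 hc0 hc hc ?_
        -- The curvature equation with B''_i = c; its right side is constant in direction i, because
        -- c, W and a'' are.
        have h1 : (B'' j).der (psDer (d i)) + c * B'' j - B'' j * c
            = W i j • a'' + c.der (psDer (d j)) := by
          rw [← hcurv i j, hB''i]
          abel
        rw [h1, der_add, der_comm (hcomm i j), hc, der_zero, add_zero]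
        ext x y
        have h2 : psDer (d i) (W i j) = 0 := congrFun (congrFun (hW i) i) j
        have h3 : psDer (d i) (a'' x y) = 0 := congrFun (congrFun ha''i x) y
        simp [Derivation.leibniz, h2, h3]
      refine ⟨G * G₁, B'', a'', hGG0, hGGB, hGGa, fun j k hk => ?_, fun k hk => ?_⟩
      · rcases Nat.lt_succ_iff_lt_or_eq.mp hk with h | h
        · exact hB''c j k h
        · obtain rfl : k = i := Fin.ext h
          exact hB''j j
      · rcases Nat.lt_succ_iff_lt_or_eq.mp hk with h | h
        · exact ha''c k h
        · obtain rfl : k = i := Fin.ext h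
          exact ha''i
  obtain ⟨G, B', a', h1, h2, h3, h4, h5⟩ := claim m le_rfl
  exact ⟨G, B', a', h1, h2, h3, fun i j => h4 i j j.2, fun j => h5 j j.2⟩

end Gauge

end

/-! ### Vanishing of the Ricci endomorphism as a formal power series in time. -/

section

open Matrix PowerSeries

section RankOne

variable {N K : Type*} [Fintype N] [CommRing K]

theorem rankOne_mul_left (M : Matrix N N K) {a : Matrix N N K}
    (h : ∀ p q r s, a p q * a r s = a p s * a r q) (p q r s : N) :
    (M * a) p q * (M * a) r s = (M * a) p s * (M * a) r q := by
  simp only [mul_apply, Finset.sum_mul_sum]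
  refine Finset.sum_congr rfl fun x _ => Finset.sum_congr rfl fun z _ => ?_
  linear_combination M p x * M r z * h x q z s

theorem rankOne_mul_right (M : Matrix N N K) {a : Matrix N N K}
    (h : ∀ p q r s, a p q * a r s = a p s * a r q) (p q r s : N) :
    (a * M) p q * (a * M) r s = (a * M) p s * (a * M) r q := by
  simp only [mul_apply, Finset.sum_mul_sum]
  rw [Finset.sum_comm]
  refine Finset.sum_congr rfl fun x _ => Finset.sum_congr rfl fun z _ => ?_
  linear_combination M z q * M x s * h p z r x

end RankOne

section Formal

set_option linter.unusedSectionVars false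

variable {C : Type*} [CommRing C] [Algebra ℝ C]

/-- The initial tractor connection has this form: it sends `Sum.inr 0` to `Sum.inl i`, sends each
`Sum.inl m` to a multiple of `Sum.inr 1`, and kills `Sum.inr 1`. It is thus strictly triangular. -/
theorem isNilpotent_offDiagonal {ι : Type*} [Fintype ι] [DecidableEq ι]
    (i : ι) (w : ι → C) :
    IsNilpotent (fromBlocks (0 : Matrix ι ι C) (of fun x => ![(1 : Matrix ι ι C) x i, 0])
      (of ![0, w]) (0 : Matrix (Fin 2) (Fin 2) C)) := by
  set c : Matrix ι (Fin 2) C := of fun x => ![(1 : Matrix ι ι C) x i, 0] with hc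
  set r : Matrix (Fin 2) ι C := of ![0, w] with hr
  have hcr : c * r = 0 := by
    ext x y
    simp [hc, hr, mul_apply, Fin.sum_univ_two]
  refine ⟨4, ?_⟩
  have h2 : fromBlocks 0 c r 0 * fromBlocks 0 c r 0 = fromBlocks 0 0 0 (r * c) := by
    rw [fromBlocks_multiply]
    simp [hcr]
  have h4 : r * c * (r * c) = 0 := by
    rw [Matrix.mul_assoc, ← Matrix.mul_assoc c, hcr, Matrix.zero_mul, Matrix.mul_zero]
  rw [show 4 = 2 + 2 from rfl, pow_add, pow_two, h2, fromBlocks_multiply]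
  simp [h4]

theorem der_tractorForm {ι : Type*} {δ : Derivation ℝ C C} {W : Matrix ι ι C}
    (h : W.der δ = 0) : (tractorForm W).der δ = 0 := by
  have h2 : δ 2 = 0 := by simpa using δ.map_natCast 2
  ext x y
  match x, y with
  | Sum.inl i, Sum.inl j =>
    have := congrFun (congrFun h i) j
    simpa [tractorForm] using this
  | Sum.inl i, Sum.inr j => simp [tractorForm]
  | Sum.inr i, Sum.inl j => simp [tractorForm]
  | Sum.inr i, Sum.inr j => fin_cases i <;> fin_cases j <;> simp [tractorForm, h2]

/-- A formal curve of connections of Ricci type on a torus that starts at the trivial connection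
has vanishing Ricci endomorphism. -/
theorem RicciTypeData.formal_eq_zero {n m : ℕ} (hn : 2 ≤ n) (hm : m = 2 * n)
    {d : Fin m → Derivation ℝ C C} (hT : IsTorusLike d)
    (D : RicciTypeData (Fin m) C⟦X⟧) (hd : D.d = fun i => psDer (d i))
    (hA0 : ∀ i, (D.A i).cf 0 = 0) (hP0 : D.P.cf 0 = 0) (ev : C →+* ℝ) :
    D.P.map (PowerSeries.map ev) = 0 := by
  have hcard : Fintype.card (Fin m) = 2 * n := by rw [Fintype.card_fin, hm]
  obtain ⟨u, hu⟩ := D.exists_covP_eq hn hcard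
  obtain ⟨f, hf⟩ := D.exists_cov_u hu hn hcard
  have hd' : ∀ i, D.d i = psDer (d i) := fun i => congrFun hd i
  have hdW : ∀ k, D.W.der (psDer (d k)) = 0 := fun k => by rw [← hd', D.dW]
  -- At time 0 both the connection matrices and P vanish, hence so does ∇P, and u is recovered from
  -- ∇P with the inverse of W.
  have hu0 : ∀ m, constantCoeff (u m) = 0 := by
    have h1 : ∀ k, (D.W * D.covP k).cf 0 = 0 := by
      intro k
      simp only [RicciTypeData.covP, cf_zero_mul, cf_add, cf_sub, hd', cf_der, hA0, hP0,
        der_zero, Matrix.mul_zero, sub_zero, add_zero]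
    intro m
    have h2 : ∀ k, constantCoeff (D.W k m) * constantCoeff (u m) = 0 := by
      intro k
      have h3 := congrArg constantCoeff (hu k m m)
      have h4 : constantCoeff ((D.W * D.covP k) m m) = 0 := by
        rw [← cf_zero_apply, h1]; rfl
      rw [h4, map_add, map_mul] at h3
      refine natCast_mul_cancel two_ne_zero ?_
      push_cast
      linear_combination -h3
    have h5 := congrArg constantCoeff (D.sum_V_W m m)
    rw [one_apply_eq, map_one, map_sum] at h5
    rw [← one_mul (constantCoeff (u m)), ← h5, Finset.sum_mul]
    exact Finset.sum_eq_zero fun k _ => by rw [map_mul, mul_assoc, h2, mul_zero]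
  set B := D.tractorConn u with hBdef
  set a := D.tractorEnd u f with hadef
  have hF : ∀ i j, (B j).der (psDer (d i)) - (B i).der (psDer (d j)) + B i * B j - B j * B i
      = D.W i j • a := by
    intro i j
    rw [← hd', ← hd']
    exact D.tractor_curvature hu hf i j
  have hcomm : ∀ i j x, psDer (d i) (psDer (d j) x) = psDer (d j) (psDer (d i) x) :=
    fun i j => psDer_comm (hT.comm i j)
  have ha : ∀ i, a.der (psDer (d i)) + B i * a - a * B i = 0 :=
    parallel_of_curvature hn hcard hcomm D.W_skew D.W_mul_V hdW hF
  have hB0 : ∀ i, (B i).cf 0 = fromBlocks (0 : Matrix (Fin m) (Fin m) C)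
      (of fun x => ![(1 : Matrix (Fin m) (Fin m) C) x i, 0])
      (of ![0, fun m => constantCoeff (RicciTypeData.half C⟦X⟧ * D.W i m)]) 0 := by
    intro i
    have hAe : ∀ x y, constantCoeff (D.A i x y) = 0 := fun x y => by
      rw [← cf_zero_apply, hA0]; rfl
    have hPe : ∀ x y, constantCoeff (D.P x y) = 0 := fun x y => by
      rw [← cf_zero_apply, hP0]; rfl
    ext x y
    rw [cf_zero_apply]
    match x, y with
    | Sum.inl x, Sum.inl y => exact hAe x y
    | Sum.inl x, Sum.inr 0 =>
      change constantCoeff ((1 : Matrix (Fin m) (Fin m) C⟦X⟧) x i)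
        = (1 : Matrix (Fin m) (Fin m) C) x i
      rw [one_apply, one_apply, apply_ite (f := constantCoeff), map_one, map_zero]
    | Sum.inl x, Sum.inr 1 => exact hPe x i
    | Sum.inr 0, Sum.inl y =>
      change constantCoeff (RicciTypeData.half C⟦X⟧ * (D.W * D.P) y i) = 0
      rw [map_mul, mul_apply, map_sum]
      simp [hPe]
    | Sum.inr 1, Sum.inl y => rfl
    | Sum.inr 0, Sum.inr 0 => exact map_zero _
    | Sum.inr 0, Sum.inr 1 => exact hu0 i
    | Sum.inr 1, Sum.inr 0 => exact map_zero _
    | Sum.inr 1, Sum.inr 1 => exact map_zero _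
  have hBnil : ∀ i, IsNilpotent ((B i).cf 0) := fun i => by
    rw [hB0]; exact isNilpotent_offDiagonal _ _
  have hBd : ∀ i j, ((B i).cf 0).der (d j) = 0 := by
    intro i j
    rw [hB0]
    ext x y
    match x, y with
    | Sum.inl x, Sum.inl y => simp
    | Sum.inl x, Sum.inr 0 =>
      change d j ((1 : Matrix (Fin m) (Fin m) C) x i) = 0
      exact congrFun (congrFun (der_one (d j)) x) i
    | Sum.inl x, Sum.inr 1 => simp
    | Sum.inr x, Sum.inl y =>
      fin_cases x
      · simp
      change d j (constantCoeff (RicciTypeData.half C⟦X⟧ * D.W i y)) = 0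
      rw [← coeff_zero_eq_constantCoeff_apply, ← coeff_psDer, Derivation.leibniz]
      have h1 : psDer (d j) (D.W i y) = 0 := congrFun (congrFun (hdW j) i) y
      have h2 : psDer (d j) (RicciTypeData.half C⟦X⟧) = 0 := (psDer (d j)).map_algebraMap _
      rw [h1, h2]
      simp
    | Sum.inr x, Sum.inr y => simp
  obtain ⟨G, b, a', hG0, hGB, hGa, hb, ha'⟩ := hT.exists_constant_gauge hdW hF ha hBnil hBd
  have hdet := isUnit_det_of_cf_zero hG0
  have hcancel : ∀ M M' : Matrix (Fin m ⊕ Fin 2) (Fin m ⊕ Fin 2) C⟦X⟧,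
      G * M = G * M' → M = M' := by
    intro M M' h
    have := congrArg (G⁻¹ * ·) h
    simpa only [← Matrix.mul_assoc, nonsing_inv_mul _ hdet, Matrix.one_mul] using this
  -- All derivatives are now zero, so parallelism and the curvature equation become the Heisenberg
  -- relations.
  have hab : ∀ i, a' * b i = b i * a' := by
    intro i
    have h := gauge_parallel (hGB i) hGa
    rw [ha, Matrix.zero_mul, ha', zero_add] at h
    have h2 := hcancel _ 0 (by rw [h, Matrix.mul_zero])
    exact (sub_eq_zero.mp h2).symm
  have hbb : ∀ i j, b i * b j - b j * b i = D.W i j • a' := by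
    intro i j
    apply hcancel
    have h := gauge_curvature (hcomm i j) (hGB i) (hGB j)
    rw [hF, hb, hb, sub_zero, zero_add, smul_mul_assoc, hGa] at h
    rw [h, mul_smul_comm]
  set T := tractorForm D.W with hTdef
  have hTd : ∀ i, T.der (psDer (d i)) = 0 := fun i => der_tractorForm (hdW i)
  have hBs : ∀ i, (B i)ᵀ * T + T * B i = 0 := D.tractorConn_skew
  set H := Gᵀ * T * G with hH
  -- T is parallel for B, so its transform H is parallel for b.
  have hdH : ∀ i, H.der (psDer (d i)) = (b i)ᵀ * H + H * b i := by
    intro i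
    have e1 : G.der (psDer (d i)) = G * b i - B i * G := by rw [← hGB]; abel
    have e2 : Gᵀ.der (psDer (d i)) = (b i)ᵀ * Gᵀ - Gᵀ * (B i)ᵀ := by
      rw [der_transpose, e1, transpose_sub, transpose_mul, transpose_mul]
    rw [hH, der_mul, der_mul, hTd, Matrix.mul_zero, add_zero, e1, e2]
    have e3 : T * B i = -((B i)ᵀ * T) := eq_neg_of_add_eq_zero_right (hBs i)
    have e4 : Gᵀ * T * (G * b i - B i * G) = Gᵀ * T * G * b i - Gᵀ * (T * B i) * G := by
      noncomm_ring
    rw [e4, e3]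
    noncomm_ring
  have hb0 : ∀ i, IsNilpotent ((b i).cf 0) := by
    intro i
    have h := congrArg (Matrix.cf 0) (hGB i)
    rw [cf_add, cf_der, cf_zero_mul, cf_zero_mul, hG0, der_one, zero_add, Matrix.mul_one,
      Matrix.one_mul] at h
    rw [← h]
    exact hBnil i
  -- H solves a Sylvester equation whose coefficients are nilpotent at time 0, so H is constant and
  -- each b_i is H-skew.
  have hbH : ∀ i, (b i)ᵀ * H + H * b i = 0 := by
    intro i
    rw [← hdH]
    refine hT.der_series_eq_zero i (b := -(b i)ᵀ) (c := b i) ?_ (hb0 i) ?_ (hb i i) ?_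
    · have h1 : (-(b i)ᵀ).cf 0 = -((b i).cf 0)ᵀ := by ext; simp [cf]
      rw [h1]
      obtain ⟨k, hk⟩ := hb0 i
      exact IsNilpotent.neg ⟨k, by rw [← transpose_pow, hk, transpose_zero]⟩
    · have h1 : (-(b i)ᵀ).der (psDer (d i)) = -((b i).der (psDer (d i)))ᵀ := by
        ext; simp
      rw [h1, hb, transpose_zero, neg_zero]
    · rw [hdH, neg_mul, add_assoc, add_sub_assoc, add_sub_assoc]
      simp [der_zero]
  have haH : a'ᵀ * H + H * a' = 0 := by
    have h1 : ∀ i j, D.W i j • (a'ᵀ * H + H * a') = 0 := by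
      intro i j
      have e : ∀ i M, (b i)ᵀ * (H * M) = -(H * b i * M) := fun i M => by
        rw [← Matrix.mul_assoc, eq_neg_of_add_eq_zero_left (hbH i), Matrix.neg_mul]
      have e' : ∀ i M, M * (b i)ᵀ * H = -(M * (H * b i)) := fun i M => by
        rw [Matrix.mul_assoc, eq_neg_of_add_eq_zero_left (hbH i), Matrix.mul_neg]
      rw [smul_add, ← smul_mul_assoc, ← mul_smul_comm, ← transpose_smul, ← hbb, transpose_sub,
        transpose_mul, transpose_mul, sub_mul, e', e', e, e]
      noncomm_ring
    let i : Fin m := ⟨0, by omega⟩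
    have h2 := D.sum_W_V i i
    rw [one_apply_eq] at h2
    rw [← one_smul C⟦X⟧ (a'ᵀ * H + H * a'), ← h2, Finset.sum_smul]
    exact Finset.sum_eq_zero fun j _ => by
      rw [mul_comm (D.W i j), mul_smul, h1, smul_zero]
  have hTt : Tᵀ = -T := by
    rw [hTdef, tractorForm, fromBlocks_transpose, fromBlocks_neg]
    congr 1
    · rw [transpose_neg, D.W_skew]
    · simp
    · simp
    · ext x y
      fin_cases x <;> fin_cases y <;> simp
  have hHt : Hᵀ = -H := by
    rw [hH, transpose_mul, transpose_mul, transpose_transpose, hTt]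
    noncomm_ring
  have ha'0 : a'.cf 0 = a.cf 0 := by
    have h := congrArg (Matrix.cf 0) hGa
    rw [cf_zero_mul, cf_zero_mul, hG0, Matrix.mul_one, Matrix.one_mul] at h
    exact h.symm
  -- At time 0 the gauge is trivial, and the entry is the product of the entry 2 of the tractor form
  -- and the entry 1 of a. So κ will be a unit among power series.
  have hκ : constantCoeff ((H * a') (Sum.inr 0) (Sum.inr 0)) = 2 := by
    have h1 : (H * a').cf 0 = T.cf 0 * a.cf 0 := by
      have h2 : Gᵀ.cf 0 = 1 := by
        have : Gᵀ.cf 0 = (G.cf 0)ᵀ := rfl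
        rw [this, hG0, transpose_one]
      rw [hH, cf_zero_mul, cf_zero_mul, cf_zero_mul, hG0, ha'0, h2, Matrix.mul_one, Matrix.one_mul]
    have h3 : constantCoeff ((H * a') (Sum.inr 0) (Sum.inr 0))
        = (T.cf 0 * a.cf 0) (Sum.inr 0) (Sum.inr 0) := by rw [← cf_zero_apply, h1]
    rw [h3, ← cf_zero_mul, cf_zero_apply, mul_apply, Fintype.sum_sum_type, Fin.sum_univ_two]
    simp [hTdef, tractorForm, hadef, RicciTypeData.tractorEnd]
    exact map_ofNat _ 2
  -- The rank statement requires a domain, which C⟦X⟧ need not be; evaluation lands in ℝ⟦X⟧.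
  let φ : C⟦X⟧ →+* ℝ⟦X⟧ := PowerSeries.map ev
  have hmap : ∀ M M' : Matrix (Fin m ⊕ Fin 2) (Fin m ⊕ Fin 2) C⟦X⟧,
      (M * M').map φ = M.map φ * M'.map φ := fun M M' => Matrix.map_mul
  have : CharZero ℝ⟦X⟧ := charZero_of_injective_algebraMap (R := ℝ) C_injective
  have hrank := heisenberg_center_rank_one (K := ℝ⟦X⟧) hn hcard (W := D.W.map φ)
    (V := D.V.map φ) (c := φ (RicciTypeData.half _)) (b := fun i => (b i).map φ)
    (a := a'.map φ) (H := H.map φ)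
    (by rw [← transpose_map, D.W_skew]; ext; simp)
    (by rw [← Matrix.map_mul, D.W_mul_V]; exact Matrix.map_one φ (map_zero _) (map_one _))
    (by rw [← map_ofNat φ 2, ← map_mul, RicciTypeData.two_mul_half, map_one])
    (by rw [← transpose_map, hHt]; ext; simp)
    (fun i => by
      rw [← transpose_map, ← hmap, ← hmap, ← Matrix.map_add _ (map_add φ), hbH]
      exact Matrix.map_zero _ (map_zero φ))
    (by
      rw [← transpose_map, ← hmap, ← hmap, ← Matrix.map_add _ (map_add φ), haH]
      exact Matrix.map_zero _ (map_zero φ))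
    (fun i j => by
      rw [← hmap, ← hmap, ← Matrix.map_sub _ (map_sub φ), hbb]
      ext
      simp)
    (fun i => by rw [← hmap, ← hmap, hab])
    (by
      rw [← hmap, PowerSeries.isUnit_iff_constantCoeff]
      have : constantCoeff ((H * a').map φ (Sum.inr 0) (Sum.inr 0))
          = ev (constantCoeff ((H * a') (Sum.inr 0) (Sum.inr 0))) := by
        rw [← coeff_zero_eq_constantCoeff_apply, ← coeff_zero_eq_constantCoeff_apply, map_apply,
          coeff_map]
      rw [this, hκ, map_ofNat]
      exact isUnit_iff_ne_zero.mpr two_ne_zero)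
  have haconj : a.map φ = G.map φ * a'.map φ * G⁻¹.map φ := by
    rw [← hmap, ← hmap, ← hGa, Matrix.mul_assoc, mul_nonsing_inv _ hdet, Matrix.mul_one]
  have hrank' : ∀ p q r s, a.map φ p q * a.map φ r s = a.map φ p s * a.map φ r q := by
    rw [haconj]
    exact rankOne_mul_right _ (rankOne_mul_left _ hrank)
  ext1 x y
  -- In the column `Sum.inr 0`, a has entry 1 in row `Sum.inr 1` and 0 in row `Sum.inl x`, so this
  -- minor reduces to P x y.
  have h := hrank' (Sum.inl x) (Sum.inl y) (Sum.inr 1) (Sum.inr 0)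
  simp only [map_apply, hadef, RicciTypeData.tractorEnd_ll, RicciTypeData.tractorEnd_10,
    RicciTypeData.tractorEnd_l0, map_one, map_zero, mul_one, zero_mul] at h
  exact h

end Formal

end

/-! ### Smooth periodic functions as a torus-like differential algebra. -/

section

open Matrix

section SegmentMean

universe u

variable {E F : Type u} [NormedAddCommGroup E] [NormedSpace ℝ E] [ProperSpace E]
  [NormedAddCommGroup F] [NormedSpace ℝ F]

/-- The mean of `c` with weight `w` over the segment from `x` to `x + v`. -/
noncomputable def segmentMean (w : ℝ → ℝ) (v : E) (c : E → F) (x : E) : F :=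
  ∫ s in (0 : ℝ)..1, w s • c (x + s • v)

theorem hasFDerivAt_segmentMean {w : ℝ → ℝ} (hw : Continuous w) (v : E) {c : E → F}
    (hc : ContDiff ℝ 1 c) (x : E) :
    HasFDerivAt (segmentMean w v c) (segmentMean w v (fderiv ℝ c) x) x := by
  have hc' : Continuous (fderiv ℝ c) := hc.continuous_fderiv one_ne_zero
  have hcont : Continuous fun q : E × ℝ => w q.2 • fderiv ℝ c (q.1 + q.2 • v) := by fun_prop
  obtain ⟨B, hB⟩ := ((isCompact_closedBall x 1).prod (isCompact_Icc (a := (0 : ℝ)) (b := 1))).exists_bound_of_continuousOn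
    hcont.continuousOn
  refine intervalIntegral.hasFDerivAt_integral_of_dominated_of_fderiv_le
    (F := fun x s => w s • c (x + s • v)) (F' := fun x s => w s • fderiv ℝ c (x + s • v))
    (s := Metric.closedBall x 1) (bound := fun _ => B) (Metric.closedBall_mem_nhds x one_pos)
    ?_ ?_ ?_ ?_ ?_ ?_
  · refine Filter.Eventually.of_forall fun y => Continuous.aestronglyMeasurable ?_
    have := hc.continuous
    fun_prop
  · apply Continuous.intervalIntegrable
    have := hc.continuous
    fun_prop
  · have : SecondCountableTopologyEither ℝ (E →L[ℝ] F) := secondCountableTopologyEither_of_left _ _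
    apply Continuous.aestronglyMeasurable
    fun_prop
  · refine Filter.Eventually.of_forall fun s hs y hy => ?_
    rw [Set.uIoc_of_le zero_le_one] at hs
    exact hB (y, s) ⟨hy, Set.Ioc_subset_Icc_self hs⟩
  · exact intervalIntegrable_const
  · refine Filter.Eventually.of_forall fun s _ y _ => ?_
    refine HasFDerivAt.const_smul ?_ _
    have h := (hc.differentiable one_ne_zero (y + s • v)).hasFDerivAt
    exact (hasFDerivAt_comp_add_right (s • v)).mpr h

theorem fderiv_segmentMean {w : ℝ → ℝ} (hw : Continuous w) (v : E) {c : E → F}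
    (hc : ContDiff ℝ 1 c) :
    fderiv ℝ (segmentMean w v c) = segmentMean w v (fderiv ℝ c) :=
  funext fun x => (hasFDerivAt_segmentMean hw v hc x).fderiv

/-- Differentiation commutes with the mean but changes the target to E →L[ℝ] F, so the induction on
the order runs over all F. Keeping E and F in one universe allows this. -/
theorem contDiff_segmentMean {w : ℝ → ℝ} (hw : Continuous w) (v : E) {c : E → F}
    (hc : ContDiff ℝ ∞ c) : ContDiff ℝ ∞ (segmentMean w v c) := by
  rw [contDiff_infty]
  intro n
  induction n generalizing F with
  | zero =>
    exact contDiff_zero.mpr (continuous_iff_continuousAt.mpr fun x =>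
      (hasFDerivAt_segmentMean hw v (hc.of_le (by simp)) x).continuousAt)
  | succ n ih =>
    have h1 : ContDiff ℝ 1 c := hc.of_le (by simp)
    refine (contDiff_succ_iff_fderiv (n := (n : ℕ∞ω))).mpr ⟨fun x =>
      (hasFDerivAt_segmentMean hw v h1 x).differentiableAt, by simp, ?_⟩
    rw [fderiv_segmentMean hw v h1]
    exact ih (hc.fderiv_right (by simp))

theorem fderiv_segmentMean_apply {w : ℝ → ℝ} (hw : Continuous w) (v : E) {c : E → F}
    (hc : ContDiff ℝ 1 c) (x y : E) :
    fderiv ℝ (segmentMean w v c) x y = ∫ s in (0 : ℝ)..1, w s • fderiv ℝ c (x + s • v) y := by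
  have hc' : Continuous (fderiv ℝ c) := hc.continuous_fderiv one_ne_zero
  rw [fderiv_segmentMean hw v hc, segmentMean, ContinuousLinearMap.intervalIntegral_apply]
  · rfl
  · apply Continuous.intervalIntegrable
    fun_prop

end SegmentMean

section PeriodicSmooth

variable {E : Type} [NormedAddCommGroup E] [NormedSpace ℝ E] {κ : Type*}

/-- The algebra of smooth functions with given periods. -/
def periodicSmooth (p : κ → E) : Subalgebra ℝ (E → ℝ) where
  carrier := {f | ContDiff ℝ ∞ f ∧ ∀ i x, f (x + p i) = f x}
  mul_mem' := fun hf hg => ⟨hf.1.mul hg.1, fun i x => by simp [hf.2 i x, hg.2 i x]⟩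
  add_mem' := fun hf hg => ⟨hf.1.add hg.1, fun i x => by simp [hf.2 i x, hg.2 i x]⟩
  algebraMap_mem' := fun r => ⟨contDiff_const, fun _ _ => rfl⟩

variable {p : κ → E}

theorem periodicSmooth.contDiff (f : periodicSmooth p) : ContDiff ℝ ∞ (f : E → ℝ) := f.2.1

theorem periodicSmooth.differentiable (f : periodicSmooth p) : Differentiable ℝ (f : E → ℝ) :=
  (contDiff f).differentiable (by simp)

theorem periodicSmooth.periodic (f : periodicSmooth p) (i : κ) (x : E) :
    (f : E → ℝ) (x + p i) = (f : E → ℝ) x := f.2.2 i x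

/-- Evaluation at a point. -/
def evalAt (p : κ → E) (x : E) : periodicSmooth p →ₐ[ℝ] ℝ :=
  (Pi.evalAlgHom ℝ (fun _ => ℝ) x).comp (periodicSmooth p).val

theorem periodicSmooth.ext_evalAt {f g : periodicSmooth p} (h : ∀ x, evalAt p x f = evalAt p x g) :
    f = g := Subtype.ext (funext h)

/-- The directional derivative along `v`, as a derivation of the algebra of periodic functions. -/
noncomputable def dirDer (p : κ → E) (v : E) :
    Derivation ℝ (periodicSmooth p) (periodicSmooth p) :=
  Derivation.mk'
    { toFun := fun f => ⟨fun x => fderiv ℝ (f : E → ℝ) x v,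
        ((periodicSmooth.contDiff f).fderiv_right (by simp)).clm_apply contDiff_const,
        fun i x => by
          have h : (fun y => (f : E → ℝ) (y + p i)) = f := funext (periodicSmooth.periodic f i)
          change fderiv ℝ (f : E → ℝ) (x + p i) v = fderiv ℝ (f : E → ℝ) x v
          rw [← fderiv_comp_add_right, h]⟩
      map_add' := fun f g => by
        ext x
        have h := fderiv_add (periodicSmooth.differentiable f x) (periodicSmooth.differentiable g x)
        exact congrArg (fun l => l v) h
      map_smul' := fun r f => by
        ext x
        have h := fderiv_const_smul (periodicSmooth.differentiable f x) r
        exact congrArg (fun l => l v) h }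
    (fun f g => by
      ext x
      have h := fderiv_mul (periodicSmooth.differentiable f x) (periodicSmooth.differentiable g x)
      exact congrArg (fun l => l v) h)

theorem dirDer_comm (v w : E) (f : periodicSmooth p) :
    dirDer p v (dirDer p w f) = dirDer p w (dirDer p v f) := by
  ext x
  have hf : ∀ y, ContDiffAt ℝ ∞ (f : E → ℝ) y := fun y => (periodicSmooth.contDiff f).contDiffAt
  have hd : DifferentiableAt ℝ (fderiv ℝ (f : E → ℝ)) x :=
    ((hf x).fderiv_right (m := ∞) (by simp)).differentiableAt (by simp)
  have h : ∀ w, fderiv ℝ (fun y => fderiv ℝ (f : E → ℝ) y w) x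
      = (fderiv ℝ (fderiv ℝ (f : E → ℝ)) x).flip w := by
    intro w
    rw [fderiv_clm_apply hd (differentiableAt_const w)]
    ext z
    simp [ContinuousLinearMap.flip_apply]
  change fderiv ℝ (fun y => fderiv ℝ (f : E → ℝ) y w) x v
    = fderiv ℝ (fun y => fderiv ℝ (f : E → ℝ) y v) x w
  rw [h, h]
  exact ((hf x).isSymmSndFDerivAt (by
    rw [minSmoothness_of_isRCLikeNormedField]
    exact WithTop.coe_le_coe.mpr le_top)) v w

theorem hasDerivAt_line (f : periodicSmooth p) (x v : E) (s : ℝ) :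
    HasDerivAt (fun s : ℝ => (f : E → ℝ) (x + s • v)) ((dirDer p v f : E → ℝ) (x + s • v)) s := by
  have h1 : HasDerivAt (fun s : ℝ => x + s • v) v s := by
    simpa using ((hasDerivAt_id s).smul_const v).const_add x
  exact (periodicSmooth.differentiable f (x + s • v)).hasFDerivAt.comp_hasDerivAt s h1

theorem continuous_line (f : periodicSmooth p) (x v : E) :
    Continuous fun s : ℝ => (f : E → ℝ) (x + s • v) :=
  (periodicSmooth.contDiff f).continuous.comp (by fun_prop)

/-- The first derivative is constant along each line in direction p_i, and its integral over one
period is zero. -/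
theorem dirDer_eq_zero (i : κ) (f : periodicSmooth p)
    (h : dirDer p (p i) (dirDer p (p i) f) = 0) : dirDer p (p i) f = 0 := by
  ext x
  have h1 : ∀ s : ℝ, (dirDer p (p i) f : E → ℝ) (x + s • p i) = (dirDer p (p i) f : E → ℝ) x := by
    intro s
    have := is_const_of_deriv_eq_zero
      (fun s => (hasDerivAt_line (dirDer p (p i) f) x (p i) s).differentiableAt)
      (fun s => by rw [(hasDerivAt_line (dirDer p (p i) f) x (p i) s).deriv, h]; rfl) s 0
    simpa using this
  have h2 := intervalIntegral.integral_eq_sub_of_hasDerivAt (a := 0) (b := 1)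
    (fun s _ => hasDerivAt_line f x (p i) s)
    ((continuous_line (dirDer p (p i) f) x (p i)).intervalIntegrable 0 1)
  simp only [h1, one_smul, zero_smul, add_zero, periodicSmooth.periodic, sub_self] at h2
  simpa using h2

variable [ProperSpace E]

/-- The weighted mean along a segment, on the algebra of periodic functions. -/
noncomputable def periodicMean {w : ℝ → ℝ} (hw : Continuous w) (v : E) (c : periodicSmooth p) :
    periodicSmooth p :=
  ⟨segmentMean w v c, contDiff_segmentMean hw v (periodicSmooth.contDiff c), fun i x => by
    simp only [segmentMean, add_right_comm x (p i), periodicSmooth.periodic]⟩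

theorem dirDer_periodicMean {w : ℝ → ℝ} (hw : Continuous w) (v y : E) (c : periodicSmooth p) :
    dirDer p y (periodicMean hw v c) = periodicMean hw v (dirDer p y c) := by
  ext x
  exact fderiv_segmentMean_apply hw v ((periodicSmooth.contDiff c).of_le (by simp)) x y

theorem isTorusLike_dirDer {m : ℕ} (p : Fin m → E) : IsTorusLike fun i => dirDer p (p i) where
  comm i j x := dirDer_comm _ _ x
  der_eq_zero i x := dirDer_eq_zero i x
  exists_primitive i c hc := by
    -- Integration by parts against the weight s - 1/2 over one period gives c minus its mean, the
    -- boundary terms adding up to c. This primitive is periodic by construction and depends on no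
    -- new coordinate.
    have hw : Continuous fun s : ℝ => s - 1 / 2 := by fun_prop
    have hm : ∀ x, (periodicMean hw (p i) (dirDer p (p i) c) : E → ℝ) x
        = (c : E → ℝ) x - ∫ s in (0 : ℝ)..1, (c : E → ℝ) (x + s • p i) := by
      intro x
      have h := intervalIntegral.integral_mul_deriv_eq_deriv_mul (a := 0) (b := 1)
        (u := fun s : ℝ => s - 1 / 2) (u' := fun _ => 1)
        (fun s _ => (hasDerivAt_id s).sub_const _) (fun s _ => hasDerivAt_line c x (p i) s)
        (continuous_const.intervalIntegrable _ _)
        ((continuous_line (dirDer p (p i) c) x (p i)).intervalIntegrable _ _)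
      simp only [one_smul, zero_smul, add_zero, periodicSmooth.periodic, one_mul] at h
      change ∫ s in (0 : ℝ)..1, (s - 1 / 2) * (dirDer p (p i) c : E → ℝ) (x + s • p i) = _
      rw [h]
      ring
    refine ⟨periodicMean hw (p i) c, fun j hj => ?_, ?_⟩
    · rw [dirDer_periodicMean, hc j hj]
      ext x
      simp [periodicMean, segmentMean]
    · have hw1 : Continuous fun _ : ℝ => (1 : ℝ) := continuous_const
      have h1 : dirDer p (p i) (periodicMean hw (p i) c) - c = -periodicMean hw1 (p i) c := by
        rw [dirDer_periodicMean]
        ext x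
        change (periodicMean hw (p i) (dirDer p (p i) c) : E → ℝ) x - (c : E → ℝ) x
          = -∫ s in (0 : ℝ)..1, (1 : ℝ) • (c : E → ℝ) (x + s • p i)
        rw [hm]
        simp
      rw [h1, map_neg, neg_eq_zero, dirDer_periodicMean]
      ext x
      have h2 := intervalIntegral.integral_eq_sub_of_hasDerivAt (a := 0) (b := 1)
        (fun s _ => hasDerivAt_line c x (p i) s)
        ((continuous_line (dirDer p (p i) c) x (p i)).intervalIntegrable 0 1)
      simp only [one_smul, zero_smul, add_zero, periodicSmooth.periodic, sub_self] at h2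
      change ∫ s in (0 : ℝ)..1, (1 : ℝ) • (dirDer p (p i) c : E → ℝ) (x + s • p i) = 0
      simpa using h2

end PeriodicSmooth

end

/-! ### Taylor expansion in time. -/

section

open Matrix PowerSeries

section Taylor

variable {S C : Type*} [CommRing S] [Algebra ℝ S] [CommRing C] [Algebra ℝ C]
  (δ : Derivation ℝ S S) (res : S →ₐ[ℝ] C)

/-- The formal Taylor series of `f` in the direction `δ`, with base point given by `res`. -/
noncomputable def taylorSeries (f : S) : C⟦X⟧ :=
  PowerSeries.mk fun k => ((k.factorial : ℝ)⁻¹) • res (δ^[k] f)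

theorem coeff_taylorSeries (f : S) (k : ℕ) :
    coeff k (taylorSeries δ res f) = ((k.factorial : ℝ)⁻¹) • res (δ^[k] f) := coeff_mk _ _

theorem succ_smul_coeff_taylorSeries (f : S) (k : ℕ) :
    ((k : C) + 1) * coeff (k + 1) (taylorSeries δ res f) = coeff k (taylorSeries δ res (δ f)) := by
  have h : ((k : C) + 1) = algebraMap ℝ C (k + 1) := by simp
  rw [coeff_taylorSeries, coeff_taylorSeries, h, ← Algebra.smul_def, smul_smul,
    Function.iterate_succ_apply, Nat.factorial_succ]
  congr 1
  push_cast
  field_simp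

/-- Expansion turns δ into the formal derivative of power series; comparing the two Leibniz rules
gives the coefficients by induction. Expansion is thus a ring homomorphism and can transport the
whole structure `RicciTypeData`. -/
theorem taylorSeries_mul (f g : S) :
    taylorSeries δ res (f * g) = taylorSeries δ res f * taylorSeries δ res g := by
  have hadd : ∀ k f g, coeff k (taylorSeries δ res (f + g))
      = coeff k (taylorSeries δ res f) + coeff k (taylorSeries δ res g) := by
    intro k f g
    simp only [coeff_taylorSeries, iterate_map_add, map_add, smul_add]
  have hder : ∀ f, taylorSeries δ res (δ f) = derivative C (taylorSeries δ res f) := by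
    intro f
    ext k
    rw [coeff_derivative, ← succ_smul_coeff_taylorSeries, mul_comm]
  ext k
  induction k generalizing f g with
  | zero => simp [coeff_taylorSeries, coeff_mul]
  | succ k ih =>
    have h1 := succ_smul_coeff_taylorSeries δ res (f * g) k
    rw [Derivation.leibniz, smul_eq_mul, smul_eq_mul, hadd, ih, ih, hder, hder, ← map_add] at h1
    have h2 : taylorSeries δ res f * derivative C (taylorSeries δ res g)
        + taylorSeries δ res g * derivative C (taylorSeries δ res f)
        = derivative C (taylorSeries δ res f * taylorSeries δ res g) := by
      rw [Derivation.leibniz, smul_eq_mul, smul_eq_mul]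
    rw [h2, coeff_derivative] at h1
    rw [← sub_eq_zero]
    refine natCast_mul_cancel (Nat.succ_ne_zero k) ?_
    push_cast
    linear_combination h1

/-- Formal Taylor expansion in the direction `δ`. -/
noncomputable def taylorHom : S →ₐ[ℝ] C⟦X⟧ :=
  AlgHom.ofLinearMap
    { toFun := taylorSeries δ res
      map_add' := fun f g => by
        ext k; simp only [coeff_taylorSeries, iterate_map_add, map_add, smul_add]
      map_smul' := fun r f => by
        ext k
        have h : ∀ k, δ^[k] (r • f) = r • δ^[k] f := fun k => by
          induction k with
          | zero => rfl
          | succ k ih => rw [Function.iterate_succ_apply', Function.iterate_succ_apply', ih,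
              Derivation.map_smul]
        simp only [RingHom.id_apply]
        rw [PowerSeries.coeff_smul, coeff_taylorSeries, coeff_taylorSeries, h, map_smul, smul_comm] }
    (by
      ext k
      change coeff k (taylorSeries δ res 1) = _
      rw [coeff_taylorSeries, coeff_one]
      cases k with
      | zero => simp
      | succ k =>
        have h : ∀ k, δ^[k] 0 = 0 := fun k => iterate_map_zero δ k
        simp [h])
    (taylorSeries_mul δ res)

theorem coeff_taylorHom (f : S) (k : ℕ) :
    coeff k (taylorHom δ res f) = ((k.factorial : ℝ)⁻¹) • res (δ^[k] f) :=
  coeff_taylorSeries δ res f k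

theorem taylorHom_der {e : Derivation ℝ S S} {e' : Derivation ℝ C C}
    (hcomm : ∀ f, δ (e f) = e (δ f)) (hres : ∀ f, res (e f) = e' (res f)) (f : S) :
    taylorHom δ res (e f) = psDer e' (taylorHom δ res f) := by
  ext k
  have h : ∀ k, δ^[k] (e f) = e (δ^[k] f) := fun k => by
    induction k with
    | zero => rfl
    | succ k ih => rw [Function.iterate_succ_apply', Function.iterate_succ_apply', ih, hcomm]
  rw [coeff_psDer, coeff_taylorHom, coeff_taylorHom, h, hres, Derivation.map_smul]

end Taylor

section Map

variable {ι S S' : Type*} [Fintype ι] [DecidableEq ι] [CommRing S] [Algebra ℝ S] [CommRing S']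
  [Algebra ℝ S']

/-- Change of the differential ring. -/
def RicciTypeData.map (D : RicciTypeData ι S) (T : S →ₐ[ℝ] S') (d' : ι → Derivation ℝ S' S')
    (hd' : ∀ i j x, d' i (d' j x) = d' j (d' i x)) (hT : ∀ i f, T (D.d i f) = d' i (T f)) :
    RicciTypeData ι S' :=
  have hder : ∀ i (M : Matrix ι ι S), (M.map T).der (d' i) = (M.der (D.d i)).map T :=
    fun i M => by ext; simp [hT]
  have hsymm : ∀ M N : Matrix ι ι S, (M * N).IsSymm → (M.map T * N.map T).IsSymm := fun M N h => by
    rw [← Matrix.map_mul, Matrix.IsSymm, ← transpose_map, h.eq]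
  { d := d'
    d_comm := hd'
    W := D.W.map T
    V := D.V.map T
    W_skew := by
      rw [← transpose_map, D.W_skew]
      ext; simp
    W_mul_V := by rw [← Matrix.map_mul, D.W_mul_V, Matrix.map_one _ (map_zero T) (map_one T)]
    dW := fun k => by rw [hder, D.dW, Matrix.map_zero _ (map_zero T)]
    dV := fun k => by rw [hder, D.dV, Matrix.map_zero _ (map_zero T)]
    A := fun i => (D.A i).map T
    A_symm := fun i a j => congrArg T (D.A_symm i a j)
    WA_symm := fun i => hsymm _ _ (D.WA_symm i)
    P := D.P.map T
    WP_symm := hsymm _ _ D.WP_symm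
    ricci := by
      have hR : (fun i j => ((D.A j).map T).der (d' i) - ((D.A i).map T).der (d' j)
          + (D.A i).map T * (D.A j).map T - (D.A j).map T * (D.A i).map T)
          = fun i j => (D.R i j).map T := by
        funext i j
        rw [hder, hder, ← Matrix.map_mul, ← Matrix.map_mul, RicciTypeData.R]
        ext
        simp [-Matrix.map_mul]
      rw [hR]
      intro i j a k
      have h := congrArg T (D.ricci i j a k)
      have hone : ∀ x y, T ((1 : Matrix ι ι S) x y) = (1 : Matrix ι ι S') x y := fun x y => by
        rw [one_apply, one_apply, apply_ite (f := T), map_one, map_zero]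
      rw [← Matrix.map_mul]
      simpa [-Matrix.map_mul, hone, RicciTypeData.R, map_ofNat T 2] using h }

end Map

section TimeDependent

variable {m : ℕ}

/-- The periods of functions on the torus. -/
def torusPeriod (i : Fin m) : Fin m → ℝ := Pi.single i 1

/-- The periods of time-dependent functions on the torus. -/
def spacetimePeriod (i : Fin m) : ℝ × (Fin m → ℝ) := (0, Pi.single i 1)

/-- Restriction of a time-dependent function to time zero. -/
def initialValue : periodicSmooth (spacetimePeriod (m := m)) →ₐ[ℝ]
    periodicSmooth (torusPeriod (m := m)) where
  toFun f := ⟨fun x => (f : ℝ × (Fin m → ℝ) → ℝ) (0, x),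
    (periodicSmooth.contDiff f).comp (contDiff_const.prodMk contDiff_id), fun i x => by
      have h := periodicSmooth.periodic f i (0, x)
      rwa [spacetimePeriod, Prod.mk_add_mk, add_zero] at h⟩
  map_one' := rfl
  map_mul' _ _ := rfl
  map_zero' := rfl
  map_add' _ _ := rfl
  commutes' _ := rfl

theorem initialValue_dirDer (i : Fin m) (f : periodicSmooth (spacetimePeriod (m := m))) :
    initialValue (dirDer _ (spacetimePeriod i) f) = dirDer _ (torusPeriod i) (initialValue f) := by
  ext x
  have h1 : HasFDerivAt (fun x : Fin m → ℝ => ((0 : ℝ), x)) (ContinuousLinearMap.inr ℝ ℝ _) x :=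
    hasFDerivAt_prodMk_right 0 x
  have h2 := (periodicSmooth.differentiable f (0, x)).hasFDerivAt.comp x h1
  change fderiv ℝ (f : ℝ × (Fin m → ℝ) → ℝ) (0, x) (spacetimePeriod i)
    = fderiv ℝ ((f : ℝ × (Fin m → ℝ) → ℝ) ∘ fun x => (0, x)) x (torusPeriod i)
  rw [h2.fderiv]
  rfl

/-- The time derivative. -/
noncomputable def timeDer (m : ℕ) :
    Derivation ℝ (periodicSmooth (spacetimePeriod (m := m)))
      (periodicSmooth (spacetimePeriod (m := m))) :=
  dirDer _ (1, 0)

theorem timeDer_comm (i : Fin m) (f : periodicSmooth (spacetimePeriod (m := m))) :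
    timeDer m (dirDer _ (spacetimePeriod i) f) = dirDer _ (spacetimePeriod i) (timeDer m f) :=
  dirDer_comm (1, 0) (spacetimePeriod i) f

theorem iteratedDeriv_time (f : periodicSmooth (spacetimePeriod (m := m))) (k : ℕ)
    (x : Fin m → ℝ) (s : ℝ) :
    iteratedDeriv k (fun s => (f : ℝ × (Fin m → ℝ) → ℝ) (s, x)) s
      = ((timeDer m)^[k] f : ℝ × (Fin m → ℝ) → ℝ) (s, x) := by
  induction k generalizing s with
  | zero => simp
  | succ k ih =>
    rw [iteratedDeriv_succ, funext ih, Function.iterate_succ_apply']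
    have h := hasDerivAt_line ((timeDer m)^[k] f) (0, x) (1, 0) s
    simp only [Prod.smul_mk, smul_eq_mul, mul_one, smul_zero, Prod.mk_add_mk, zero_add,
      add_zero] at h
    exact h.deriv

/-- A function that is analytic in time vanishes if its Taylor series at time zero does. -/
theorem eq_zero_of_taylorHom (f : periodicSmooth (spacetimePeriod (m := m))) (x : Fin m → ℝ)
    (hf : AnalyticOnNhd ℝ (fun s => (f : ℝ × (Fin m → ℝ) → ℝ) (s, x)) Set.univ)
    (h : ∀ k, (coeff k (taylorHom (timeDer m) initialValue f)).1 x = 0) (s : ℝ) :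
    (f : ℝ × (Fin m → ℝ) → ℝ) (s, x) = 0 := by
  have h1 : ∀ k, iteratedDeriv k (fun s => (f : ℝ × (Fin m → ℝ) → ℝ) (s, x)) 0 = 0 := by
    intro k
    have h2 := h k
    rw [coeff_taylorHom] at h2
    rw [iteratedDeriv_time]
    have h3 : ((k.factorial : ℝ)⁻¹) * ((timeDer m)^[k] f : ℝ × (Fin m → ℝ) → ℝ) (0, x) = 0 := h2
    exact (mul_eq_zero.mp h3).resolve_left (inv_ne_zero (by exact_mod_cast k.factorial_ne_zero))
  have h2 := (hf 0 trivial).hasFPowerSeriesAt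
  have h4 : HasFPowerSeriesAt (fun s => (f : ℝ × (Fin m → ℝ) → ℝ) (s, x))
      (0 : FormalMultilinearSeries ℝ ℝ ℝ) 0 := by
    have e : FormalMultilinearSeries.ofScalars ℝ (fun k => iteratedDeriv k
        (fun s => (f : ℝ × (Fin m → ℝ) → ℝ) (s, x)) 0 / (k.factorial : ℝ)) = 0 := by
      ext k
      simp [h1]
    rw [e] at h2
    exact h2
  have h3 := hf.eqOn_zero_of_preconnected_of_eventuallyEq_zero isPreconnected_univ
    (Set.mem_univ 0) h4.eventually_eq_zero
  exact h3 (Set.mem_univ s)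

/-- A curve of connections of Ricci type on a torus that starts at the trivial connection and has a
Ricci endomorphism analytic in time has vanishing Ricci endomorphism. -/
theorem RicciTypeData.eq_zero_of_analytic {n : ℕ} (hn : 2 ≤ n) (hm : m = 2 * n)
    (D : RicciTypeData (Fin m) (periodicSmooth (spacetimePeriod (m := m))))
    (hd : D.d = fun i => dirDer spacetimePeriod (spacetimePeriod i))
    (hA : ∀ i a j, initialValue (D.A i a j) = 0) (hP : ∀ a j, initialValue (D.P a j) = 0)
    (han : ∀ a j x, AnalyticOnNhd ℝ
      (fun s => (D.P a j : ℝ × (Fin m → ℝ) → ℝ) (s, x)) Set.univ) :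
    D.P = 0 := by
  have hT := isTorusLike_dirDer (torusPeriod (m := m))
  let T := taylorHom (timeDer m) (initialValue (m := m))
  have hT0 : ∀ f, constantCoeff (T f) = initialValue f := fun f => by
    rw [← coeff_zero_eq_constantCoeff_apply, coeff_taylorHom]
    simp
  have key : ∀ i f, T (D.d i f) = psDer (dirDer torusPeriod (torusPeriod i)) (T f) := fun i f => by
    rw [congrFun hd i]
    exact taylorHom_der (timeDer m) initialValue (timeDer_comm i) (initialValue_dirDer i) f
  let D' : RicciTypeData (Fin m) (periodicSmooth (torusPeriod (m := m)))⟦X⟧ :=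
    D.map T (fun i => psDer (dirDer torusPeriod (torusPeriod i)))
      (fun i j => psDer_comm (hT.comm i j)) key
  ext a j q
  obtain ⟨s, x⟩ := q
  refine eq_zero_of_taylorHom (D.P a j) x (han a j x) (fun k => ?_) s
  have h := D'.formal_eq_zero hn hm hT rfl
    (fun i => by ext1 a j; rw [cf_zero_apply]; exact (hT0 _).trans (hA i a j))
    (by ext1 a j; rw [cf_zero_apply]; exact (hT0 _).trans (hP a j))
    (evalAt torusPeriod x).toRingHom
  have h1 := congrArg (coeff k) (congrFun (congrFun h a) j)
  rw [map_apply, coeff_map] at h1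
  exact h1

end TimeDependent

end

/-! ### The Ricci type condition in a frame, and tensoriality of the curvature. -/

section

open Matrix

section WeylIdentity

set_option linter.unusedSectionVars false

variable {ι S : Type*} [Fintype ι] [CommRing S] [Algebra ℝ S]

/-- The curvature endomorphisms of the connection with connection matrices `A`. -/
def curvMatrix (d : ι → Derivation ℝ S S) (A : ι → Matrix ι ι S) (i j : ι) : Matrix ι ι S :=
  (A j).der (d i) - (A i).der (d j) + A i * A j - A j * A i

/-- The vanishing of the non-Ricci part of the lowered curvature `W * R i j`, for a Ricci
tensor `r`. -/
def WeylVanishes (n : ℕ) (W r : Matrix ι ι S) (R : ι → ι → Matrix ι ι S) : Prop :=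
  ∀ i j k l, 2 * ((n : S) + 1) * (W * R i j) l k = 2 * W i j * r k l + W i k * r j l
    + W i l * r j k - W j k * r i l - W j l * r i k

variable {n : ℕ} {W V r : Matrix ι ι S} {A : ι → Matrix ι ι S} {d : ι → Derivation ℝ S S}

theorem isSymm_mul_curvMatrix (hW : Wᵀ = -W) (hdW : ∀ k, W.der (d k) = 0)
    (hA : ∀ i, (W * A i).IsSymm) (i j : ι) : (W * curvMatrix d A i j).IsSymm := by
  have h1 : ∀ i j, (W * (A j).der (d i)).IsSymm := fun i j => by
    have h2 : W * (A j).der (d i) = (W * A j).der (d i) := by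
      rw [der_mul, hdW, Matrix.zero_mul, zero_add]
    rw [h2, Matrix.IsSymm, ← der_transpose, (hA j).eq]
  have h2 : ∀ i, (A i)ᵀ * W = -(W * A i) := fun i => by
    have h := (hA i).eq
    rw [transpose_mul, hW, Matrix.mul_neg] at h
    rw [← h, neg_neg]
  have h3 : ∀ i j, (W * (A i * A j))ᵀ = -(W * (A j * A i)) := fun i j => by
    rw [← Matrix.mul_assoc, transpose_mul, (hA i).eq, ← Matrix.mul_assoc, h2, Matrix.neg_mul,
      Matrix.mul_assoc]
  rw [curvMatrix, Matrix.mul_sub, Matrix.mul_add, Matrix.mul_sub, Matrix.IsSymm, transpose_sub,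
    transpose_add, transpose_sub, (h1 i j).eq, (h1 j i).eq, h3, h3]
  abel

variable [DecidableEq ι] [Nonempty ι]

/-- In the part skew in k, l only 2 W_ij (r_kl - r_lk) survives: W R_ij is symmetric, and the other
four terms are symmetric in k, l as two pairs. -/
theorem WeylVanishes.isSymm {R : ι → ι → Matrix ι ι S} (h : WeylVanishes n W r R)
    (hWV : W * V = 1) (hR : ∀ i j, (W * R i j).IsSymm) : r.IsSymm := by
  have h1 : ∀ i j k l, W i j * (r k l - r l k) = 0 := by
    intro i j k l
    refine natCast_mul_cancel two_ne_zero ?_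
    push_cast
    linear_combination h i j l k - h i j k l + 2 * ((n : S) + 1) * (hR i j).swap l k
  ext k l
  rw [transpose_apply, ← sub_eq_zero]
  obtain ⟨i⟩ := ‹Nonempty ι›
  have h2 : ∑ j, W i j * V j i = 1 := by rw [← mul_apply, hWV, one_apply_eq]
  rw [← one_mul (r l k - r k l), ← h2, Finset.sum_mul]
  exact Finset.sum_eq_zero fun j _ => by rw [mul_right_comm, h1, zero_mul]

/-- Raise the index l with V; c is the inverse of n + 1, so P is the Ricci tensor with an index
raised, divided by n + 1. -/
theorem WeylVanishes.ricciTypeIdentity {R : ι → ι → Matrix ι ι S} (h : WeylVanishes n W r R)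
    (hW : Wᵀ = -W) (hWV : W * V = 1) (hr : r.IsSymm) {c : S} (hc : ((n : S) + 1) * c = 1) :
    RicciTypeIdentity W (V * c • r) R := by
  have hVW : V * W = 1 := mul_eq_one_comm.mp hWV
  set Q := c • r with hQ
  have hQs : ∀ x y, Q x y = Q y x := fun x y => by simp [hQ, hr.swap x y]
  have h1 : ∀ i j k l, 2 * (W * R i j) l k = 2 * W i j * Q k l + W i k * Q j l
      + W i l * Q j k - W j k * Q i l - W j l * Q i k := by
    intro i j k l
    simp only [hQ, Matrix.smul_apply, smul_eq_mul]
    linear_combination c * h i j k l - 2 * (W * R i j) l k * hc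
  intro i j a k
  have h2 : 2 * R i j a k = ∑ l, V a l * (2 * (W * R i j) l k) := by
    have h3 : R i j a k = (V * (W * R i j)) a k := by
      rw [← Matrix.mul_assoc, hVW, Matrix.one_mul]
    rw [h3, mul_apply, Finset.mul_sum]
    exact Finset.sum_congr rfl fun l _ => by ring
  have h3 : ∀ x, ∑ l, V a l * W x l = -(1 : Matrix ι ι S) a x := fun x => by
    rw [← hVW, mul_apply, ← Finset.sum_neg_distrib]
    exact Finset.sum_congr rfl fun l _ => by rw [skew_swap hW x l]; ring
  have h4 : ∀ x, ∑ l, V a l * Q x l = (V * Q) a x := fun x => by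
    rw [mul_apply]
    exact Finset.sum_congr rfl fun l _ => by rw [hQs x l]
  have h5 : W * (V * Q) = Q := by rw [← Matrix.mul_assoc, hWV, Matrix.one_mul]
  rw [h2, h5]
  have h6 : ∑ l, V a l * (2 * (W * R i j) l k) = 2 * W i j * ∑ l, V a l * Q k l
      + W i k * ∑ l, V a l * Q j l + (∑ l, V a l * W i l) * Q j k
      - W j k * ∑ l, V a l * Q i l - (∑ l, V a l * W j l) * Q i k := by
    simp only [Finset.mul_sum, Finset.sum_mul, ← Finset.sum_add_distrib, ← Finset.sum_sub_distrib]
    exact Finset.sum_congr rfl fun l _ => by rw [h1]; ring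
  rw [h6, h3, h3, h4, h4, h4]
  ring

/-- The data of a connection whose curvature has vanishing non-Ricci part. -/
def RicciTypeData.ofWeyl (hd : ∀ i j x, d i (d j x) = d j (d i x)) (hW : Wᵀ = -W)
    (hWV : W * V = 1) (hdW : ∀ k, W.der (d k) = 0) (hdV : ∀ k, V.der (d k) = 0)
    (hA : ∀ i a j, A i a j = A j a i) (hWA : ∀ i, (W * A i).IsSymm)
    (h : WeylVanishes n W r (curvMatrix d A)) {c : S} (hc : ((n : S) + 1) * c = 1) :
    RicciTypeData ι S where
  d := d
  d_comm := hd
  W := W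
  V := V
  W_skew := hW
  W_mul_V := hWV
  dW := hdW
  dV := hdV
  A := A
  A_symm := hA
  WA_symm := hWA
  P := V * c • r
  WP_symm := by
    have hr := h.isSymm hWV (isSymm_mul_curvMatrix hW hdW hWA)
    rw [← Matrix.mul_assoc, hWV, Matrix.one_mul]
    exact hr.smul c
  ricci := h.ricciTypeIdentity hW hWV (h.isSymm hWV (isSymm_mul_curvMatrix hW hdW hWA)) hc

end WeylIdentity

namespace TorusConnection

variable {m : ℕ} {F : Type*} [NormedAddCommGroup F] [NormedSpace ℝ F]

theorem proj_surjective : Function.Surjective (proj (m := m)) := fun p => by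
  choose x hx using fun i => QuotientAddGroup.mk_surjective (p i)
  exact ⟨x, funext hx⟩

theorem proj_add_single (x : Vec m) (i : Fin m) : proj (x + Pi.single i 1) = proj x := by
  funext j
  by_cases h : j = i
  · subst h; simp [proj]
  · simp [proj, h]

theorem isSmooth_const (v : F) : IsSmooth (fun _ : Torus m => v) := contDiff_const

theorem isSmooth_invField (v : Vec m) : IsSmooth (invField v) := contDiff_const

theorem IsSmooth.comp_apply {X : Field m} (h : IsSmooth X) (i : Fin m) :
    IsSmooth fun p => X p i := contDiff_pi.mp h i

theorem along_proj (X : Field m) {f : Torus m → F} (hf : IsSmooth f) (x : Vec m) :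
    along X f (proj x) = fderiv ℝ (fun x => f (proj x)) x (X (proj x)) := by
  have h1 : HasDerivAt (fun s : ℝ => x + s • X (proj x)) (X (proj x)) 0 := by
    simpa using ((hasDerivAt_id (0 : ℝ)).smul_const (X (proj x))).const_add x
  have h2 : HasFDerivAt (fun x => f (proj x)) (fderiv ℝ (fun x => f (proj x)) x)
      (x + (0 : ℝ) • X (proj x)) := by
    rw [zero_smul, add_zero]
    exact (hf.differentiable (by simp) x).hasFDerivAt
  exact (h2.comp_hasDerivAt (0 : ℝ) h1).deriv

theorem field_eq_sum (X : Field m) :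
    X = ∑ i, (fun p => X p i) • invField (Pi.single i 1) := by
  funext p
  ext a
  simp [invField, Finset.sum_apply, Pi.single_apply]

theorem IsSmooth.sum {κ : Type*} {s : Finset κ} {X : κ → Torus m → F}
    (h : ∀ i ∈ s, IsSmooth (X i)) : IsSmooth (∑ i ∈ s, X i) := by
  have h1 : ContDiff ℝ ∞ fun x : Vec m => ∑ i ∈ s, X i (proj x) := ContDiff.sum h
  simpa [IsSmooth, Finset.sum_apply] using h1

theorem IsSmooth.smul {f : Torus m → ℝ} {X : Torus m → F} (hf : IsSmooth f) (hX : IsSmooth X) :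
    IsSmooth (f • X) := ContDiff.smul hf hX

namespace Connection

variable (D : Connection m)

theorem cov_zero_left {Y : Field m} (hY : IsSmooth Y) : D.cov 0 Y = 0 := by
  have h := D.smul_left 0 0 Y (isSmooth_const 0) (isSmooth_const 0) hY
  rwa [zero_smul, zero_smul] at h

theorem cov_zero_right {X : Field m} (hX : IsSmooth X) : D.cov X 0 = 0 := by
  have h := D.add_right X 0 0 hX (isSmooth_const 0) (isSmooth_const 0)
  rw [add_zero] at h
  exact left_eq_add.mp h

theorem cov_sum_left {κ : Type*} (s : Finset κ) {X : κ → Field m} {Y : Field m}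
    (hX : ∀ i, IsSmooth (X i)) (hY : IsSmooth Y) :
    D.cov (∑ i ∈ s, X i) Y = ∑ i ∈ s, D.cov (X i) Y := by
  classical
  induction s using Finset.induction_on with
  | empty => simp [D.cov_zero_left hY]
  | insert i s hi ih =>
    rw [Finset.sum_insert hi, Finset.sum_insert hi,
      D.add_left _ _ _ (hX i) (IsSmooth.sum fun j _ => hX j) hY, ih]

theorem cov_sum_right {κ : Type*} (s : Finset κ) {X : Field m} {Y : κ → Field m}
    (hX : IsSmooth X) (hY : ∀ i, IsSmooth (Y i)) :
    D.cov X (∑ i ∈ s, Y i) = ∑ i ∈ s, D.cov X (Y i) := by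
  classical
  induction s using Finset.induction_on with
  | empty => simp [D.cov_zero_right hX]
  | insert i s hi ih =>
    rw [Finset.sum_insert hi, Finset.sum_insert hi,
      D.add_right _ _ _ hX (hY i) (IsSmooth.sum fun j _ => hY j), ih]

/-- The Christoffel fields `∇_{e_i} e_j`. -/
def christoffelField (i j : Fin m) : Field m :=
  D.cov (invField (Pi.single i 1)) (invField (Pi.single j 1))

theorem isSmooth_christoffelField (i j : Fin m) : IsSmooth (D.christoffelField i j) :=
  D.smooth _ _ (isSmooth_invField _) (isSmooth_invField _)

/-- The Christoffel form `(u, v) ↦ ∇_u v` for translation-invariant fields. -/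
noncomputable def christoffel (x : Vec m) : Vec m →L[ℝ] Vec m →L[ℝ] Vec m :=
  ∑ i, ∑ j, (ContinuousLinearMap.proj (R := ℝ) (φ := fun _ : Fin m => ℝ) i).smulRight
    ((ContinuousLinearMap.proj (R := ℝ) (φ := fun _ : Fin m => ℝ) j).smulRight
      (D.christoffelField i j (proj x)))

theorem christoffel_apply (x u v : Vec m) :
    D.christoffel x u v = ∑ i, ∑ j, u i • v j • D.christoffelField i j (proj x) := by
  simp [christoffel]

theorem contDiff_christoffel : ContDiff ℝ ∞ D.christoffel :=
  ContDiff.sum fun i _ => ContDiff.sum fun j _ =>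
    contDiff_const.smulRight (contDiff_const.smulRight (D.isSmooth_christoffelField i j))

theorem cov_proj {X Y : Field m} (hX : IsSmooth X) (hY : IsSmooth Y) (x : Vec m) :
    D.cov X Y (proj x) = fderiv ℝ (fun x => Y (proj x)) x (X (proj x))
      + D.christoffel x (X (proj x)) (Y (proj x)) := by
  have hXi := fun i => hX.comp_apply i
  have hYi := fun i => hY.comp_apply i
  have h1 : D.cov X Y = ∑ i, (fun p => X p i) • D.cov (invField (Pi.single i 1)) Y := by
    conv_lhs => rw [field_eq_sum X]
    rw [D.cov_sum_left _ (fun i => (hXi i).smul (isSmooth_invField _)) hY]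
    exact Finset.sum_congr rfl fun i _ => D.smul_left _ _ _ (hXi i) (isSmooth_invField _) hY
  have h2 : ∀ i, D.cov (invField (Pi.single i 1)) Y
      = ∑ j, (along (invField (Pi.single i 1)) (fun p => Y p j) • invField (Pi.single j 1)
        + (fun p => Y p j) • D.christoffelField i j) := by
    intro i
    conv_lhs => rw [field_eq_sum Y]
    rw [D.cov_sum_right _ (isSmooth_invField _) fun j => (hYi j).smul (isSmooth_invField _)]
    exact Finset.sum_congr rfl fun j _ =>
      D.leibniz _ _ _ (hYi j) (isSmooth_invField _) (isSmooth_invField _)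
  have hYd : DifferentiableAt ℝ (fun x => Y (proj x)) x := hY.differentiable (by simp) x
  have h3 : ∀ i j, along (invField (Pi.single i 1)) (fun p => Y p j) (proj x)
      = fderiv ℝ (fun x => Y (proj x)) x (Pi.single i 1) j := by
    intro i j
    rw [along_proj _ (hYi j), fderiv_pi fun j => ((hYi j).differentiable (by simp) x)]
    rfl
  have h4 : fderiv ℝ (fun x => Y (proj x)) x (X (proj x))
      = ∑ i, X (proj x) i • fderiv ℝ (fun x => Y (proj x)) x (Pi.single i 1) := by
    conv_lhs => rw [pi_eq_sum_univ' (X (proj x))]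
    rw [map_sum]
    refine Finset.sum_congr rfl fun i _ => ?_
    rw [map_smul]
  rw [h1, h4, christoffel_apply, ← Finset.sum_add_distrib, Finset.sum_apply]
  refine Finset.sum_congr rfl fun i _ => ?_
  rw [Pi.smul_apply', h2, Finset.sum_apply, ← Finset.smul_sum, ← smul_add]
  congr 1
  simp only [Pi.add_apply, Pi.smul_apply', h3, Finset.sum_add_distrib]
  congr 1
  ext a
  simp [invField, Finset.sum_apply, Pi.single_apply]

/-- The curvature form in terms of the Christoffel form. -/
noncomputable def curvForm (x u v w : Vec m) : Vec m :=
  fderiv ℝ D.christoffel x u v w - fderiv ℝ D.christoffel x v u w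
    + D.christoffel x u (D.christoffel x v w) - D.christoffel x v (D.christoffel x u w)

theorem isSmooth_along {X : Field m} {f : Torus m → F} (hX : IsSmooth X) (hf : IsSmooth f) :
    IsSmooth (along X f) := by
  have h : (fun x => along X f (proj x))
      = fun x => fderiv ℝ (fun x => f (proj x)) x (X (proj x)) := funext (along_proj X hf)
  rw [IsSmooth, h]
  exact (ContDiff.fderiv_right (m := ∞) hf (by simp)).clm_apply hX

/-- Tensoriality: second derivatives of Z cancel by their symmetry, first derivatives of Z cancel
between the Christoffel terms, and derivatives of X and Y are absorbed by the bracket. -/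
theorem curv_proj {X Y Z : Field m} (hX : IsSmooth X) (hY : IsSmooth Y) (hZ : IsSmooth Z)
    (x : Vec m) :
    D.curv X Y Z (proj x) = D.curvForm x (X (proj x)) (Y (proj x)) (Z (proj x)) := by
  have hB : IsSmooth (bracket X Y) := (isSmooth_along hX hY).sub (isSmooth_along hY hX)
  have hB' : bracket X Y (proj x) = fderiv ℝ (fun x => Y (proj x)) x (X (proj x))
      - fderiv ℝ (fun x => X (proj x)) x (Y (proj x)) := by
    rw [bracket, Pi.sub_apply, along_proj X hY, along_proj Y hX]
  have hdX : HasFDerivAt (fun x => X (proj x)) (fderiv ℝ (fun x => X (proj x)) x) x :=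
    (ContDiff.differentiable hX (by simp) x).hasFDerivAt
  have hdY : HasFDerivAt (fun x => Y (proj x)) (fderiv ℝ (fun x => Y (proj x)) x) x :=
    (ContDiff.differentiable hY (by simp) x).hasFDerivAt
  have hdZ : HasFDerivAt (fun x => Z (proj x)) (fderiv ℝ (fun x => Z (proj x)) x) x :=
    (ContDiff.differentiable hZ (by simp) x).hasFDerivAt
  have hd2Z : HasFDerivAt (fderiv ℝ fun x => Z (proj x))
      (fderiv ℝ (fderiv ℝ fun x => Z (proj x)) x) x :=
    ((ContDiff.fderiv_right (m := ∞) hZ (by simp)).differentiable (by simp) x).hasFDerivAt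
  have hdA : HasFDerivAt D.christoffel (fderiv ℝ D.christoffel x) x :=
    (D.contDiff_christoffel.differentiable (by simp) x).hasFDerivAt
  have hsymm : IsSymmSndFDerivAt ℝ (fun x => Z (proj x)) x :=
    (ContDiff.contDiffAt hZ).isSymmSndFDerivAt (by
      rw [minSmoothness_of_isRCLikeNormedField]
      exact WithTop.coe_le_coe.mpr le_top)
  have key : ∀ {X Y : Field m}, IsSmooth X → IsSmooth Y →
      HasFDerivAt (fun x => Y (proj x)) (fderiv ℝ (fun x => Y (proj x)) x) x →
      D.cov X (D.cov Y Z) (proj x)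
        = fderiv ℝ (fderiv ℝ fun x => Z (proj x)) x (X (proj x)) (Y (proj x))
          + fderiv ℝ (fun x => Z (proj x)) x (fderiv ℝ (fun x => Y (proj x)) x (X (proj x)))
          + fderiv ℝ D.christoffel x (X (proj x)) (Y (proj x)) (Z (proj x))
          + D.christoffel x (fderiv ℝ (fun x => Y (proj x)) x (X (proj x))) (Z (proj x))
          + D.christoffel x (Y (proj x)) (fderiv ℝ (fun x => Z (proj x)) x (X (proj x)))
          + D.christoffel x (X (proj x)) (fderiv ℝ (fun x => Z (proj x)) x (Y (proj x)))
          + D.christoffel x (X (proj x)) (D.christoffel x (Y (proj x)) (Z (proj x))) := by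
    intro X Y hX hY hdY
    have h1 : (fun x => D.cov Y Z (proj x)) = fun x =>
        fderiv ℝ (fun x => Z (proj x)) x (Y (proj x))
          + D.christoffel x (Y (proj x)) (Z (proj x)) := funext (D.cov_proj hY hZ)
    have h2 := (hd2Z.clm_apply hdY).add ((hdA.clm_apply hdY).clm_apply hdZ)
    rw [D.cov_proj hX (D.smooth _ _ hY hZ), h1, D.cov_proj hY hZ]
    have h3 := h2.fderiv
    rw [show fderiv ℝ (fun x => fderiv ℝ (fun x => Z (proj x)) x (Y (proj x))
          + D.christoffel x (Y (proj x)) (Z (proj x))) x = _ from h3]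
    simp only [_root_.add_apply, ContinuousLinearMap.comp_apply,
      ContinuousLinearMap.flip_apply, map_add]
    abel
  rw [curv, Pi.sub_apply, Pi.sub_apply, key hX hY hdY, key hY hX hdX, D.cov_proj hB hZ, hB',
    curvForm, hsymm (X (proj x)) (Y (proj x))]
  simp only [map_sub, _root_.sub_apply]
  abel

theorem curvForm_eq_sum (x u v w : Vec m) :
    D.curvForm x u v w = ∑ i, ∑ j, ∑ k, (u i * v j * w k) •
      D.curvForm x (Pi.single i 1) (Pi.single j 1) (Pi.single k 1) := by
  have hb : ∀ u : Vec m, u = ∑ i, u i • (Pi.single i 1 : Vec m) := fun u => by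
    ext j; simp [Finset.sum_apply, Pi.single_apply]
  have h3 : ∀ u v w, D.curvForm x u v w = ∑ k, w k • D.curvForm x u v (Pi.single k 1) := by
    intro u v w
    conv_lhs => rw [hb w]
    simp only [curvForm, map_sum, map_smul, smul_sub, smul_add, Finset.sum_sub_distrib,
      Finset.sum_add_distrib]
  have h2 : ∀ u v w, D.curvForm x u v w = ∑ j, v j • D.curvForm x u (Pi.single j 1) w := by
    intro u v w
    conv_lhs => rw [hb v]
    simp only [curvForm, map_sum, map_smul, smul_sub, smul_add, Finset.sum_sub_distrib,
      Finset.sum_add_distrib, _root_.sum_apply, _root_.smul_apply]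
  have h1 : ∀ u v w, D.curvForm x u v w = ∑ i, u i • D.curvForm x (Pi.single i 1) v w := by
    intro u v w
    conv_lhs => rw [hb u]
    simp only [curvForm, map_sum, map_smul, smul_sub, smul_add, Finset.sum_sub_distrib,
      Finset.sum_add_distrib, _root_.sum_apply, _root_.smul_apply]
  rw [h1]
  refine Finset.sum_congr rfl fun i _ => ?_
  rw [h2, Finset.smul_sum]
  refine Finset.sum_congr rfl fun j _ => ?_
  rw [h3, Finset.smul_sum, Finset.smul_sum]
  exact Finset.sum_congr rfl fun k _ => by rw [smul_smul, smul_smul, mul_assoc]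

/-- A connection is flat if its curvature vanishes on translation-invariant fields. -/
theorem isFlat_of_invField (h : ∀ i j k, D.curv (invField (Pi.single i 1))
    (invField (Pi.single j 1)) (invField (Pi.single k 1)) = 0) : D.IsFlat := by
  intro X Y Z hX hY hZ
  funext p
  obtain ⟨x, rfl⟩ := proj_surjective p
  rw [D.curv_proj hX hY hZ, curvForm_eq_sum]
  refine Finset.sum_eq_zero fun i _ => Finset.sum_eq_zero fun j _ =>
    Finset.sum_eq_zero fun k _ => ?_
  have h1 := congrFun (h i j k) (proj x)
  rw [D.curv_proj (isSmooth_invField _) (isSmooth_invField _) (isSmooth_invField _)] at h1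
  have h2 : D.curvForm x (Pi.single i 1) (Pi.single j 1) (Pi.single k 1) = 0 := h1
  rw [h2, smul_zero]

end Connection

end TorusConnection

end

/-! ### Analytic families of connections defined for all times. -/

section

open Matrix

section AnalyticPeriodic

variable {E : Type} [NormedAddCommGroup E] [NormedSpace ℝ E] {κ : Type*}

/-- The subalgebra of real analytic periodic functions. -/
def periodicAnalytic (p : κ → E) : Subalgebra ℝ (periodicSmooth p) where
  carrier := {f | AnalyticOnNhd ℝ (f : E → ℝ) Set.univ}
  mul_mem' := fun hf hg => AnalyticOnNhd.mul hf hg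
  add_mem' := fun hf hg => AnalyticOnNhd.add hf hg
  algebraMap_mem' := fun _ => analyticOnNhd_const

theorem dirDer_mem_periodicAnalytic {p : κ → E} {f : periodicSmooth p}
    (hf : f ∈ periodicAnalytic p) (v : E) : dirDer p v f ∈ periodicAnalytic p := by
  have h1 : AnalyticOnNhd ℝ (fderiv ℝ (f : E → ℝ)) Set.univ := AnalyticOnNhd.fderiv hf
  exact ((ContinuousLinearMap.apply ℝ ℝ v).analyticOnNhd Set.univ).comp h1 (Set.mapsTo_univ _ _)

end AnalyticPeriodic

theorem fderiv_prod_right {m : ℕ} {f : ℝ × (Fin m → ℝ) → ℝ} {s : ℝ} {x : Fin m → ℝ}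
    (hf : DifferentiableAt ℝ f (s, x)) (v : Fin m → ℝ) :
    fderiv ℝ (fun x => f (s, x)) x v = fderiv ℝ f (s, x) (0, v) := by
  have h1 : HasFDerivAt (fun x : Fin m → ℝ => (s, x)) (ContinuousLinearMap.inr ℝ ℝ _) x :=
    hasFDerivAt_prodMk_right s x
  have h2 := hf.hasFDerivAt.comp x h1
  rw [show fderiv ℝ (fun x => f (s, x)) x = _ from h2.fderiv]
  rfl

namespace TorusConnection

namespace Connection

variable {m : ℕ} (D : Connection m)

/-- The matrix of `v ↦ ∇_{e_i} v` on translation-invariant fields. -/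
def christoffelMatrix (i : Fin m) (p : Torus m) : Matrix (Fin m) (Fin m) ℝ :=
  of fun a j => D.christoffelField i j p a

/-- The matrix of the curvature endomorphism `R(e_i, e_j)`. -/
noncomputable def curvEndo (i j : Fin m) (p : Torus m) : Matrix (Fin m) (Fin m) ℝ :=
  of fun a k => D.curv (invField (Pi.single i 1)) (invField (Pi.single j 1))
    (invField (Pi.single k 1)) p a

/-- The matrix of the Ricci tensor. -/
noncomputable def ricciMatrix (p : Torus m) : Matrix (Fin m) (Fin m) ℝ :=
  of fun j k => ∑ c, D.curvEndo j c p c k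

theorem along_const {F : Type*} [NormedAddCommGroup F] [NormedSpace ℝ F] (X : Field m) (v : F) :
    along X (fun _ => v) = 0 := by
  funext p
  exact deriv_const _ _

theorem bracket_invField (u v : Vec m) : bracket (invField u) (invField v) = 0 := by
  rw [bracket, show along (invField u) (invField v) = 0 from along_const _ v,
    show along (invField v) (invField u) = 0 from along_const _ u, sub_zero]

theorem cov_invField_proj (i : Fin m) {Y : Field m} (hY : IsSmooth Y) (x : Vec m) (a : Fin m) :
    D.cov (invField (Pi.single i 1)) Y (proj x) a
      = fderiv ℝ (fun x => Y (proj x) a) x (Pi.single i 1)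
        + ∑ b, D.christoffelMatrix i (proj x) a b * Y (proj x) b := by
  rw [D.cov_proj (isSmooth_invField _) hY, christoffel_apply,
    fderiv_pi fun j => ((hY.comp_apply j).differentiable (by simp) x), Pi.add_apply]
  congr 1
  simp [invField, christoffelMatrix, Finset.sum_apply, Pi.single_apply, ite_apply, mul_comm]

theorem curvEndo_proj (i j : Fin m) (x : Vec m) (a k : Fin m) :
    D.curvEndo i j (proj x) a k
      = fderiv ℝ (fun x => D.christoffelMatrix j (proj x) a k) x (Pi.single i 1)
        - fderiv ℝ (fun x => D.christoffelMatrix i (proj x) a k) x (Pi.single j 1)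
        + (D.christoffelMatrix i (proj x) * D.christoffelMatrix j (proj x)) a k
        - (D.christoffelMatrix j (proj x) * D.christoffelMatrix i (proj x)) a k := by
  have h : ∀ i j, D.cov (invField (Pi.single i 1)) (D.cov (invField (Pi.single j 1))
      (invField (Pi.single k 1))) (proj x) a
      = fderiv ℝ (fun x => D.christoffelMatrix j (proj x) a k) x (Pi.single i 1)
        + (D.christoffelMatrix i (proj x) * D.christoffelMatrix j (proj x)) a k := fun i j =>
    D.cov_invField_proj i (D.isSmooth_christoffelField j k) x a
  rw [curvEndo, of_apply, curv, bracket_invField, D.cov_zero_left (isSmooth_invField _), sub_zero,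
    Pi.sub_apply, Pi.sub_apply, h, h]
  ring

theorem bilinForm_single_right (Ω : LinearMap.BilinForm ℝ (Vec m)) (u : Vec m) (k : Fin m) :
    Ω u (Pi.single k 1) = ∑ a, u a * Ω (Pi.single a 1) (Pi.single k 1) := by
  have hb : u = ∑ i, u i • (Pi.single i 1 : Vec m) := by
    ext j; simp [Finset.sum_apply, Pi.single_apply]
  conv_lhs => rw [hb]
  simp

theorem isSymm_christoffelMatrix {Ω : LinearMap.BilinForm ℝ (Vec m)} (hΩ : Ω.IsAlt)
    (hD : D.Preserves Ω) (i : Fin m) (p : Torus m) :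
    (LinearMap.BilinForm.toMatrix' Ω * D.christoffelMatrix i p).IsSymm := by
  have h1 : ∀ j k, (LinearMap.BilinForm.toMatrix' Ω * D.christoffelMatrix i p) k j
      = -Ω (D.christoffelField i j p) (Pi.single k 1) := by
    intro j k
    rw [bilinForm_single_right, mul_apply, ← Finset.sum_neg_distrib]
    refine Finset.sum_congr rfl fun a _ => ?_
    rw [LinearMap.BilinForm.toMatrix'_apply, ← hΩ.neg_eq (Pi.single k 1)]
    simp only [christoffelMatrix, of_apply]
    ring
  ext j k
  rw [transpose_apply, h1, h1]
  have h := hD (invField (Pi.single i 1)) (invField (Pi.single j 1)) (invField (Pi.single k 1))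
    (isSmooth_invField _) (isSmooth_invField _) (isSmooth_invField _) p
  rw [show (fun q => Ω (invField (Pi.single j 1) q) (invField (Pi.single k 1) q))
    = fun _ => Ω (Pi.single j 1) (Pi.single k 1) from rfl, along_const] at h
  have h2 := hΩ.neg_eq (Pi.single j 1) (D.christoffelField i k p)
  have h3 : (0 : ℝ) = Ω (D.christoffelField i j p) (Pi.single k 1)
    + Ω (Pi.single j 1) (D.christoffelField i k p) := h
  linarith

theorem christoffelMatrix_swap (hD : D.TorsionFree) (i a j : Fin m) (p : Torus m) :
    D.christoffelMatrix i p a j = D.christoffelMatrix j p a i := by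
  have h := hD (invField (Pi.single i 1)) (invField (Pi.single j 1)) (isSmooth_invField _)
    (isSmooth_invField _)
  rw [bracket_invField, sub_eq_zero] at h
  exact congrFun (congrFun h p) a

theorem weylVanishes {n : ℕ} (D : Connection (2 * n)) {Ω : LinearMap.BilinForm ℝ (Vec (2 * n))}
    (hΩ : Ω.IsAlt) (hD : D.IsRicciType Ω) (p : Torus (2 * n)) :
    WeylVanishes n (LinearMap.BilinForm.toMatrix' Ω) (D.ricciMatrix p)
      fun i j => D.curvEndo i j p := by
  intro i j k l
  have h := hD (invField (Pi.single i 1)) (invField (Pi.single j 1)) (invField (Pi.single k 1))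
    (invField (Pi.single l 1)) (isSmooth_invField _) (isSmooth_invField _) (isSmooth_invField _)
    (isSmooth_invField _) p
  -- The lowered index sits in the first slot of W but in the second slot of Ω; hence the sign.
  have h1 : Ω (D.curv (invField (Pi.single i 1)) (invField (Pi.single j 1))
      (invField (Pi.single k 1)) p) (Pi.single l 1)
      = -(LinearMap.BilinForm.toMatrix' Ω * D.curvEndo i j p) l k := by
    rw [bilinForm_single_right, mul_apply, ← Finset.sum_neg_distrib]
    refine Finset.sum_congr rfl fun a _ => ?_
    rw [LinearMap.BilinForm.toMatrix'_apply, ← hΩ.neg_eq (Pi.single a 1)]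
    simp only [curvEndo, of_apply]
    ring
  have h2 : ∀ j k, D.ricci (invField (Pi.single j 1)) (invField (Pi.single k 1)) p
      = D.ricciMatrix p j k := fun _ _ => rfl
  have h3 : ∀ i, invField (Pi.single i 1) p = (Pi.single i 1 : Vec (2 * n)) := fun _ => rfl
  have h4 : ((n : ℝ) + 1) ≠ 0 := by positivity
  rw [weylPart, ricciPart] at h
  simp only [h1, h2, h3, ← LinearMap.BilinForm.toMatrix'_apply] at h
  field_simp at h
  linear_combination -h

end Connection

section Family

variable {m n : ℕ} {D : ℝ → Connection m}

/-- The Christoffel symbols of a family of connections as time-dependent periodic functions. -/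
def christoffelSymbol (hD : ∀ i a j, AnalyticOnNhd ℝ
      (fun q : ℝ × Vec m => (D q.1).christoffelMatrix i (proj q.2) a j) Set.univ)
    (i : Fin m) : Matrix (Fin m) (Fin m) (periodicSmooth (spacetimePeriod (m := m))) :=
  of fun a j => ⟨fun q => (D q.1).christoffelMatrix i (proj q.2) a j, (hD i a j).contDiff,
    fun k q => by
      have h : (q + spacetimePeriod k) = (q.1, q.2 + Pi.single k 1) :=
        Prod.ext (add_zero q.1) rfl
      rw [h]
      change (D q.1).christoffelMatrix i (proj (q.2 + Pi.single k 1)) a j = _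
      rw [proj_add_single]⟩

variable (hD : ∀ i a j, AnalyticOnNhd ℝ
      (fun q : ℝ × Vec m => (D q.1).christoffelMatrix i (proj q.2) a j) Set.univ)

theorem evalAt_christoffelSymbol (s : ℝ) (x : Vec m) (i : Fin m) :
    (christoffelSymbol hD i).map (evalAt _ (s, x)) = (D s).christoffelMatrix i (proj x) := rfl

theorem evalAt_curvMatrix (s : ℝ) (x : Vec m) (i j : Fin m) :
    (curvMatrix (fun i => dirDer _ (spacetimePeriod i)) (christoffelSymbol hD) i j).map
      (evalAt _ (s, x)) = (D s).curvEndo i j (proj x) := by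
  have h1 : ∀ i j a k, evalAt _ (s, x) (dirDer _ (spacetimePeriod i) (christoffelSymbol hD j a k))
      = fderiv ℝ (fun x => (D s).christoffelMatrix j (proj x) a k) x (Pi.single i 1) :=
    fun i j a k => (fderiv_prod_right
      (periodicSmooth.differentiable (christoffelSymbol hD j a k) (s, x)) (Pi.single i 1)).symm
  have h2 : ∀ i j, ((christoffelSymbol hD i) * (christoffelSymbol hD j)).map (evalAt _ (s, x))
      = (D s).christoffelMatrix i (proj x) * (D s).christoffelMatrix j (proj x) := fun i j => by
    rw [Matrix.map_mul, evalAt_christoffelSymbol, evalAt_christoffelSymbol]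
  ext a k
  rw [Connection.curvEndo_proj, ← h1, ← h1, ← h2, ← h2]
  simp only [curvMatrix, map_apply, Matrix.sub_apply, Matrix.add_apply, map_sub, map_add, der_apply]

include hD in
/-- An analytic family of symplectic connections of Ricci type, defined for all times, whose initial
member is the standard connection is flat. -/
theorem curvEndo_eq_zero (hn : 2 ≤ n) (hm : m = 2 * n) {W : Matrix (Fin m) (Fin m) ℝ}
    (hW : Wᵀ = -W) (hdet : IsUnit W.det) (htorsion : ∀ s, (D s).TorsionFree)
    (hsymm : ∀ s i p, (W * (D s).christoffelMatrix i p).IsSymm)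
    (hweyl : ∀ s p, WeylVanishes n W ((D s).ricciMatrix p) fun i j => (D s).curvEndo i j p)
    (h0 : (D 0).IsStandard) (s : ℝ) (p : Torus m) (i j : Fin m) : (D s).curvEndo i j p = 0 := by
  let S := periodicSmooth (spacetimePeriod (m := m))
  let ev : ℝ × Vec m → S →ₐ[ℝ] ℝ := evalAt spacetimePeriod
  let ofReal : Matrix (Fin m) (Fin m) ℝ → Matrix (Fin m) (Fin m) S := fun M => M.map (algebraMap ℝ S)
  have hext : ∀ M N : Matrix (Fin m) (Fin m) S, (∀ s x, M.map (ev (s, x)) = N.map (ev (s, x))) →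
      M = N := fun M N h => by
    ext1 a k
    exact periodicSmooth.ext_evalAt fun q => congrFun (congrFun (h q.1 q.2) a) k
  have hevW : ∀ q M, (ofReal M).map (ev q) = M := fun _ _ => rfl
  let d : Fin m → Derivation ℝ S S := fun i => dirDer spacetimePeriod (spacetimePeriod i)
  let A := christoffelSymbol hD
  let r : Matrix (Fin m) (Fin m) S := of fun j k => ∑ c, curvMatrix d A j c c k
  have hR : ∀ s x i j, (curvMatrix d A i j).map (ev (s, x)) = (D s).curvEndo i j (proj x) :=
    evalAt_curvMatrix hD
  have hr : ∀ s x, r.map (ev (s, x)) = (D s).ricciMatrix (proj x) := fun s x => by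
    ext j k
    simp only [r, map_apply, of_apply, map_sum, Connection.ricciMatrix, ← hR]
  have hder : ∀ M k, (ofReal M).der (d k) = 0 := fun M k => by
    ext1 a b
    exact (d k).map_algebraMap _
  have hne : Nonempty (Fin m) := ⟨⟨0, by omega⟩⟩
  have hn1 : ((n : ℝ) + 1) ≠ 0 := by positivity
  have hweyl' : WeylVanishes n (ofReal W) r (curvMatrix d A) := by
    intro i j k l
    refine periodicSmooth.ext_evalAt fun q => ?_
    have h := hweyl q.1 (proj q.2) i j k l
    simp only [← hR, ← hr] at h
    have h1 : ev q ((ofReal W * curvMatrix d A i j) l k)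
        = (W * (curvMatrix d A i j).map (ev q)) l k := by
      conv_rhs => rw [← hevW q W, ← Matrix.map_mul]
      rfl
    change ev q _ = ev q _
    simp only [map_sub, map_add, map_mul, map_one, map_natCast, map_ofNat, h1]
    exact h
  let D' : RicciTypeData (Fin m) S := RicciTypeData.ofWeyl (d := d) (W := ofReal W)
    (V := ofReal W⁻¹) (r := r) (A := A) (c := algebraMap ℝ S ((n : ℝ) + 1)⁻¹)
    (fun i j => dirDer_comm _ _)
    (hext _ _ fun s x => hW)
    (hext _ _ fun s x => by
      rw [Matrix.map_mul, hevW, hevW, mul_nonsing_inv _ hdet,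
        Matrix.map_one _ (map_zero _) (map_one _)])
    (hder W) (hder W⁻¹)
    (fun i a j => periodicSmooth.ext_evalAt fun q =>
      (D q.1).christoffelMatrix_swap (htorsion q.1) i a j (proj q.2))
    (fun i => hext _ _ fun s x => by
      rw [transpose_map, Matrix.map_mul, hevW]
      exact hsymm s i (proj x))
    hweyl'
    (by
      rw [show ((n : S) + 1) = algebraMap ℝ S ((n : ℝ) + 1) by simp, ← map_mul,
        mul_inv_cancel₀ hn1, map_one])
  have hA0 : ∀ i a j, initialValue (A i a j) = 0 := fun i a j => by
    refine periodicSmooth.ext_evalAt fun x => ?_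
    exact congrFun (congrFun (h0 (Pi.single i 1) (Pi.single j 1)) (proj x)) a
  -- Restriction to time 0 commutes with the spatial derivatives, so the initial curvature, and with
  -- it P, is computed from the vanishing initial Christoffel symbols.
  have hR0 : ∀ i j a k, initialValue (curvMatrix d A i j a k) = 0 := fun i j a k => by
    simp only [curvMatrix, Matrix.sub_apply, Matrix.add_apply, der_apply, mul_apply, map_sub,
      map_add, map_sum, map_mul, d, initialValue_dirDer, hA0]
    simp
  have hPdef : ∀ a j, D'.P a j = ∑ l, algebraMap ℝ S (W⁻¹ a l)
      * (algebraMap ℝ S ((n : ℝ) + 1)⁻¹ * ∑ c, curvMatrix d A l c c j) := fun _ _ => rfl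
  have hAan : ∀ i a j, A i a j ∈ periodicAnalytic spacetimePeriod := hD
  have hRan : ∀ i j a k, curvMatrix d A i j a k ∈ periodicAnalytic spacetimePeriod :=
    fun i j a k => by
      simp only [curvMatrix, Matrix.sub_apply, Matrix.add_apply, der_apply, mul_apply]
      exact sub_mem (add_mem (sub_mem (dirDer_mem_periodicAnalytic (hAan _ _ _) _)
        (dirDer_mem_periodicAnalytic (hAan _ _ _) _))
        (sum_mem fun b _ => mul_mem (hAan _ _ _) (hAan _ _ _)))
        (sum_mem fun b _ => mul_mem (hAan _ _ _) (hAan _ _ _))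
  have hPan : ∀ a j, D'.P a j ∈ periodicAnalytic spacetimePeriod := fun a j => by
    rw [hPdef]
    exact sum_mem fun l _ => mul_mem (Subalgebra.algebraMap_mem _ _)
      (mul_mem (Subalgebra.algebraMap_mem _ _) (sum_mem fun c _ => hRan _ _ _ _))
  have hP := D'.eq_zero_of_analytic hn hm rfl hA0
    (fun a j => by rw [hPdef]; simp [hR0])
    (fun a j x => by
      have h1 : AnalyticOnNhd ℝ (fun s : ℝ => (s, x)) Set.univ :=
        analyticOnNhd_id.prod analyticOnNhd_const
      exact AnalyticOnNhd.comp (hPan a j) h1 (Set.mapsTo_univ _ _))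
  obtain ⟨x, rfl⟩ := proj_surjective p
  ext a k
  -- With P = 0 the Ricci type identity says that twice the curvature is zero.
  have h := D'.ricci i j a k
  rw [hP] at h
  simp only [Matrix.zero_apply, mul_zero, zero_mul, sub_zero, add_zero] at h
  have h2 : curvMatrix d A i j a k = 0 :=
    natCast_mul_cancel two_ne_zero (by push_cast; exact h)
  rw [← hR, map_apply, h2, map_zero]
  rfl

end Family

end TorusConnection

end

/-! ### Analyticity of the curvature in the parameter, and the theorem on an interval. -/

namespace TorusConnection

theorem IsAnalyticCurve.christoffelMatrix {m : ℕ} {I : Set ℝ} {D : ℝ → Connection m}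
    (h : IsAnalyticCurve I D) (i a j : Fin m) :
    AnalyticOnNhd ℝ (fun q : ℝ × Vec m => (D q.1).christoffelMatrix i (proj q.2) a j)
      (I ×ˢ Set.univ) :=
  ((ContinuousLinearMap.proj (R := ℝ) (φ := fun _ : Fin m => ℝ) a).analyticOnNhd Set.univ).comp
    (h (invField (Pi.single i 1)) (invField (Pi.single j 1)) analyticOnNhd_const
      analyticOnNhd_const) (Set.mapsTo_univ _ _)

/-- The curvature of an analytic curve of connections is analytic in the parameter. -/
theorem IsAnalyticCurve.curvEndo {m : ℕ} {I : Set ℝ} {D : ℝ → Connection m}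
    (h : IsAnalyticCurve I D) (hI : IsOpen I) (i j a k : Fin m) (x : Vec m) :
    AnalyticOnNhd ℝ (fun t => (D t).curvEndo i j (proj x) a k) I := by
  have hline : AnalyticOnNhd ℝ (fun t : ℝ => (t, x)) I :=
    analyticOnNhd_id.prod analyticOnNhd_const
  have hmaps : Set.MapsTo (fun t : ℝ => (t, x)) I (I ×ˢ (Set.univ : Set (Vec m))) :=
    fun t ht => ⟨ht, trivial⟩
  have h1 : ∀ i a j, AnalyticOnNhd ℝ (fun t => (D t).christoffelMatrix i (proj x) a j) I :=
    fun i a j => (h.christoffelMatrix i a j).comp hline hmaps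
  have h2 : ∀ i j, AnalyticOnNhd ℝ (fun t => fderiv ℝ (fun q : ℝ × Vec m =>
      (D q.1).christoffelMatrix j (proj q.2) a k) (t, x) (0, Pi.single i 1)) I := fun i j =>
    ((ContinuousLinearMap.apply ℝ ℝ ((0, Pi.single i 1) : ℝ × Vec m)).analyticOnNhd Set.univ).comp
      ((h.christoffelMatrix j a k).fderiv.comp hline hmaps) (Set.mapsTo_univ _ _)
  have h3 : ∀ i j, AnalyticOnNhd ℝ (fun t => fderiv ℝ (fun x =>
      (D t).christoffelMatrix j (proj x) a k) x (Pi.single i 1)) I := fun i j =>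
    (h2 i j).congr hI fun t ht => (fderiv_prod_right
      (h.christoffelMatrix j a k (t, x) ⟨ht, trivial⟩).differentiableAt (Pi.single i 1)).symm
  have h4 : ∀ i j, AnalyticOnNhd ℝ (fun t => ((D t).christoffelMatrix i (proj x)
      * (D t).christoffelMatrix j (proj x)) a k) I := fun i j => by
    simp only [Matrix.mul_apply]
    exact Finset.analyticOnNhd_fun_sum _ fun b _ => (h1 i a b).mul (h1 j b k)
  simp only [Connection.curvEndo_proj]
  exact (((h3 i j).sub (h3 j i)).add (h4 i j)).sub (h4 j i)

end TorusConnection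

theorem mainTheorem2 (n : ℕ) (hn : 2 ≤ n)
    (Ω : LinearMap.BilinForm ℝ (TorusConnection.Vec (2 * n)))
    (hΩalt : Ω.IsAlt) (hΩnd : Ω.Nondegenerate)
    (I : Set ℝ) (hIopen : IsOpen I) (hIint : I.OrdConnected) (hI0 : (0 : ℝ) ∈ I)
    (D : ℝ → TorusConnection.Connection (2 * n))
    (hanalytic : TorusConnection.IsAnalyticCurve I D)
    (hsympl : ∀ t ∈ I, (D t).IsSymplectic Ω)
    (hstandard : (D 0).IsStandard)
    (hRicci : ∀ t ∈ I, (D t).IsRicciType Ω) :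
    ∀ t ∈ I, (D t).IsFlat := by
  obtain ⟨δ, hδ, hball⟩ := Metric.isOpen_iff.mp hIopen 0 hI0
  -- The substitution t = (δ/2) sin s is analytic, fixes 0 and maps all of ℝ into I, so the curve in
  -- s is defined for all times.
  have hmem : ∀ s, δ / 2 * Real.sin s ∈ I := fun s => hball (by
    rw [Metric.mem_ball, dist_zero_right, Real.norm_eq_abs, abs_mul, abs_of_pos (half_pos hδ)]
    calc δ / 2 * |Real.sin s| ≤ δ / 2 * 1 := by gcongr; exact Real.abs_sin_le_one s
      _ < δ := by linarith)
  have hW : (LinearMap.BilinForm.toMatrix' Ω).transpose = -LinearMap.BilinForm.toMatrix' Ω := by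
    ext i j
    simp only [Matrix.transpose_apply, Matrix.neg_apply, LinearMap.BilinForm.toMatrix'_apply]
    exact (hΩalt.neg_eq _ _).symm
  have hdet : IsUnit (LinearMap.BilinForm.toMatrix' Ω).det :=
    isUnit_iff_ne_zero.mpr (Matrix.nondegenerate_iff_det_ne_zero.mp
      (LinearMap.BilinForm.nondegenerate_toMatrix'_iff.mpr hΩnd))
  have hflow : AnalyticOnNhd ℝ (fun q : ℝ × TorusConnection.Vec (2 * n) =>
      (δ / 2 * Real.sin q.1, q.2)) Set.univ :=
    (analyticOnNhd_const.mul (Real.analyticOnNhd_sin.comp analyticOnNhd_fst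
      (Set.mapsTo_univ _ _))).prod analyticOnNhd_snd
  have hflat : ∀ s p i j, (D (δ / 2 * Real.sin s)).curvEndo i j p = 0 :=
    TorusConnection.curvEndo_eq_zero (D := fun s => D (δ / 2 * Real.sin s))
      (fun i a j => (hanalytic.christoffelMatrix i a j).comp hflow
        fun q _ => ⟨hmem q.1, trivial⟩) hn rfl hW hdet (fun s => (hsympl _ (hmem s)).1)
      (fun s i p => (D _).isSymm_christoffelMatrix hΩalt (hsympl _ (hmem s)).2 i p)
      (fun s p => (D _).weylVanishes hΩalt (hRicci _ (hmem s)) p)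
      (by simpa using hstandard)
  have hzero : ∀ i j a k x, ∀ t ∈ I, (D t).curvEndo i j (TorusConnection.proj x) a k = 0 := by
    intro i j a k x
    -- The curvature is analytic in t on the interval I, so vanishing near 0 suffices; for |t| < δ/2
    -- the substitution is inverted by arcsin.
    refine (hanalytic.curvEndo hIopen i j a k x).eqOn_zero_of_preconnected_of_eventuallyEq_zero
      hIint.isPreconnected hI0 ?_
    filter_upwards [Metric.ball_mem_nhds (0 : ℝ) (half_pos hδ)] with t ht
    rw [Metric.mem_ball, dist_zero_right, Real.norm_eq_abs, abs_lt] at ht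
    have h1 : -1 ≤ t / (δ / 2) := by rw [le_div_iff₀ (half_pos hδ)]; linarith
    have h2 : t / (δ / 2) ≤ 1 := by rw [div_le_iff₀ (half_pos hδ)]; linarith
    have h := hflat (Real.arcsin (t / (δ / 2))) (TorusConnection.proj x) i j
    rw [Real.sin_arcsin h1 h2, mul_div_cancel₀ _ (half_pos hδ).ne'] at h
    rw [h]
    rfl
  intro t ht
  refine (D t).isFlat_of_invField fun i j k => ?_
  funext p
  obtain ⟨x, rfl⟩ := TorusConnection.proj_surjective p
  ext a
  exact hzero i j a k x t ht
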